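/- Let $(M,F)$ and $(\bar M,\bar F)$ be smooth Finsler manifolds of dimension $n\ge 2$: $F\colon TM\to[0,\infty)$ is smooth on the set $TM_0$ of non-zero tangent vectors, positively homogeneous of degree one ($F(x,\lambda y)=\lambda F(x,y)$ for $\lambda>0$), and its fundamental tensor $g_{ij}(x,y)=\frac12\,\partial^2F^2/\partial y^i\partial y^j$ is positive definite on $TM_0$; likewise $\bar F$, with fundamental tensor $\bar g$. For a curve $c$ with $\dot c\ne0$ let $\nabla_{\dot c}$ be the Cartan covariant derivative along $c$ with line element $(c,\dot c)$, which in local coordinates is $$(\nabla_{\dot c}X)^i=\dot X^i+\big(\Gamma^i_{jk}\dot x^k+C^i_{jk}(\ddot x^k+N^k_l\dot x^l)\big)X^j ,$$ where, at $(x,\dot x)$, $G^i=\frac14g^{il}\big(\frac{\partial^2F^2}{\partial x^m\partial y^l}y^m-\frac{\partial F^2}{\partial x^l}\big)$, $N^i_j=\frac{\partial G^i}{\partial y^j}$, $\frac{\delta}{\delta x^j}=\frac{\partial}{\partial x^j}-N^i_j\frac{\partial}{\partial y^i}$, $\Gamma^i_{jk}=\frac12g^{ih}\big(\frac{\delta g_{hk}}{\delta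 x^j}+\frac{\delta g_{hj}}{\delta x^k}-\frac{\delta g_{jk}}{\delta x^h}\big)$ and $C^i_{hk}=\frac12g^{im}\frac{\partial g_{mk}}{\partial y^h}$. A geodesic circle is a smooth curve $c(s)$ on an open interval, parametrized by arc length ($F(c,c')=1$), whose first Frenet curvature $k_1=|\nabla_{c'}c'|$ is constant and whose second Frenet curvature vanishes: $k_2=|\nabla_{c'}e_2+k_1c'|=0$ with $e_2=k_1^{-1}\nabla_{c'}c'$ (for a geodesic, $k_1=0$, one puts $k_2=0$); norms are taken with respect to $g_{(c,c')}$. Let $\varphi\colon M\to\bar M$ be a smooth local diffeomorphism that preserves geodesic circles: whenever $c$ is a geodesic circle of $(M,F)$, the curve $\varphi\circ c$, reparametrized by its $\bar F$-arc length with the same orientation, is a geodesic circle of $(\bar M,\bar F)$. Then $\varphi$ is conformal: there is a smooth function $\sigma\colon M\to\mathbb R$ with $\varphi^*\bar g=e^{2\sigma}g$, that is, $$\bar g_{d\varphi_x(y)}\big(d\varphi_x(u),d\varphi_x(v)\big)=e^{2\sigma(x)}\,g_{(x,y)}(u,v)\qquad(x\in M,\ y,u,v\in T_xM,\ y\neq0).$$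 Consequently a local diffeomorphism is concircular (that is, conformal and preserving geodesic circles) if and only if it preserves geodesic circles, so that the conformality assumption in the definition of concircular transformations is redundant. -/

import Mathlib

open scoped Manifold ContDiff

noncomputable section

namespace Finsler

/-- The model space `ℝⁿ`. -/
abbrev E (n : ℕ) : Type := EuclideanSpace ℝ (Fin n)

/-! ### Finsler structures -/

/-- The fundamental tensor `g_y(u, v) = ½ ∂²(F²)/∂u∂v (x, y)` of a function `F` on `TM`, the
derivatives being taken inside the vector space `T_xM`. -/
def fundamentalTensor {n : ℕ} {M : Type*} [TopologicalSpace M] [ChartedSpace (E n) M]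
    (F : TangentBundle 𝓘(ℝ, E n) M → ℝ) (x : M) (y u v : TangentSpace 𝓘(ℝ, E n) x) : ℝ :=
  (1 / 2) * fderiv ℝ (fun z : E n => fderiv ℝ (fun w : E n => F ⟨x, w⟩ ^ 2) z u) y v

/-- A Finsler structure: a nonnegative function on `TM`, smooth on the slit tangent bundle,
positively homogeneous of degree one, with positive definite fundamental tensor. -/
structure FinslerStructure (n : ℕ) (M : Type*) [TopologicalSpace M] [ChartedSpace (E n) M]
    [IsManifold 𝓘(ℝ, E n) ∞ M] where
  /-- the underlying function on the tangent bundle -/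
  F : TangentBundle 𝓘(ℝ, E n) M → ℝ
  nonneg : ∀ v, 0 ≤ F v
  smooth : ContMDiffOn 𝓘(ℝ, E n).tangent 𝓘(ℝ, ℝ) ∞ F {v | v.2 ≠ 0}
  homog : ∀ (x : M) (y : TangentSpace 𝓘(ℝ, E n) x) (r : ℝ), 0 < r → F ⟨x, r • y⟩ = r * F ⟨x, y⟩
  posDef : ∀ (x : M) (y v : TangentSpace 𝓘(ℝ, E n) x), y ≠ 0 → v ≠ 0 →
    0 < fundamentalTensor F x y v v

/-! ### Local formulas of the Cartan connection

Here `L x y` is the expression of a Finsler structure in local coordinates `(xⁱ, yⁱ)`. -/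

namespace Local

variable {n : ℕ}

/-- `∂f/∂xⁱ` -/
def dx (i : Fin n) (f : E n → E n → ℝ) (x y : E n) : ℝ :=
  fderiv ℝ (fun z => f z y) x (EuclideanSpace.single i 1)

/-- `∂f/∂yⁱ` -/
def dy (i : Fin n) (f : E n → E n → ℝ) (x y : E n) : ℝ :=
  fderiv ℝ (fun z => f x z) y (EuclideanSpace.single i 1)

/-- `L²` -/
def sq (L : E n → E n → ℝ) (x y : E n) : ℝ := L x y ^ 2

/-- `g_{ij} = ½ ∂²L²/∂yⁱ∂yʲ` -/
def g (L : E n → E n → ℝ) (i j : Fin n) (x y : E n) : ℝ :=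
  (1 / 2) * dy i (dy j (sq L)) x y

/-- `g^{ij}`, the inverse matrix of `g_{ij}` -/
def gInv (L : E n → E n → ℝ) (i j : Fin n) (x y : E n) : ℝ :=
  ((Matrix.of fun a b : Fin n => g L a b x y)⁻¹) i j

/-- The spray coefficients `Gⁱ = ¼ g^{il} (∂²L²/∂xᵐ∂yˡ yᵐ - ∂L²/∂xˡ)`. -/
def G (L : E n → E n → ℝ) (i : Fin n) (x y : E n) : ℝ :=
  (1 / 4) * ∑ l, gInv L i l x y * ((∑ m, dx m (dy l (sq L)) x y * y m) - dx l (sq L) x y)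

/-- The nonlinear connection `Nⁱ_j = ∂Gⁱ/∂yʲ`. -/
def N (L : E n → E n → ℝ) (i j : Fin n) (x y : E n) : ℝ := dy j (G L i) x y

/-- The horizontal derivative `δf/δxʲ = ∂f/∂xʲ - Nⁱ_j ∂f/∂yⁱ`. -/
def δ (L : E n → E n → ℝ) (j : Fin n) (f : E n → E n → ℝ) (x y : E n) : ℝ :=
  dx j f x y - ∑ i, N L i j x y * dy i f x y

/-- `Γⁱ_{jk} = ½ g^{ih} (δg_{hk}/δxʲ + δg_{hj}/δxᵏ - δg_{jk}/δxʰ)` -/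
def Γ (L : E n → E n → ℝ) (i j k : Fin n) (x y : E n) : ℝ :=
  (1 / 2) * ∑ h, gInv L i h x y *
    (δ L j (g L h k) x y + δ L k (g L h j) x y - δ L h (g L j k) x y)

/-- The Cartan torsion tensor `Cⁱ_{hk} = ½ g^{im} ∂g_{mk}/∂yʰ`. -/
def C (L : E n → E n → ℝ) (i h k : Fin n) (x y : E n) : ℝ :=
  (1 / 2) * ∑ m, gInv L i m x y * dy h (g L m k) x y

/-- The connection form `ω_jⁱ = Γⁱ_{jk} dxᵏ + Cⁱ_{jk} δyᵏ`, with `δyᵏ = dyᵏ + Nᵏ_l dxˡ`, of the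
Cartan connection at `(x, y)`, evaluated on the vector `(a, b) = aᵏ ∂/∂xᵏ + bᵏ ∂/∂yᵏ`. -/
def connForm (L : E n → E n → ℝ) (i j : Fin n) (x y a b : E n) : ℝ :=
  ∑ k, (Γ L i j k x y * a k + C L i j k x y * (b k + ∑ l, N L k l x y * a l))

/-- The Cartan covariant derivative of the vector field `X` along the curve `x` at time `t`,
with line element `(x, ẋ)`: `δXⁱ/dt = dXⁱ/dt + ω_jⁱ(ẋ, ẍ) Xʲ`. -/
def covDeriv (L : E n → E n → ℝ) (x X : ℝ → E n) (t : ℝ) : E n :=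
  WithLp.toLp 2 fun i => deriv X t i +
    ∑ j, connForm L i j (x t) (deriv x t) (deriv x t) (deriv (deriv x) t) * X t j

end Local

/-! ### Curves in a Finsler manifold -/

section Curves

variable {n : ℕ} {M : Type*} [TopologicalSpace M] [ChartedSpace (E n) M]
  [IsManifold 𝓘(ℝ, E n) ∞ M]

/-- The expression of `F` in the coordinates `(xⁱ, yⁱ)` given by the preferred chart at `p`. -/
def localExpr (F : TangentBundle 𝓘(ℝ, E n) M → ℝ) (p : M) (x y : E n) : ℝ :=
  F ⟨(extChartAt 𝓘(ℝ, E n) p).symm x,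
    mfderiv 𝓘(ℝ, E n) 𝓘(ℝ, E n) (extChartAt 𝓘(ℝ, E n) p).symm x y⟩

/-- The velocity vector of a curve. -/
def velocity (c : ℝ → M) (t : ℝ) : TangentSpace 𝓘(ℝ, E n) (c t) :=
  mfderiv 𝓘(ℝ, ℝ) 𝓘(ℝ, E n) c t (1 : ℝ)

/-- The Cartan covariant derivative `∇_ċ X` at time `t` of a vector field `X` along a curve `c`.
It is computed in the preferred chart at the point `c t`, and carried back to `T_{c(t)}M`. -/
def covDeriv (Φ : FinslerStructure n M) (c : ℝ → M) (X : ∀ t, TangentSpace 𝓘(ℝ, E n) (c t))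
    (t : ℝ) : TangentSpace 𝓘(ℝ, E n) (c t) :=
  (mfderiv 𝓘(ℝ, E n) 𝓘(ℝ, E n) (extChartAt 𝓘(ℝ, E n) (c t)) (c t)).inverse
    (Local.covDeriv (localExpr Φ.F (c t)) (fun τ => extChartAt 𝓘(ℝ, E n) (c t) (c τ))
      (fun τ => mfderiv 𝓘(ℝ, E n) 𝓘(ℝ, E n) (extChartAt 𝓘(ℝ, E n) (c t)) (c τ) (X τ)) t)

/-- The length of `v ∈ T_{c(t)}M` for the scalar product `g` determined by the tangent vector
`ċ(t)`. -/
def normAlong (Φ : FinslerStructure n M) (c : ℝ → M) (t : ℝ)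
    (v : TangentSpace 𝓘(ℝ, E n) (c t)) : ℝ :=
  √(fundamentalTensor Φ.F (c t) (velocity c t) v v)

/-- The first Frenet curvature `k₁ = |∇_{c'} c'|` of a unit speed curve. -/
def firstCurvature (Φ : FinslerStructure n M) (c : ℝ → M) (t : ℝ) : ℝ :=
  normAlong Φ c t (covDeriv Φ c (velocity c) t)

/-- The second Frenet vector `e₂ = k₁⁻¹ ∇_{c'} c'` of a unit speed curve. -/
def secondFrenetVector (Φ : FinslerStructure n M) (c : ℝ → M) (t : ℝ) :
    TangentSpace 𝓘(ℝ, E n) (c t) :=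
  (firstCurvature Φ c t)⁻¹ • covDeriv Φ c (velocity c) t

/-- The second Frenet curvature `k₂ = |∇_{c'} e₂ + k₁ c'|` of a unit speed curve. For a geodesic,
that is, if `k₁` vanishes identically, `e₂` and `k₂` are zero. -/
def secondCurvature (Φ : FinslerStructure n M) (c : ℝ → M) (t : ℝ) : ℝ :=
  normAlong Φ c t
    (covDeriv Φ c (secondFrenetVector Φ c) t + firstCurvature Φ c t • velocity c t)

/-- `c`, restricted to the open interval `I`, is a geodesic circle parametrized by arc length:
a smooth unit speed curve with constant first and vanishing second Frenet curvature. -/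
structure IsGeodesicCircle (Φ : FinslerStructure n M) (c : ℝ → M) (I : Set ℝ) : Prop where
  isOpen : IsOpen I
  ordConnected : I.OrdConnected
  smooth : ContMDiffOn 𝓘(ℝ, ℝ) 𝓘(ℝ, E n) ∞ c I
  unitSpeed : ∀ s ∈ I, Φ.F ⟨c s, velocity c s⟩ = 1
  firstCurvature_const : ∃ k : ℝ, ∀ s ∈ I, firstCurvature Φ c s = k
  secondCurvature_zero : ∀ s ∈ I, secondCurvature Φ c s = 0

end Curves

/-! ### Maps between Finsler manifolds -/

section Maps

variable {n : ℕ} {M M' : Type*}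
  [TopologicalSpace M] [ChartedSpace (E n) M] [IsManifold 𝓘(ℝ, E n) ∞ M]
  [TopologicalSpace M'] [ChartedSpace (E n) M'] [IsManifold 𝓘(ℝ, E n) ∞ M']

/-- `φ` maps geodesic circles to geodesic circles: for every geodesic circle `c(s)`, the curve
`φ ∘ c`, after an orientation preserving change `s = s(s')` of its parameter to arc length, is a
geodesic circle. -/
def PreservesGeodesicCircles (Φ : FinslerStructure n M) (Φ' : FinslerStructure n M')
    (φ : M → M') : Prop :=
  ∀ (c : ℝ → M) (I : Set ℝ), IsGeodesicCircle Φ c I →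
    ∃ (J : Set ℝ) (s : ℝ → ℝ), ContDiffOn ℝ ∞ s J ∧ (∀ t ∈ J, 0 < deriv s t) ∧ s '' J = I ∧
      IsGeodesicCircle Φ' (φ ∘ c ∘ s) J

/-- `φ` is conformal: `φ^* g' = e^{2σ} g` on the slit tangent bundle, for a smooth function `σ`
on `M`. -/
def IsConformal (Φ : FinslerStructure n M) (Φ' : FinslerStructure n M') (φ : M → M') : Prop :=
  ∃ σ : M → ℝ, ContMDiff 𝓘(ℝ, E n) 𝓘(ℝ, ℝ) ∞ σ ∧
    ∀ (x : M) (y u v : TangentSpace 𝓘(ℝ, E n) x), y ≠ 0 →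
      fundamentalTensor Φ'.F (φ x) (mfderiv 𝓘(ℝ, E n) 𝓘(ℝ, E n) φ x y)
          (mfderiv 𝓘(ℝ, E n) 𝓘(ℝ, E n) φ x u) (mfderiv 𝓘(ℝ, E n) 𝓘(ℝ, E n) φ x v) =
        Real.exp (2 * σ x) * fundamentalTensor Φ.F x y u v

/-- `φ` is concircular: it is conformal and preserves geodesic circles. -/
def IsConcircular (Φ : FinslerStructure n M) (Φ' : FinslerStructure n M') (φ : M → M') : Prop :=
  IsConformal Φ Φ' φ ∧ PreservesGeodesicCircles Φ Φ' φ

end Maps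

end Finsler

end

/-!
# Maps of Finsler manifolds preserving geodesic circles are conformal

Through every unit vector `y` and every curvature vector `w ≠ 0` orthogonal to `y` passes a geodesic
circle: it solves `∇_{x'} x' = w`, `∇_{x'} w = -k² x'` (`LocalFinsler.exists_circle`), which is of
third order in `x`. In suitable coordinates a local diffeomorphism is the identity, between two
Finsler functions `L` and `L'`. If it preserves geodesic circles, then each circle `x` of `L`,
reparametrized by its `L'`-arc length, satisfies `∇'∇' z' ∈ ℝ z'`. Written at the initial point, this
says that a certain expression in `w`, the `circleDefect`, is a multiple of `y`
(`circleDefect_eq_smul`, `exists_circleDefect_eq`). The expression is a polynomial of degree two in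
`w`, the factor `3` in it coming from `s''` in the change of parameter, and its quadratic part is

  `C'(w, w) - C(w, w) - 3 (∂_w L' / L') w ∈ ℝ y`   for all `w ⟂ y`   (`cartan_sub_cartan`),

where `C` is the Cartan tensor and `∂_w` the vertical derivative. Only this relation is used in the
sequel, at one point `x` of the manifold at a time.

Polarizing and taking traces (`trace_cartan_sub_cartan`), and since the trace of `2 C(w, ·)` is
`∂_w log det g` by Jacobi's formula, the function `log (det g' / det g) - 3 n log (L' / L)` on
`T_xM ∖ 0` is stationary, hence equal to a constant `K` as `n ≥ 2` makes `T_xM ∖ 0` connected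
(`exists_logRatio_eq`). Let `ρ` be the maximum of `L' / L` over `T_xM ∖ 0`. Where it is attained,
`ρ² L² - L'²` has a minimum, so `g' ≤ ρ² g` and `log (det g' / det g) ≤ 2 n log ρ`, whence
`K ≤ -n log ρ` (`logRatio_le`). Exchanging `L` and `L'` gives the opposite inequality for the minimum
of `L' / L`. So minimum and maximum agree (`exists_log_sub_log_eq`): `L' = e^σ L` on `T_xM`, where `σ`
depends on `x` only, and smoothly so because the ratio may be computed with a local vector field.

The Cartan connection enters through the description of its objects by derivatives of the energy
`L² / 2` (`gf_spray`, `two_gf_nonlin`, `gf_cartan`), which gives the form `X' + N X + C(∇x', X)` of the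
covariant derivative (`LocalFinsler.covDeriv_eq`), its compatibility with the metric and its
independence of the coordinates (`IsLocalIsometry.covDeriv_eq`).
-/

noncomputable section

namespace Finsler

/-! ### Directional derivatives of smooth functions -/

section Calculus

variable {V F : Type*} [NormedAddCommGroup V] [NormedSpace ℝ V] [NormedAddCommGroup F]
  [NormedSpace ℝ F] {W : Set V} {f : V → F} {p : V}

theorem _root_.ContDiffOn.fderiv_infty (hf : ContDiffOn ℝ ∞ f W) (hW : IsOpen W) :
    ContDiffOn ℝ ∞ (fderiv ℝ f) W :=
  hf.fderiv_of_isOpen hW (by norm_cast)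

theorem _root_.ContDiffOn.differentiableAt_infty (hf : ContDiffOn ℝ ∞ f W) (hW : IsOpen W)
    (hp : p ∈ W) : DifferentiableAt ℝ f p :=
  (hf.contDiffAt (hW.mem_nhds hp)).differentiableAt (by simp)

theorem fderiv_fderiv_comm (hf : ContDiffOn ℝ ∞ f W) (hW : IsOpen W) (hp : p ∈ W) (a b : V) :
    fderiv ℝ (fderiv ℝ f) p a b = fderiv ℝ (fderiv ℝ f) p b a := by
  have h := (hf.contDiffAt (hW.mem_nhds hp)).isSymmSndFDerivAt
    (by rw [minSmoothness_of_isRCLikeNormedField]; exact WithTop.coe_le_coe.2 (le_top : (2 : ℕ∞) ≤ ⊤))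
  exact h.eq a b

theorem fderiv_fderiv_apply (hf : ContDiffOn ℝ ∞ f W) (hW : IsOpen W) (hp : p ∈ W) (a b : V) :
    fderiv ℝ (fun q => fderiv ℝ f q b) p a = fderiv ℝ (fderiv ℝ f) p a b := by
  have h := ((hf.fderiv_infty hW).differentiableAt_infty hW hp).hasFDerivAt.clm_apply
    (hasFDerivAt_const b p)
  rw [h.fderiv]; simp

/-- The third derivative is symmetric in its last two arguments. -/
theorem fderiv_three_comm_right (hf : ContDiffOn ℝ ∞ f W) (hW : IsOpen W) (hp : p ∈ W)
    (a b c : V) :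
    fderiv ℝ (fderiv ℝ (fderiv ℝ f)) p a b c = fderiv ℝ (fderiv ℝ (fderiv ℝ f)) p a c b := by
  have h2 := (((hf.fderiv_infty hW).fderiv_infty hW).differentiableAt_infty hW hp).hasFDerivAt
  have hb := (h2.clm_apply (hasFDerivAt_const b p)).clm_apply (hasFDerivAt_const c p)
  have hc := (h2.clm_apply (hasFDerivAt_const c p)).clm_apply (hasFDerivAt_const b p)
  have he : (fun q => fderiv ℝ (fderiv ℝ f) q b c) =ᶠ[nhds p]
      fun q => fderiv ℝ (fderiv ℝ f) q c b := by
    filter_upwards [hW.mem_nhds hp] with q hq using fderiv_fderiv_comm hf hW hq b c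
  have h := congrArg (fun φ => φ a) (hb.unique (hc.congr_of_eventuallyEq he))
  simpa using h

theorem fderiv_three_comm_left (hf : ContDiffOn ℝ ∞ f W) (hW : IsOpen W) (hp : p ∈ W)
    (a b c : V) :
    fderiv ℝ (fderiv ℝ (fderiv ℝ f)) p a b c = fderiv ℝ (fderiv ℝ (fderiv ℝ f)) p b a c := by
  rw [fderiv_fderiv_comm (hf.fderiv_infty hW) hW hp a b]

variable {V₁ V₂ : Type*} [NormedAddCommGroup V₁] [NormedSpace ℝ V₁] [NormedAddCommGroup V₂]
  [NormedSpace ℝ V₂]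

theorem fderiv_clm_apply₁ {c : V → V₁ →L[ℝ] F} {c' : V →L[ℝ] V₁ →L[ℝ] F} {u : V → V₁}
    {u' : V →L[ℝ] V₁} (hc : HasFDerivAt c c' p) (hu : HasFDerivAt u u' p) (a : V) :
    fderiv ℝ (fun q => c q (u q)) p a = c' a (u p) + c p (u' a) := by
  rw [(hc.clm_apply hu).fderiv]
  simp [add_comm]

theorem fderiv_clm_apply₂ {c : V → V₁ →L[ℝ] V₂ →L[ℝ] F} {c' : V →L[ℝ] V₁ →L[ℝ] V₂ →L[ℝ] F}
    {u : V → V₁} {u' : V →L[ℝ] V₁} {v : V → V₂} {v' : V →L[ℝ] V₂} (hc : HasFDerivAt c c' p)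
    (hu : HasFDerivAt u u' p) (hv : HasFDerivAt v v' p) (a : V) :
    fderiv ℝ (fun q => c q (u q) (v q)) p a =
      c' a (u p) (v p) + c p (u' a) (v p) + c p (u p) (v' a) := by
  rw [((hc.clm_apply hu).clm_apply hv).fderiv]
  simp only [_root_.add_apply, ContinuousLinearMap.comp_apply, ContinuousLinearMap.flip_apply]
  abel

variable {V₀ : Type*} [NormedAddCommGroup V₀] [NormedSpace ℝ V₀] {φ : V → V₀} {φ' : V →L[ℝ] V₀}

theorem hasFDerivAt_comp_of {c : V₀ → F} {c' : V₀ →L[ℝ] F} {q : V₀} (hc : HasFDerivAt c c' q)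
    (hφ : HasFDerivAt φ φ' p) (hq : φ p = q) : HasFDerivAt (fun q => c (φ q)) (c' ∘L φ') p := by
  subst hq
  exact hc.comp p hφ

theorem hasDerivAt_comp_of {c : V₀ → F} {c' : V₀ →L[ℝ] F} {γ : ℝ → V₀} {γ' : V₀} {t : ℝ}
    (hc : HasFDerivAt c c' (γ t)) (hγ : HasDerivAt γ γ' t) :
    HasDerivAt (fun s => c (γ s)) (c' γ') t :=
  hc.comp_hasDerivAt t hγ

theorem fderiv_comp_clm_apply₁ {c : V₀ → V₁ →L[ℝ] F} {c' : V₀ →L[ℝ] V₁ →L[ℝ] F} {u : V → V₁}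
    {u' : V →L[ℝ] V₁} (hc : HasFDerivAt c c' (φ p)) (hφ : HasFDerivAt φ φ' p)
    (hu : HasFDerivAt u u' p) (a : V) :
    fderiv ℝ (fun q => c (φ q) (u q)) p a = c' (φ' a) (u p) + c (φ p) (u' a) :=
  fderiv_clm_apply₁ (c := fun q => c (φ q)) (hasFDerivAt_comp_of hc hφ rfl) hu a

theorem fderiv_comp_clm_apply₂ {c : V₀ → V₁ →L[ℝ] V₂ →L[ℝ] F}
    {c' : V₀ →L[ℝ] V₁ →L[ℝ] V₂ →L[ℝ] F} {u : V → V₁} {u' : V →L[ℝ] V₁} {v : V → V₂}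
    {v' : V →L[ℝ] V₂} (hc : HasFDerivAt c c' (φ p)) (hφ : HasFDerivAt φ φ' p)
    (hu : HasFDerivAt u u' p) (hv : HasFDerivAt v v' p) (a : V) :
    fderiv ℝ (fun q => c (φ q) (u q) (v q)) p a =
      c' (φ' a) (u p) (v p) + c (φ p) (u' a) (v p) + c (φ p) (u p) (v' a) :=
  fderiv_clm_apply₂ (hasFDerivAt_comp_of (F := V₁ →L[ℝ] V₂ →L[ℝ] F) hc hφ rfl) hu hv a

theorem hasDerivAt_comp_clm_apply₂ {c : V₀ → V₁ →L[ℝ] V₂ →L[ℝ] F}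
    {c' : V₀ →L[ℝ] V₁ →L[ℝ] V₂ →L[ℝ] F} {γ : ℝ → V₀} {γ' : V₀} {u : ℝ → V₁} {u' : V₁}
    {v : ℝ → V₂} {v' : V₂} {t : ℝ} (hc : HasFDerivAt c c' (γ t)) (hγ : HasDerivAt γ γ' t)
    (hu : HasDerivAt u u' t) (hv : HasDerivAt v v' t) :
    HasDerivAt (fun s => c (γ s) (u s) (v s))
      (c' γ' (u t) (v t) + c (γ t) u' (v t) + c (γ t) (u t) v') t := by
  have h0 : HasDerivAt (fun s => c (γ s)) (c' γ') t :=
    hasDerivAt_comp_of (F := V₁ →L[ℝ] V₂ →L[ℝ] F) hc hγ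
  have h := (h0.clm_apply hu).clm_apply hv
  simpa only [_root_.add_apply] using h

end Calculus

variable {n : ℕ}

/-- The `i`-th coordinate vector of `ℝⁿ`. -/
abbrev ei (i : Fin n) : E n := EuclideanSpace.single i 1

theorem sum_smul_ei (u : E n) : ∑ i, u i • ei i = u := by
  ext j
  simp [Finset.sum_apply, Pi.single_apply]

theorem linear_expand {F : Type*} [AddCommGroup F] [Module ℝ F] (φ : E n →ₗ[ℝ] F) (u : E n) :
    φ u = ∑ i, u i • φ (ei i) := by
  conv_lhs => rw [← sum_smul_ei u]
  simp

open Local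

/-! ### Finsler functions in local coordinates -/

/-- Half the square of a function `L`, on `U × ℝⁿ ⊆ ℝⁿ × ℝⁿ` the set of pairs `(x, y)`. -/
def energy (L : E n → E n → ℝ) (p : E n × E n) : ℝ := L p.1 p.2 ^ 2 / 2

/-- The differential of the energy, as a function on `ℝⁿ × ℝⁿ`. -/
abbrev D1 (L : E n → E n → ℝ) := fderiv ℝ (energy L)

/-- The second differential of the energy, as a bilinear form on `ℝⁿ × ℝⁿ`. -/
abbrev D2 (L : E n → E n → ℝ) := fderiv ℝ (fderiv ℝ (energy L))

/-- The third differential of the energy, as a trilinear form on `ℝⁿ × ℝⁿ`. -/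
abbrev D3 (L : E n → E n → ℝ) := fderiv ℝ (fderiv ℝ (fderiv ℝ (energy L)))

/-- The fundamental tensor `g_{(x, y)}(u, v)`, the vertical Hessian of the energy. -/
def gf (L : E n → E n → ℝ) (p : E n × E n) (u v : E n) : ℝ := D2 L p (0, u) (0, v)

/-- A Finsler function over an open subset `U` of `ℝⁿ`. -/
structure LocalFinsler (U : Set (E n)) (L : E n → E n → ℝ) : Prop where
  isOpen : IsOpen U
  smooth : ContDiffOn ℝ ∞ (fun p : E n × E n => L p.1 p.2) (U ×ˢ {0}ᶜ)
  nonneg : ∀ x ∈ U, ∀ y, 0 ≤ L x y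
  homog : ∀ x ∈ U, ∀ y, ∀ r : ℝ, 0 < r → L x (r • y) = r * L x y
  posDef : ∀ x ∈ U, ∀ y ≠ 0, ∀ v ≠ 0, 0 < gf L (x, y) v v

/-- The matrix `(g_{ij})` of the fundamental tensor. -/
def gMat (L : E n → E n → ℝ) (p : E n × E n) : Matrix (Fin n) (Fin n) ℝ :=
  Matrix.of fun a b => Local.g L a b p.1 p.2

/-- The geodesic spray `2 Gⁱ`. -/
def spray (L : E n → E n → ℝ) (p : E n × E n) : E n :=
  WithLp.toLp 2 fun i => 2 * Local.G L i p.1 p.2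

/-- The nonlinear connection `X ↦ Nⁱ_j Xʲ`. -/
def nonlin (L : E n → E n → ℝ) (p : E n × E n) (X : E n) : E n :=
  WithLp.toLp 2 fun i => ∑ j, Local.N L i j p.1 p.2 * X j

/-- The Cartan tensor `(b, X) ↦ Cⁱ_{jk} Xʲ bᵏ`. -/
def cartan (L : E n → E n → ℝ) (p : E n × E n) (b X : E n) : E n :=
  WithLp.toLp 2 fun i => ∑ j, ∑ k, Local.C L i j k p.1 p.2 * b k * X j

theorem Local.dy_eq {f : E n → E n → ℝ} {p : E n × E n}
    (h : DifferentiableAt ℝ (fun p : E n × E n => f p.1 p.2) p) (i : Fin n) :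
    dy i f p.1 p.2 = fderiv ℝ (fun p : E n × E n => f p.1 p.2) p (0, ei i) := by
  have h1 : HasFDerivAt (fun z : E n => (p.1, z)) (ContinuousLinearMap.inr ℝ (E n) (E n)) p.2 :=
    (hasFDerivAt_const p.1 p.2).prodMk (hasFDerivAt_id p.2)
  have h2 := HasFDerivAt.comp p.2 (g := fun p : E n × E n => f p.1 p.2) (f := fun z => (p.1, z))
    h.hasFDerivAt h1
  exact congrArg (fun φ => φ (ei i)) h2.fderiv

theorem Local.dx_eq {f : E n → E n → ℝ} {p : E n × E n}
    (h : DifferentiableAt ℝ (fun p : E n × E n => f p.1 p.2) p) (i : Fin n) :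
    dx i f p.1 p.2 = fderiv ℝ (fun p : E n × E n => f p.1 p.2) p (ei i, 0) := by
  have h1 : HasFDerivAt (fun z : E n => (z, p.2)) (ContinuousLinearMap.inl ℝ (E n) (E n)) p.1 :=
    (hasFDerivAt_id p.1).prodMk (hasFDerivAt_const p.2 p.1)
  have h2 := HasFDerivAt.comp p.1 (g := fun p : E n × E n => f p.1 p.2) (f := fun z => (z, p.2))
    h.hasFDerivAt h1
  exact congrArg (fun φ => φ (ei i)) h2.fderiv

namespace LocalFinsler

variable {U : Set (E n)} {L : E n → E n → ℝ} (hL : LocalFinsler U L) {p : E n × E n}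
include hL

theorem isOpen_slit : IsOpen (U ×ˢ ({0}ᶜ : Set (E n))) :=
  hL.isOpen.prod isOpen_compl_singleton

theorem smooth_energy : ContDiffOn ℝ ∞ (energy L) (U ×ˢ {0}ᶜ) :=
  (hL.smooth.pow 2).div_const 2

theorem smooth_D1 : ContDiffOn ℝ ∞ (D1 L) (U ×ˢ {0}ᶜ) :=
  hL.smooth_energy.fderiv_infty hL.isOpen_slit

theorem smooth_D2 : ContDiffOn ℝ ∞ (D2 L) (U ×ˢ {0}ᶜ) :=
  hL.smooth_D1.fderiv_infty hL.isOpen_slit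

variable (hp : p ∈ U ×ˢ ({0}ᶜ : Set (E n)))
include hp

theorem hasFDerivAt_D1 : HasFDerivAt (D1 L) (D2 L p) p :=
  (hL.smooth_D1.differentiableAt_infty hL.isOpen_slit hp).hasFDerivAt

theorem hasFDerivAt_D2 : HasFDerivAt (D2 L) (D3 L p) p :=
  (hL.smooth_D2.differentiableAt_infty hL.isOpen_slit hp).hasFDerivAt

theorem D2_comm (a b : E n × E n) : D2 L p a b = D2 L p b a :=
  fderiv_fderiv_comm hL.smooth_energy hL.isOpen_slit hp a b

theorem D3_comm_left (a b c : E n × E n) : D3 L p a b c = D3 L p b a c :=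
  fderiv_three_comm_left hL.smooth_energy hL.isOpen_slit hp a b c

theorem D3_comm_right (a b c : E n × E n) : D3 L p a b c = D3 L p a c b :=
  fderiv_three_comm_right hL.smooth_energy hL.isOpen_slit hp a b c

theorem gf_comm (u v : E n) : gf L p u v = gf L p v u := hL.D2_comm hp _ _

theorem dy_sq (i : Fin n) : dy i (sq L) p.1 p.2 = 2 * D1 L p (0, ei i) := by
  have h := hL.smooth_energy.differentiableAt_infty hL.isOpen_slit hp
  have he : (fun p : E n × E n => sq L p.1 p.2) = fun p => 2 * energy L p := by
    ext p; simp only [Local.sq, energy]; ring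
  rw [dy_eq (by rw [he]; exact h.const_mul 2), he, fderiv_const_mul h]
  simp

theorem dx_sq (i : Fin n) : dx i (sq L) p.1 p.2 = 2 * D1 L p (ei i, 0) := by
  have h := hL.smooth_energy.differentiableAt_infty hL.isOpen_slit hp
  have he : (fun p : E n × E n => sq L p.1 p.2) = fun p => 2 * energy L p := by
    ext p; simp only [Local.sq, energy]; ring
  rw [dx_eq (by rw [he]; exact h.const_mul 2), he, fderiv_const_mul h]
  simp

theorem hasFDerivAt_dy_sq (j : Fin n) : HasFDerivAt (fun p : E n × E n => dy j (sq L) p.1 p.2)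
    ((2 : ℝ) • (D2 L p).flip (0, ei j)) p := by
  have h := ((hL.hasFDerivAt_D1 hp).clm_apply (hasFDerivAt_const (0, ei j) p)).const_mul 2
  have h' := h.congr_of_eventuallyEq (f₁ := fun p : E n × E n => dy j (sq L) p.1 p.2) (by
    filter_upwards [hL.isOpen_slit.mem_nhds hp] with q hq using hL.dy_sq hq j)
  simpa using h'

theorem g_eq (i j : Fin n) : Local.g L i j p.1 p.2 = gf L p (ei i) (ei j) := by
  rw [Local.g, dy_eq (hL.hasFDerivAt_dy_sq hp j).differentiableAt, (hL.hasFDerivAt_dy_sq hp j).fderiv]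
  simp [gf]

theorem dx_dy_sq (i j : Fin n) :
    dx i (dy j (sq L)) p.1 p.2 = 2 * D2 L p (ei i, 0) (0, ei j) := by
  rw [dx_eq (hL.hasFDerivAt_dy_sq hp j).differentiableAt, (hL.hasFDerivAt_dy_sq hp j).fderiv]
  simp

theorem hasFDerivAt_gf (u v : E n) : HasFDerivAt (fun q => gf L q u v)
    (((D3 L p).flip (0, u)).flip (0, v)) p := by
  have h := ((hL.hasFDerivAt_D2 hp).clm_apply (hasFDerivAt_const (0, u) p)).clm_apply
    (hasFDerivAt_const (0, v) p)
  refine h.congr_fderiv ?_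
  ext <;> simp

theorem hasFDerivAt_g (i j : Fin n) : HasFDerivAt (fun q : E n × E n => Local.g L i j q.1 q.2)
    (((D3 L p).flip (0, ei i)).flip (0, ei j)) p :=
  (hL.hasFDerivAt_gf hp (ei i) (ei j)).congr_of_eventuallyEq (by
    filter_upwards [hL.isOpen_slit.mem_nhds hp] with q hq using hL.g_eq hq i j)

theorem dx_g (i j k : Fin n) :
    dx k (Local.g L i j) p.1 p.2 = D3 L p (ei k, 0) (0, ei i) (0, ei j) := by
  rw [dx_eq (hL.hasFDerivAt_g hp i j).differentiableAt, (hL.hasFDerivAt_g hp i j).fderiv]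
  simp

theorem dy_g (i j k : Fin n) :
    dy k (Local.g L i j) p.1 p.2 = D3 L p (0, ei k) (0, ei i) (0, ei j) := by
  rw [dy_eq (hL.hasFDerivAt_g hp i j).differentiableAt, (hL.hasFDerivAt_g hp i j).fderiv]
  simp

theorem gf_eq_dotProduct (u v : E n) :
    gf L p u v = (fun i => u i) ⬝ᵥ (gMat L p).mulVec fun i => v i := by
  have h1 := linear_expand ((D2 L p).flip (0, v) ∘L ContinuousLinearMap.inr ℝ _ _).toLinearMap u
  have h2 := fun i => linear_expand
    ((D2 L p (0, ei i)) ∘L ContinuousLinearMap.inr ℝ _ _).toLinearMap v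
  simp at h1 h2
  simp only [gf, h1, h2, dotProduct, Matrix.mulVec, gMat, Matrix.of_apply, hL.g_eq hp]
  simp [mul_comm]

theorem posDef_gMat : (gMat L p).PosDef := by
  refine Matrix.PosDef.of_dotProduct_mulVec_pos ?_ fun x hx => ?_
  · ext i j
    simp [gMat, hL.g_eq hp, hL.gf_comm hp (ei j)]
  · have h := hL.posDef p.1 hp.1 p.2 hp.2 (WithLp.toLp 2 x) (by
      intro h; exact hx (by simpa using congrArg WithLp.ofLp h))
    rw [hL.gf_eq_dotProduct hp] at h
    simpa using h

theorem det_pos : 0 < (gMat L p).det := (hL.posDef_gMat hp).det_pos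

/-- Raising the index of the covector `c` with `g^{ij}` is inverse to lowering it with `g`. -/
theorem gf_raise (c : Fin n → ℝ) (u : E n) :
    gf L p (WithLp.toLp 2 fun i => ∑ h, gInv L i h p.1 p.2 * c h) u = ∑ m, c m * u m := by
  rw [hL.gf_comm hp, hL.gf_eq_dotProduct hp]
  have : (fun i => ∑ h, gInv L i h p.1 p.2 * c h) = (gMat L p)⁻¹.mulVec c := rfl
  simp only [this, Matrix.mulVec_mulVec]
  rw [Matrix.mul_nonsing_inv _ (hL.det_pos hp).ne'.isUnit]
  simp [dotProduct, mul_comm]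

theorem gf_ext {v w : E n} (h : ∀ u, gf L p v u = gf L p w u) : v = w := by
  by_contra hne
  have hpos := hL.posDef p.1 hp.1 p.2 hp.2 (v - w) (sub_ne_zero.2 hne)
  have hs : ((0 : E n), v - w) = (0, v) - (0, w) := by simp
  have h0 := h (v - w)
  rw [hL.gf_comm hp, hL.gf_comm hp w] at h0
  simp only [gf] at h0 hpos
  rw [← sub_eq_zero, ← map_sub, ← hs] at h0
  exact hpos.ne' h0

/-- The Euler–Lagrange characterization of the geodesic spray. -/
theorem gf_spray (u : E n) :
    gf L p (spray L p) u = D2 L p (p.2, 0) (0, u) - D1 L p (u, 0) := by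
  have hs : spray L p = WithLp.toLp 2 fun i => ∑ h, gInv L i h p.1 p.2 *
      (D2 L p (p.2, 0) (0, ei h) - D1 L p (ei h, 0)) := by
    unfold spray
    congr 1
    ext i
    rw [Local.G, Finset.mul_sum, Finset.mul_sum]
    refine Finset.sum_congr rfl fun l _ => ?_
    have h1 := linear_expand
      ((D2 L p).flip (0, ei l) ∘L ContinuousLinearMap.inl ℝ _ _).toLinearMap p.2
    simp at h1
    simp only [hL.dx_dy_sq hp, hL.dx_sq hp]
    rw [h1, Finset.sum_congr rfl fun m _ =>
      show _ = 2 * (p.2 m * D2 L p (ei m, 0) (0, ei l)) by ring, ← Finset.mul_sum]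
    ring
  rw [hs, hL.gf_raise hp]
  have h2 := linear_expand ((D2 L p (p.2, 0) ∘L ContinuousLinearMap.inr ℝ _ _) -
    (D1 L p ∘L ContinuousLinearMap.inl ℝ _ _)).toLinearMap u
  simp only [ContinuousLinearMap.coe_coe, _root_.sub_apply,
    ContinuousLinearMap.comp_apply, ContinuousLinearMap.inr_apply,
    ContinuousLinearMap.inl_apply, smul_eq_mul] at h2
  rw [h2]
  exact Finset.sum_congr rfl fun m _ => mul_comm _ _

end LocalFinsler

end Finsler

namespace Finsler

variable {n : ℕ}

open Local

/-! ### Consequences of homogeneity -/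

namespace LocalFinsler

variable {U : Set (E n)} {L : E n → E n → ℝ} (hL : LocalFinsler U L) {p : E n × E n}
include hL

omit hL in
theorem scale_mem (hp : p ∈ U ×ˢ ({0}ᶜ : Set (E n))) {r : ℝ} (hr : 0 < r) :
    (p.1, r • p.2) ∈ U ×ˢ ({0}ᶜ : Set (E n)) :=
  ⟨hp.1, smul_ne_zero hr.ne' hp.2⟩

theorem energy_scale (hp : p ∈ U ×ˢ ({0}ᶜ : Set (E n))) {r : ℝ} (hr : 0 < r) :
    energy L (p.1, r • p.2) = r ^ 2 * energy L p := by
  simp only [energy, hL.homog _ hp.1 _ _ hr]; ring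

variable (hp : p ∈ U ×ˢ ({0}ᶜ : Set (E n)))
include hp

omit hL hp in
theorem hasFDerivAt_scale (r : ℝ) (p : E n × E n) :
    HasFDerivAt (fun q : E n × E n => (q.1, r • q.2))
      ((ContinuousLinearMap.fst ℝ _ _).prod (r • ContinuousLinearMap.snd ℝ _ _)) p :=
  hasFDerivAt_fst.prodMk (hasFDerivAt_snd.const_smul r)

/-- Homogeneity of the derivatives of the energy: a derivative in a vertical direction lowers the
degree by one. -/
theorem D1_scale {r : ℝ} (hr : 0 < r) (a : E n × E n) :
    D1 L (p.1, r • p.2) (a.1, r • a.2) = r ^ 2 * D1 L p a := by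
  have hd {q} (hq : q ∈ U ×ˢ ({0}ᶜ : Set (E n))) :=
    hL.smooth_energy.differentiableAt_infty hL.isOpen_slit hq
  have h1 := (hd (scale_mem hp hr)).hasFDerivAt.comp p (hasFDerivAt_scale r p)
  have h2 := Filter.EventuallyEq.fderiv_eq (𝕜 := ℝ) (x := p)
    (f₁ := energy L ∘ fun q : E n × E n => (q.1, r • q.2)) (f := fun q => r ^ 2 * energy L q) (by
      filter_upwards [hL.isOpen_slit.mem_nhds hp] with q hq using hL.energy_scale hq hr)
  rw [h1.fderiv, fderiv_const_mul (hd hp)] at h2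
  exact congrArg (fun φ => φ a) h2

theorem D2_scale {r : ℝ} (hr : 0 < r) (a b : E n × E n) :
    D2 L (p.1, r • p.2) (a.1, r • a.2) (b.1, r • b.2) = r ^ 2 * D2 L p a b := by
  have h1 := fderiv_clm_apply₁ ((hL.hasFDerivAt_D1 (scale_mem hp hr)).comp p
    (hasFDerivAt_scale r p)) (hasFDerivAt_const (b.1, r • b.2) p) a
  have h2 := fderiv_clm_apply₁ ((hL.hasFDerivAt_D1 hp).const_smul (r ^ 2))
    (hasFDerivAt_const b p) a
  have h3 := Filter.EventuallyEq.fderiv_eq (𝕜 := ℝ) (x := p)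
    (f₁ := fun q => (D1 L ∘ fun q : E n × E n => (q.1, r • q.2)) q (b.1, r • b.2))
    (f := fun q => (r ^ 2 • D1 L) q b) (by
      filter_upwards [hL.isOpen_slit.mem_nhds hp] with q hq using hL.D1_scale hq hr b)
  rw [h3, h2] at h1
  simpa using h1.symm

theorem D3_scale {r : ℝ} (hr : 0 < r) (a b c : E n × E n) :
    D3 L (p.1, r • p.2) (a.1, r • a.2) (b.1, r • b.2) (c.1, r • c.2) = r ^ 2 * D3 L p a b c := by
  have h1 := fderiv_comp_clm_apply₂
    (φ := fun q : E n × E n => (q.1, r • q.2)) (hL.hasFDerivAt_D2 (scale_mem hp hr))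
    (hasFDerivAt_scale r p) (hasFDerivAt_const (b.1, r • b.2) p)
    (hasFDerivAt_const (c.1, r • c.2) p) a
  have h2 := fderiv_clm_apply₂ (hL.hasFDerivAt_D2 hp) (hasFDerivAt_const b p)
    (hasFDerivAt_const c p) a
  have h3 := Filter.EventuallyEq.fderiv_eq (𝕜 := ℝ) (x := p)
    (f₁ := fun q => D2 L (q.1, r • q.2) (b.1, r • b.2) (c.1, r • c.2)) (f := fun q => r ^ 2 * D2 L q b c) (by
      filter_upwards [hL.isOpen_slit.mem_nhds hp] with q hq using hL.D2_scale hq hr b c)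
  have h4 : DifferentiableAt ℝ (fun q => D2 L q b c) p :=
    (((hL.hasFDerivAt_D2 hp).clm_apply (hasFDerivAt_const b p)).clm_apply
      (hasFDerivAt_const c p)).differentiableAt
  rw [h3, fderiv_const_mul h4, _root_.smul_apply, h2] at h1
  simp only [_root_.zero_apply, map_zero, add_zero, smul_eq_mul] at h1
  exact h1.symm

/-- Euler's identity for the energy, which is homogeneous of degree two. -/
theorem euler : D1 L p (0, p.2) = 2 * energy L p := by
  have h0 : HasDerivAt (fun r : ℝ => (p.1, r • p.2)) ((0 : E n), p.2) 1 := by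
    simpa using (hasDerivAt_const (1 : ℝ) p.1).prodMk ((hasDerivAt_id (1 : ℝ)).smul_const p.2)
  have h1 := HasFDerivAt.comp_hasDerivAt (f := fun r : ℝ => (p.1, r • p.2)) (l := energy L)
    (l' := D1 L p) 1 (by simpa using
    (hL.smooth_energy.differentiableAt_infty hL.isOpen_slit hp).hasFDerivAt) h0
  have h2 : HasDerivAt (energy L ∘ fun r : ℝ => (p.1, r • p.2)) (2 * energy L p) 1 := by
    have h := ((hasDerivAt_id (1 : ℝ)).pow 2).mul_const (energy L p)
    simp only [id, Nat.cast_ofNat, pow_one, mul_one, Nat.add_one_sub_one] at h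
    refine h.congr_of_eventuallyEq ?_
    filter_upwards [lt_mem_nhds one_pos] with r hr using hL.energy_scale hp hr
  exact h1.unique h2

/-- Derivative of Euler's identity in the direction `a`. -/
theorem euler_D2 (a : E n × E n) : D2 L p a (0, p.2) = 2 * D1 L p a - D1 L p (0, a.2) := by
  have h1 := (hL.hasFDerivAt_D1 hp).clm_apply
    ((hasFDerivAt_const (0 : E n) p).prodMk hasFDerivAt_snd)
  have h2 := ((hL.smooth_energy.differentiableAt_infty hL.isOpen_slit
    hp).hasFDerivAt.const_mul 2).congr_of_eventuallyEq
    (f₁ := fun q : E n × E n => D1 L q (0, q.2)) (by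
      filter_upwards [hL.isOpen_slit.mem_nhds hp] with q hq using hL.euler hq)
  have h := congrArg (fun φ => φ a) (h1.unique h2)
  simp at h
  linarith

theorem gf_self_left (u : E n) : gf L p p.2 u = D1 L p (0, u) := by
  rw [hL.gf_comm hp, gf, hL.euler_D2 hp]; ring

omit hL hp in
theorem D_zero_pair : ((0 : E n), (0 : E n)) = 0 := rfl

theorem D2_hor_self (u : E n) : D2 L p (u, 0) (0, p.2) = 2 * D1 L p (u, 0) := by
  have := hL.euler_D2 hp (u, 0)
  simpa [D_zero_pair] using this

theorem gf_self : gf L p p.2 p.2 = L p.1 p.2 ^ 2 := by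
  rw [hL.gf_self_left hp, hL.euler hp, energy]; ring

theorem pos : 0 < L p.1 p.2 := by
  have h := hL.posDef p.1 hp.1 p.2 hp.2 p.2 hp.2
  rw [hL.gf_self hp] at h
  exact lt_of_le_of_ne (hL.nonneg _ hp.1 _) fun h0 => by simp [← h0] at h

/-- Derivative of `gf_self_left`. -/
theorem euler_D3 (a : E n × E n) (u : E n) :
    D3 L p a (0, p.2) (0, u) = D2 L p (a.1, 0) (0, u) := by
  have h1 := ((hL.hasFDerivAt_D2 hp).clm_apply
    ((hasFDerivAt_const (0 : E n) p).prodMk hasFDerivAt_snd)).clm_apply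
    (hasFDerivAt_const ((0 : E n), u) p)
  have h2 := ((hL.hasFDerivAt_D1 hp).clm_apply
    (hasFDerivAt_const ((0 : E n), u) p)).congr_of_eventuallyEq
    (f₁ := fun q : E n × E n => D2 L q (0, q.2) (0, u)) (by
      filter_upwards [hL.isOpen_slit.mem_nhds hp] with q hq using hL.gf_self_left hq u)
  have h := congrArg (fun φ => φ a) (h1.unique h2)
  have ha : a = (a.1, 0) + (0, a.2) := by simp
  have h3 : D2 L p a (0, u) = D2 L p (a.1, 0) (0, u) + D2 L p (0, a.2) (0, u) := by
    rw [← _root_.add_apply, ← map_add, ← ha]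
  simp at h
  linarith

end LocalFinsler

/-! ### Smoothness of the connection coefficients -/

theorem contDiffOn_det {V : Type*} [NormedAddCommGroup V] [NormedSpace ℝ V] {W : Set V}
    {A : V → Matrix (Fin n) (Fin n) ℝ} (h : ∀ i j, ContDiffOn ℝ ∞ (fun q => A q i j) W) :
    ContDiffOn ℝ ∞ (fun q => (A q).det) W := by
  simp only [Matrix.det_apply]
  exact ContDiffOn.sum fun σ _ => ContDiffOn.const_smul _ (contDiffOn_prod fun i _ => h _ _)

theorem contDiffOn_inv {V : Type*} [NormedAddCommGroup V] [NormedSpace ℝ V] {W : Set V}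
    {A : V → Matrix (Fin n) (Fin n) ℝ} (h : ∀ i j, ContDiffOn ℝ ∞ (fun q => A q i j) W)
    (h0 : ∀ q ∈ W, (A q).det ≠ 0) (i j : Fin n) :
    ContDiffOn ℝ ∞ (fun q => (A q)⁻¹ i j) W := by
  simp only [Matrix.inv_def, Matrix.smul_apply, Ring.inverse_eq_inv', Matrix.adjugate_apply]
  refine ((contDiffOn_det h).inv h0).smul (contDiffOn_det fun k l => ?_)
  simp only [Matrix.updateRow_apply]
  split_ifs
  · exact contDiffOn_const
  · exact h k l

namespace LocalFinsler

variable {U : Set (E n)} {L : E n → E n → ℝ} (hL : LocalFinsler U L) {p : E n × E n}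
include hL

theorem smooth_gf (u v : E n) : ContDiffOn ℝ ∞ (fun q => gf L q u v) (U ×ˢ {0}ᶜ) :=
  (hL.smooth_D2.clm_apply contDiffOn_const).clm_apply contDiffOn_const

theorem smooth_g (i j : Fin n) :
    ContDiffOn ℝ ∞ (fun q : E n × E n => Local.g L i j q.1 q.2) (U ×ˢ {0}ᶜ) :=
  (hL.smooth_gf (ei i) (ei j)).congr fun _ hq => hL.g_eq hq i j

theorem smooth_gInv (i j : Fin n) :
    ContDiffOn ℝ ∞ (fun q : E n × E n => gInv L i j q.1 q.2) (U ×ˢ {0}ᶜ) :=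
  contDiffOn_inv (A := gMat L) hL.smooth_g (fun _ hq => (hL.det_pos hq).ne') i j

theorem smooth_G (i : Fin n) :
    ContDiffOn ℝ ∞ (fun q : E n × E n => Local.G L i q.1 q.2) (U ×ˢ {0}ᶜ) := by
  unfold Local.G
  refine contDiffOn_const.mul (ContDiffOn.sum fun l _ => (hL.smooth_gInv i l).mul (.sub
    (ContDiffOn.sum fun m _ => .mul ?_ ?_) ?_))
  · refine ContDiffOn.congr (f := fun q => 2 * D2 L q (ei m, 0) (0, ei l)) ?_
      fun q hq => hL.dx_dy_sq hq m l
    exact contDiffOn_const.mul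
      ((hL.smooth_D2.clm_apply contDiffOn_const).clm_apply contDiffOn_const)
  · fun_prop
  · refine ContDiffOn.congr (f := fun q => 2 * D1 L q (ei l, 0)) ?_ fun q hq => hL.dx_sq hq l
    exact contDiffOn_const.mul (hL.smooth_D1.clm_apply contDiffOn_const)

theorem smooth_spray : ContDiffOn ℝ ∞ (spray L) (U ×ˢ {0}ᶜ) := by
  rw [contDiffOn_euclidean]
  exact fun i => contDiffOn_const.mul (hL.smooth_G i)

theorem smooth_N (i j : Fin n) :
    ContDiffOn ℝ ∞ (fun q : E n × E n => Local.N L i j q.1 q.2) (U ×ˢ {0}ᶜ) := by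
  refine ContDiffOn.congr (f := fun q => fderiv ℝ (fun q : E n × E n => Local.G L i q.1 q.2) q
    (0, ei j)) (((hL.smooth_G i).fderiv_infty hL.isOpen_slit).clm_apply contDiffOn_const)
    fun q hq => ?_
  exact dy_eq ((hL.smooth_G i).differentiableAt_infty hL.isOpen_slit hq) j

theorem smooth_C (i j k : Fin n) :
    ContDiffOn ℝ ∞ (fun q : E n × E n => Local.C L i j k q.1 q.2) (U ×ˢ {0}ᶜ) := by
  unfold Local.C
  refine contDiffOn_const.mul (ContDiffOn.sum fun l _ => (hL.smooth_gInv i l).mul ?_)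
  refine ContDiffOn.congr (f := fun q => fderiv ℝ (fun q : E n × E n => Local.g L l k q.1 q.2) q
    (0, ei j)) (((hL.smooth_g l k).fderiv_infty hL.isOpen_slit).clm_apply contDiffOn_const)
    fun q hq => ?_
  exact dy_eq ((hL.smooth_g l k).differentiableAt_infty hL.isOpen_slit hq) j

variable (hp : p ∈ U ×ˢ ({0}ᶜ : Set (E n)))
include hp

theorem hasFDerivAt_spray : HasFDerivAt (spray L) (fderiv ℝ (spray L) p) p :=
  (hL.smooth_spray.differentiableAt_infty hL.isOpen_slit hp).hasFDerivAt

/-! ### The Cartan connection in terms of the energy -/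

theorem nonlin_eq (X : E n) : nonlin L p X = (1 / 2 : ℝ) • fderiv ℝ (spray L) p (0, X) := by
  have h := linear_expand
    (fderiv ℝ (spray L) p ∘L ContinuousLinearMap.inr ℝ _ _).toLinearMap X
  simp only [ContinuousLinearMap.coe_coe, ContinuousLinearMap.comp_apply,
    ContinuousLinearMap.inr_apply] at h
  rw [h]
  ext i
  have key : ∀ j, fderiv ℝ (spray L) p (0, ei j) i = 2 * Local.N L i j p.1 p.2 := by
    intro j
    have hG := (hL.smooth_G i).differentiableAt_infty hL.isOpen_slit hp
    have h1 : HasFDerivAt (fun q => spray L q i) _ p :=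
      (EuclideanSpace.proj (𝕜 := ℝ) i).hasFDerivAt.comp p (hL.hasFDerivAt_spray hp)
    have h2 : HasFDerivAt (fun q => spray L q i) _ p := hG.hasFDerivAt.const_mul 2
    have h3 := congrArg (fun φ => φ (0, ei j)) (h1.unique h2)
    rw [Local.N, dy_eq hG]
    simpa using h3
  simp only [nonlin, PiLp.smul_apply, WithLp.ofLp_sum, WithLp.ofLp_smul, Finset.sum_apply,
    Pi.smul_apply, smul_eq_mul, key, Finset.mul_sum]
  exact Finset.sum_congr rfl fun j _ => by ring

/-- Vertical derivative of the Euler–Lagrange equation `gf_spray`. -/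
theorem two_gf_nonlin (X u : E n) :
    2 * gf L p (nonlin L p X) u = D3 L p (0, X) (p.2, 0) (0, u) + D2 L p (X, 0) (0, u)
      - D2 L p (0, X) (u, 0) - D3 L p (0, X) (0, spray L p) (0, u) := by
  have h1 := fderiv_clm_apply₂ (hL.hasFDerivAt_D2 hp) ((hasFDerivAt_const (0 : E n) p).prodMk
    (hL.hasFDerivAt_spray hp)) (hasFDerivAt_const ((0 : E n), u) p) (0, X)
  have h2 := fderiv_clm_apply₂ (hL.hasFDerivAt_D2 hp) (hasFDerivAt_snd.prodMk
    (hasFDerivAt_const (0 : E n) p)) (hasFDerivAt_const ((0 : E n), u) p) (0, X)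
  have h3 := fderiv_clm_apply₁ (hL.hasFDerivAt_D1 hp) (hasFDerivAt_const (u, (0 : E n)) p) (0, X)
  have h4 := Filter.EventuallyEq.fderiv_eq (𝕜 := ℝ) (x := p)
    (f₁ := fun q => D2 L q (0, spray L q) (0, u))
    (f := (fun q => D2 L q (q.2, 0) (0, u)) - fun q => D1 L q (u, 0)) (by
      filter_upwards [hL.isOpen_slit.mem_nhds hp] with q hq using hL.gf_spray hq u)
  rw [fderiv_sub (((hL.hasFDerivAt_D2 hp).clm_apply (hasFDerivAt_snd.prodMk
    (hasFDerivAt_const (0 : E n) p))).clm_apply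
    (hasFDerivAt_const ((0 : E n), u) p)).differentiableAt
    ((hL.hasFDerivAt_D1 hp).clm_apply (hasFDerivAt_const (u, (0 : E n)) p)).differentiableAt] at h4
  rw [h4, _root_.sub_apply, h2, h3] at h1
  have h5 : gf L p (nonlin L p X) u = 1 / 2 * D2 L p (0, fderiv ℝ (spray L) p (0, X)) (0, u) := by
    have : ((0 : E n), nonlin L p X) = (1 / 2 : ℝ) • (0, fderiv ℝ (spray L) p (0, X)) := by
      rw [hL.nonlin_eq hp, Prod.smul_mk, smul_zero]
    rw [gf, this, map_smul, _root_.smul_apply, smul_eq_mul]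
  simp only [_root_.zero_apply, map_zero, add_zero, ContinuousLinearMap.prod_apply,
    ContinuousLinearMap.coe_snd'] at h1
  rw [h5]
  linarith

/-- Euler's identity for the spray, which is homogeneous of degree two. -/
theorem nonlin_self : nonlin L p p.2 = spray L p := by
  refine hL.gf_ext hp fun u => ?_
  have h := hL.two_gf_nonlin hp p.2 u
  rw [hL.gf_spray hp u]
  rw [hL.D3_comm_left hp (0, p.2), hL.D3_comm_left hp (0, p.2), hL.euler_D3 hp,
    hL.euler_D3 hp, hL.D2_comm hp (0, p.2), hL.D2_hor_self hp] at h
  have h0 : D2 L p (0, 0) (0, u) = 0 := by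
    rw [D_zero_pair]; simp
  dsimp only at h
  rw [h0] at h
  linarith

end LocalFinsler

end Finsler

namespace Finsler

variable {n : ℕ}

open Local

/-! ### The Cartan covariant derivative -/

theorem bilinear_expand (B : E n →ₗ[ℝ] E n →ₗ[ℝ] ℝ) (u v : E n) :
    B u v = ∑ j, ∑ k, B (ei j) (ei k) * v k * u j := by
  rw [linear_expand B u, LinearMap.sum_apply]
  refine Finset.sum_congr rfl fun j _ => ?_
  rw [LinearMap.smul_apply, linear_expand (B (ei j)) v, Finset.smul_sum]
  exact Finset.sum_congr rfl fun k _ => by simp only [smul_eq_mul]; ring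

namespace LocalFinsler

variable {U : Set (E n)} {L : E n → E n → ℝ} (hL : LocalFinsler U L) {p : E n × E n}
include hL

variable (hp : p ∈ U ×ˢ ({0}ᶜ : Set (E n)))
include hp

/-- `δg_{ij}/δxᵏ` is the third derivative of the energy in the horizontal direction over `eₖ`. -/
theorem δ_g (i j k : Fin n) : δ L k (Local.g L i j) p.1 p.2 =
    D3 L p (ei k, - nonlin L p (ei k)) (0, ei i) (0, ei j) := by
  have h1 := linear_expand (((D3 L p).flip (0, ei i)).flip (0, ei j) ∘L
    ContinuousLinearMap.inr ℝ _ _).toLinearMap (nonlin L p (ei k))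
  simp only [ContinuousLinearMap.coe_coe, ContinuousLinearMap.comp_apply,
    ContinuousLinearMap.inr_apply, ContinuousLinearMap.flip_apply] at h1
  have h2 : (ei k, - nonlin L p (ei k)) = (ei k, (0 : E n)) - (0, nonlin L p (ei k)) := by simp
  rw [h2, map_sub, _root_.sub_apply, _root_.sub_apply, h1, δ, hL.dx_g hp]
  congr 1
  refine Finset.sum_congr rfl fun m _ => ?_
  rw [hL.dy_g hp]
  simp [nonlin]

/-- The map `X ↦ (X, -N X)` lifting a vector to its horizontal lift. -/
theorem exists_horizontal_lift : ∃ H : E n →ₗ[ℝ] E n × E n, ∀ X, H X = (X, - nonlin L p X) := by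
  refine ⟨(LinearMap.id).prod (-((1 / 2 : ℝ) • (fderiv ℝ (spray L) p ∘L
    ContinuousLinearMap.inr ℝ _ _).toLinearMap)), fun X => ?_⟩
  rw [hL.nonlin_eq hp]
  simp

/-- The nonlinear connection through horizontal derivatives of the fundamental tensor, in the form
of a Koszul formula contracted with the line element. -/
theorem two_gf_nonlin' (X u : E n) : 2 * gf L p (nonlin L p X) u =
    D3 L p (X, - nonlin L p X) (0, u) (0, p.2) + D3 L p (p.2, - spray L p) (0, u) (0, X)
      - D3 L p (u, - nonlin L p u) (0, X) (0, p.2) := by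
  rw [hL.two_gf_nonlin hp, hL.D3_comm_right hp _ (0, u) (0, p.2), hL.euler_D3 hp,
    hL.D3_comm_right hp _ (0, X) (0, p.2), hL.euler_D3 hp, hL.D2_comm hp (0, X) (u, 0)]
  have h2 : (p.2, - spray L p) = (p.2, (0 : E n)) - (0, spray L p) := by simp
  rw [h2, map_sub, _root_.sub_apply, _root_.sub_apply, hL.D3_comm_left hp (0, X),
    hL.D3_comm_left hp (0, X), hL.D3_comm_right hp _ (0, u) (0, X),
    hL.D3_comm_right hp _ (0, u) (0, X)]
  ring

/-- Contracting the coefficients `Γⁱ_{jk}` with the line element gives the nonlinear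
connection. -/
theorem sum_Γ (X : E n) (i : Fin n) :
    ∑ j, ∑ k, Local.Γ L i j k p.1 p.2 * p.2 k * X j = nonlin L p X i := by
  obtain ⟨H, hH⟩ := hL.exists_horizontal_lift hp
  let c : Fin n → ℝ := fun h => (1 / 2) * (D3 L p (X, - nonlin L p X) (0, ei h) (0, p.2) +
    D3 L p (p.2, - spray L p) (0, ei h) (0, X) - D3 L p (ei h, - nonlin L p (ei h)) (0, X) (0, p.2))
  have hc : ∀ h, c h = (1 / 2) * ∑ j, ∑ k, (δ L j (Local.g L h k) p.1 p.2 +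
      δ L k (Local.g L h j) p.1 p.2 - δ L h (Local.g L j k) p.1 p.2) * p.2 k * X j := by
    intro h
    let inr : E n →ₗ[ℝ] E n × E n := LinearMap.inr ℝ (E n) (E n)
    let T : E n × E n →ₗ[ℝ] E n × E n →ₗ[ℝ] ℝ :=
      LinearMap.mk₂ ℝ (fun a b => D3 L p a (0, ei h) b) (by simp) (by simp) (by simp) (by simp)
    let T' : E n × E n →ₗ[ℝ] E n × E n →ₗ[ℝ] ℝ :=
      LinearMap.mk₂ ℝ (fun a b => D3 L p (H (ei h)) a b) (by simp) (by simp) (by simp) (by simp)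
    have h1 := bilinear_expand (T.compl₁₂ H inr) X p.2
    have h2 := bilinear_expand (T.compl₁₂ H inr).flip X p.2
    have h3 := bilinear_expand (T'.compl₁₂ inr inr) X p.2
    simp only [LinearMap.flip_apply, LinearMap.compl₁₂_apply, LinearMap.mk₂_apply, T, T', inr, hH,
      LinearMap.inr_apply, hL.nonlin_self hp] at h1 h2 h3
    simp only [c, h1, h2, h3, hL.δ_g hp, ← Finset.sum_add_distrib, ← Finset.sum_sub_distrib]
    congr 1
    exact Finset.sum_congr rfl fun j _ => Finset.sum_congr rfl fun k _ => by ring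
  have hv : nonlin L p X = WithLp.toLp 2 fun i => ∑ h, gInv L i h p.1 p.2 * c h := by
    refine hL.gf_ext hp fun u => ?_
    rw [hL.gf_raise hp]
    have h1 := linear_expand ((D2 L p (0, nonlin L p X)) ∘L
      ContinuousLinearMap.inr ℝ _ _).toLinearMap u
    simp only [ContinuousLinearMap.coe_coe, ContinuousLinearMap.comp_apply,
      ContinuousLinearMap.inr_apply, smul_eq_mul] at h1
    rw [gf, h1]
    refine Finset.sum_congr rfl fun m _ => ?_
    have h2 := hL.two_gf_nonlin' hp X (ei m)
    rw [gf] at h2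
    simp only [c, ← h2]
    ring
  rw [hv]
  simp only [hc, Local.Γ, Finset.mul_sum, Finset.sum_mul]
  rw [Finset.sum_congr rfl fun j _ => Finset.sum_comm, Finset.sum_comm]
  exact Finset.sum_congr rfl fun h _ => Finset.sum_congr rfl fun j _ =>
    Finset.sum_congr rfl fun k _ => by ring

/-- The Cartan tensor with lowered index is half the third vertical derivative of the energy; in
particular it is totally symmetric. -/
theorem gf_cartan (b X u : E n) :
    gf L p (cartan L p b X) u = (1 / 2) * D3 L p (0, b) (0, X) (0, u) := by
  let c : Fin n → ℝ := fun m => (1 / 2) * D3 L p (0, b) (0, X) (0, ei m)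
  have hc : ∀ m, c m = (1 / 2) * ∑ j, ∑ k, D3 L p (0, ei j) (0, ei m) (0, ei k) * b k * X j := by
    intro m
    let T : E n →ₗ[ℝ] E n →ₗ[ℝ] ℝ :=
      (LinearMap.mk₂ ℝ (fun a b => D3 L p a (0, ei m) b) (by simp) (by simp) (by simp)
        (by simp) : E n × E n →ₗ[ℝ] E n × E n →ₗ[ℝ] ℝ).compl₁₂
        (LinearMap.inr ℝ (E n) (E n)) (LinearMap.inr ℝ (E n) (E n))
    have h1 := bilinear_expand T X b
    simp only [LinearMap.compl₁₂_apply, LinearMap.mk₂_apply, T, LinearMap.inr_apply] at h1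
    rw [← h1, hL.D3_comm_right hp, hL.D3_comm_left hp (0, X)]
  have hv : cartan L p b X = WithLp.toLp 2 fun i => ∑ h, gInv L i h p.1 p.2 * c h := by
    unfold cartan
    congr 1
    ext i
    simp only [hc, Local.C, Finset.mul_sum, Finset.sum_mul, hL.dy_g hp]
    rw [Finset.sum_congr rfl fun j _ => Finset.sum_comm, Finset.sum_comm]
    exact Finset.sum_congr rfl fun h _ => Finset.sum_congr rfl fun j _ =>
      Finset.sum_congr rfl fun k _ => by ring
  have h1 := linear_expand ((D3 L p (0, b) (0, X)) ∘L
      ContinuousLinearMap.inr ℝ _ _).toLinearMap u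
  simp only [ContinuousLinearMap.coe_coe, ContinuousLinearMap.comp_apply,
    ContinuousLinearMap.inr_apply, smul_eq_mul] at h1
  rw [hv, hL.gf_raise hp, h1, Finset.mul_sum]
  exact Finset.sum_congr rfl fun m _ => by simp only [c]; ring

theorem cartan_self_right (b : E n) : cartan L p b p.2 = 0 := by
  refine hL.gf_ext hp fun u => ?_
  rw [hL.gf_cartan hp, hL.euler_D3 hp]
  simp [gf, D_zero_pair]

theorem cartan_comm (b X : E n) : cartan L p b X = cartan L p X b := by
  refine hL.gf_ext hp fun u => ?_
  rw [hL.gf_cartan hp, hL.gf_cartan hp, hL.D3_comm_left hp]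

end LocalFinsler

/-- The Cartan covariant derivative in terms of the nonlinear connection and the Cartan
tensor. -/
theorem LocalFinsler.covDeriv_eq {U : Set (E n)} {L : E n → E n → ℝ} (hL : LocalFinsler U L)
    {x X : ℝ → E n} {t : ℝ} (hx : x t ∈ U) (hy : deriv x t ≠ 0) :
    Local.covDeriv L x X t = deriv X t + nonlin L (x t, deriv x t) (X t) +
      cartan L (x t, deriv x t) (deriv (deriv x) t + spray L (x t, deriv x t)) (X t) := by
  have hp : (x t, deriv x t) ∈ U ×ˢ ({0}ᶜ : Set (E n)) := ⟨hx, hy⟩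
  ext i
  rw [← hL.nonlin_self hp]
  rw [PiLp.add_apply, PiLp.add_apply, ← hL.sum_Γ hp]
  simp only [Local.covDeriv, cartan, connForm, PiLp.add_apply, nonlin, Finset.sum_mul, add_mul,
    Finset.sum_add_distrib, add_assoc]

end Finsler

namespace Finsler

variable {n : ℕ}

open Local

/-! ### Compatibility with the metric -/

/-- The Cartan covariant derivative along a curve is compatible with the fundamental tensor. -/
theorem LocalFinsler.hasDerivAt_gf {U : Set (E n)} {L : E n → E n → ℝ} (hL : LocalFinsler U L)
    {x X Y : ℝ → E n} {t : ℝ} (hx : x t ∈ U) (hy : deriv x t ≠ 0) (dx : DifferentiableAt ℝ x t)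
    (ddx : DifferentiableAt ℝ (deriv x) t) (dX : DifferentiableAt ℝ X t)
    (dY : DifferentiableAt ℝ Y t) :
    HasDerivAt (fun s => gf L (x s, deriv x s) (X s) (Y s))
      (gf L (x t, deriv x t) (Local.covDeriv L x X t) (Y t) +
        gf L (x t, deriv x t) (X t) (Local.covDeriv L x Y t)) t := by
  have hp : (x t, deriv x t) ∈ U ×ˢ ({0}ᶜ : Set (E n)) := ⟨hx, hy⟩
  have h := hasDerivAt_comp_clm_apply₂ (γ := fun s => (x s, deriv x s)) (hL.hasFDerivAt_D2 hp)
    (dx.hasDerivAt.prodMk ddx.hasDerivAt)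
    ((hasDerivAt_const t (0 : E n)).prodMk dX.hasDerivAt)
    ((hasDerivAt_const t (0 : E n)).prodMk dY.hasDerivAt)
  refine h.congr_deriv ?_
  set p := (x t, deriv x t) with hpdef
  have key : ∀ X X' Y : E n, gf L p (X' + nonlin L p X +
      cartan L p (deriv (deriv x) t + spray L p) X) Y = gf L p X' Y + gf L p (nonlin L p X) Y +
      (1 / 2) * D3 L p (0, deriv (deriv x) t) (0, X) (0, Y) +
      (1 / 2) * D3 L p (0, spray L p) (0, X) (0, Y) := by
    intro X X' Y
    have h1 : ∀ a b : E n, ((0 : E n), a + b) = (0, a) + (0, b) := by simp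
    have h2 := hL.gf_cartan hp (deriv (deriv x) t + spray L p) X Y
    simp only [gf] at h2 ⊢
    simp only [h1, map_add, _root_.add_apply] at h2 ⊢
    rw [h2]
    ring
  rw [hL.covDeriv_eq hx hy, hL.covDeriv_eq hx hy, ← hpdef, key, hL.gf_comm hp (X t), key]
  have hX := hL.two_gf_nonlin hp (X t) (Y t)
  have hY := hL.two_gf_nonlin hp (Y t) (X t)
  have e : (deriv x t, deriv (deriv x) t) = (deriv x t, (0 : E n)) + (0, deriv (deriv x) t) := by
    simp
  rw [e, map_add, _root_.add_apply, _root_.add_apply]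
  rw [hL.D3_comm_left hp (0, X t), hL.D3_comm_left hp (0, X t), hL.D2_comm hp (0, X t)] at hX
  rw [hL.D3_comm_left hp (0, Y t), hL.D3_comm_left hp (0, Y t), hL.D2_comm hp (0, Y t),
    hL.D3_comm_right hp _ (0, Y t), hL.D3_comm_right hp _ (0, Y t)] at hY
  rw [hL.D3_comm_right hp _ (0, Y t), hL.D3_comm_right hp _ (0, Y t)]
  have hc := hL.gf_comm hp (deriv Y t) (X t)
  rw [hc]
  simp only [gf] at hX hY ⊢
  dsimp only [p] at hX hY ⊢
  linarith

/-! ### Invariance under changes of coordinates -/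

/-- `θ` is a local diffeomorphism from `U` to `U'` which pulls `L'` back to `L`. -/
structure IsLocalIsometry (U U' : Set (E n)) (L L' : E n → E n → ℝ) (θ : E n → E n) : Prop where
  smooth : ContDiffOn ℝ ∞ θ U
  mapsTo : ∀ x ∈ U, θ x ∈ U'
  injective : ∀ x ∈ U, Function.Injective (fderiv ℝ θ x)
  pullback : ∀ x ∈ U, ∀ y, L x y = L' (θ x) (fderiv ℝ θ x y)

/-- The map induced by `θ` on tangent vectors. -/
def tang (θ : E n → E n) (p : E n × E n) : E n × E n := (θ p.1, fderiv ℝ θ p.1 p.2)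

namespace IsLocalIsometry

variable {U U' : Set (E n)} {L L' : E n → E n → ℝ} {θ : E n → E n}
  (h : IsLocalIsometry U U' L L' θ) (hL : LocalFinsler U L) (hL' : LocalFinsler U' L')
  {p : E n × E n} (hp : p ∈ U ×ˢ ({0}ᶜ : Set (E n)))
include h hp

theorem tang_mem : tang θ p ∈ U' ×ˢ ({0}ᶜ : Set (E n)) :=
  ⟨h.mapsTo _ hp.1, fun h0 => hp.2 (h.injective _ hp.1 (by simpa [tang] using h0))⟩

theorem surjective : Function.Surjective (fderiv ℝ θ p.1) :=
  LinearMap.injective_iff_surjective (f := (fderiv ℝ θ p.1).toLinearMap).1 (h.injective _ hp.1)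

theorem energy_eq : energy L p = energy L' (tang θ p) := by
  simp [energy, tang, h.pullback _ hp.1]

include hL

theorem hasFDerivAt_map : HasFDerivAt θ (fderiv ℝ θ p.1) p.1 :=
  (h.smooth.differentiableAt_infty hL.isOpen hp.1).hasFDerivAt

theorem hasFDerivAt_fderiv : HasFDerivAt (fderiv ℝ θ) (fderiv ℝ (fderiv ℝ θ) p.1) p.1 :=
  ((h.smooth.fderiv_infty hL.isOpen).differentiableAt_infty hL.isOpen hp.1).hasFDerivAt

theorem hasFDerivAt_fderiv_fst : HasFDerivAt (fun q : E n × E n => fderiv ℝ θ q.1)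
    (fderiv ℝ (fderiv ℝ θ) p.1 ∘L ContinuousLinearMap.fst ℝ _ _) p :=
  hasFDerivAt_comp_of (h.hasFDerivAt_fderiv hL hp) hasFDerivAt_fst rfl

theorem hasFDerivAt_tang : ∃ T : E n × E n →L[ℝ] E n × E n, HasFDerivAt (tang θ) T p ∧
    ∀ a, T a = (fderiv ℝ θ p.1 a.1, fderiv ℝ (fderiv ℝ θ) p.1 a.1 p.2 + fderiv ℝ θ p.1 a.2) := by
  refine ⟨_, (hasFDerivAt_comp_of (h.hasFDerivAt_map hL hp) hasFDerivAt_fst rfl).prodMk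
    ((h.hasFDerivAt_fderiv_fst hL hp).clm_apply hasFDerivAt_snd), fun a => ?_⟩
  simp [add_comm]

/-- A constant vector `u`, transported by the derivative of `θ`, as a vertical vector. -/
theorem hasFDerivAt_vertical (u : E n) : ∃ T : E n × E n →L[ℝ] E n × E n,
    HasFDerivAt (fun q : E n × E n => ((0 : E n), fderiv ℝ θ q.1 u)) T p ∧
    ∀ a, T a = (0, fderiv ℝ (fderiv ℝ θ) p.1 a.1 u) := by
  refine ⟨_, (hasFDerivAt_const (0 : E n) p).prodMk
    ((h.hasFDerivAt_fderiv_fst hL hp).clm_apply (hasFDerivAt_const u p)), fun a => ?_⟩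
  simp

include hL'

theorem D1_eq (a : E n × E n) : D1 L p a = D1 L' (tang θ p) (fderiv ℝ θ p.1 a.1,
    fderiv ℝ (fderiv ℝ θ) p.1 a.1 p.2 + fderiv ℝ θ p.1 a.2) := by
  obtain ⟨T, hT, hTa⟩ := h.hasFDerivAt_tang hL hp
  have h1 := hasFDerivAt_comp_of (hL'.smooth_energy.differentiableAt_infty hL'.isOpen_slit
    (h.tang_mem hp)).hasFDerivAt hT rfl
  have h2 := Filter.EventuallyEq.fderiv_eq (𝕜 := ℝ) (x := p) (f₁ := energy L)
    (f := fun q => energy L' (tang θ q)) (by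
      filter_upwards [hL.isOpen_slit.mem_nhds hp] with q hq using h.energy_eq hq)
  rw [D1, h2, h1.fderiv, ContinuousLinearMap.comp_apply, hTa]

theorem D1_vertical_eq (u : E n) : D1 L p (0, u) = D1 L' (tang θ p) (0, fderiv ℝ θ p.1 u) := by
  rw [h.D1_eq hL hL' hp]; simp

theorem D2_vertical_eq (a : E n × E n) (u : E n) : D2 L p a (0, u) =
    D2 L' (tang θ p) (fderiv ℝ θ p.1 a.1, fderiv ℝ (fderiv ℝ θ) p.1 a.1 p.2 + fderiv ℝ θ p.1 a.2)
      (0, fderiv ℝ θ p.1 u) + D1 L' (tang θ p) (0, fderiv ℝ (fderiv ℝ θ) p.1 a.1 u) := by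
  obtain ⟨T, hT, hTa⟩ := h.hasFDerivAt_tang hL hp
  obtain ⟨R, hR, hRa⟩ := h.hasFDerivAt_vertical hL hp u
  have h1 := fderiv_comp_clm_apply₁ (φ := tang θ) (hL'.hasFDerivAt_D1 (h.tang_mem hp)) hT hR a
  have h2 := Filter.EventuallyEq.fderiv_eq (𝕜 := ℝ) (x := p) (f₁ := fun q => D1 L q (0, u))
    (f := fun q => D1 L' (tang θ q) (0, fderiv ℝ θ q.1 u)) (by
      filter_upwards [hL.isOpen_slit.mem_nhds hp] with q hq using h.D1_vertical_eq hL hL' hq u)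
  rw [← fderiv_fderiv_apply hL.smooth_energy hL.isOpen_slit hp, h2, h1, hTa, hRa]

theorem gf_eq (u v : E n) :
    gf L p u v = gf L' (tang θ p) (fderiv ℝ θ p.1 u) (fderiv ℝ θ p.1 v) := by
  rw [gf, h.D2_vertical_eq hL hL' hp]; simp [gf, LocalFinsler.D_zero_pair]

/-- The transformation law of the spray, the second derivative of `θ` being the inhomogeneous
term. -/
theorem spray_eq : fderiv ℝ θ p.1 (spray L p) =
    spray L' (tang θ p) + fderiv ℝ (fderiv ℝ θ) p.1 p.2 p.2 := by
  refine hL'.gf_ext (h.tang_mem hp) fun w => ?_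
  obtain ⟨u, rfl⟩ := h.surjective hp w
  rw [← h.gf_eq hL hL' hp, hL.gf_spray hp, h.D2_vertical_eq hL hL' hp, h.D1_eq hL hL' hp]
  have e : ∀ a b : E n, (a, b) = (a, 0) + (0, b) := by simp
  have e' : ∀ a b : E n, ((0 : E n), a + b) = (0, a) + (0, b) := by simp
  have h1 := hL'.gf_spray (h.tang_mem hp) (fderiv ℝ θ p.1 u)
  rw [gf] at h1 ⊢
  rw [e', map_add, _root_.add_apply, h1, e (fderiv ℝ θ p.1 u), e (fderiv ℝ θ p.1 p.2)]
  simp only [map_add, _root_.add_apply, map_zero, add_zero]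
  rw [fderiv_fderiv_comm h.smooth hL.isOpen hp.1 u p.2]
  simp only [tang]
  ring

theorem nonlin_eq (X : E n) : fderiv ℝ θ p.1 (nonlin L p X) =
    nonlin L' (tang θ p) (fderiv ℝ θ p.1 X) + fderiv ℝ (fderiv ℝ θ) p.1 p.2 X := by
  obtain ⟨T, hT, hTa⟩ := h.hasFDerivAt_tang hL hp
  have h1 := fderiv_clm_apply₁ (h.hasFDerivAt_fderiv_fst hL hp) (hL.hasFDerivAt_spray hp) (0, X)
  have h2 := hasFDerivAt_comp_of (hL'.hasFDerivAt_spray (h.tang_mem hp)) hT rfl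
  have h3' := (((h.smooth.fderiv_infty hL.isOpen).fderiv_infty hL.isOpen).differentiableAt_infty
    hL.isOpen hp.1).hasFDerivAt
  have h3 := fderiv_comp_clm_apply₂ (φ := Prod.fst (α := E n) (β := E n)) h3'
    hasFDerivAt_fst hasFDerivAt_snd hasFDerivAt_snd (0, X)
  have d3 : DifferentiableAt ℝ (fun q : E n × E n => fderiv ℝ (fderiv ℝ θ) q.1 q.2 q.2) p :=
    (((hasFDerivAt_comp_of h3' hasFDerivAt_fst rfl).clm_apply hasFDerivAt_snd).clm_apply
      hasFDerivAt_snd).differentiableAt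
  have h4 := Filter.EventuallyEq.fderiv_eq (𝕜 := ℝ) (x := p)
    (f₁ := fun q => fderiv ℝ θ q.1 (spray L q))
    (f := (fun q => spray L' (tang θ q)) + fun q => fderiv ℝ (fderiv ℝ θ) q.1 q.2 q.2) (by
      filter_upwards [hL.isOpen_slit.mem_nhds hp] with q hq using h.spray_eq hL hL' hq)
  rw [fderiv_add h2.differentiableAt d3, h2.fderiv] at h4
  rw [h4, _root_.add_apply, h3, ContinuousLinearMap.comp_apply, hTa] at h1
  simp only [map_zero, _root_.zero_apply, zero_add, ContinuousLinearMap.comp_apply,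
    ContinuousLinearMap.coe_fst', ContinuousLinearMap.coe_snd'] at h1
  rw [fderiv_fderiv_comm h.smooth hL.isOpen hp.1 X p.2] at h1
  rw [hL.nonlin_eq hp, hL'.nonlin_eq (h.tang_mem hp), map_smul, ← h1]
  module

theorem cartan_eq (b X : E n) : fderiv ℝ θ p.1 (cartan L p b X) =
    cartan L' (tang θ p) (fderiv ℝ θ p.1 b) (fderiv ℝ θ p.1 X) := by
  refine hL'.gf_ext (h.tang_mem hp) fun w => ?_
  obtain ⟨u, rfl⟩ := h.surjective hp w
  rw [← h.gf_eq hL hL' hp, hL.gf_cartan hp, hL'.gf_cartan (h.tang_mem hp)]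
  obtain ⟨T, hT, hTa⟩ := h.hasFDerivAt_tang hL hp
  obtain ⟨R, hR, hRa⟩ := h.hasFDerivAt_vertical hL hp u
  obtain ⟨Q, hQ, hQa⟩ := h.hasFDerivAt_vertical hL hp X
  have h1 := fderiv_comp_clm_apply₂ (φ := tang θ) (hL'.hasFDerivAt_D2 (h.tang_mem hp)) hT hQ hR
    (0, b)
  have h2 := Filter.EventuallyEq.fderiv_eq (𝕜 := ℝ) (x := p) (f₁ := fun q => gf L q X u)
    (f := fun q => D2 L' (tang θ q) (0, fderiv ℝ θ q.1 X) (0, fderiv ℝ θ q.1 u)) (by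
      filter_upwards [hL.isOpen_slit.mem_nhds hp] with q hq using h.gf_eq hL hL' hq X u)
  rw [← h2, (hL.hasFDerivAt_gf hp X u).fderiv, hTa, hRa, hQa] at h1
  simp only [map_zero, _root_.zero_apply, zero_add, LocalFinsler.D_zero_pair, add_zero,
    ContinuousLinearMap.flip_apply] at h1
  rw [h1]

omit h hp in
/-- The Cartan covariant derivative along a curve does not depend on the coordinates. -/
theorem covDeriv_eq (h : IsLocalIsometry U U' L L' θ) {x X : ℝ → E n} {t : ℝ}
    (hx : x t ∈ U) (hy : deriv x t ≠ 0)
    (dx : ∀ᶠ s in nhds t, DifferentiableAt ℝ x s) (ddx : DifferentiableAt ℝ (deriv x) t)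
    (dX : DifferentiableAt ℝ X t) :
    Local.covDeriv L' (fun s => θ (x s)) (fun s => fderiv ℝ θ (x s) (X s)) t =
      fderiv ℝ θ (x t) (Local.covDeriv L x X t) := by
  have hp : (x t, deriv x t) ∈ U ×ˢ ({0}ᶜ : Set (E n)) := ⟨hx, hy⟩
  have hmem := h.tang_mem hp
  have hd : ∀ᶠ s in nhds t, deriv (fun s => θ (x s)) s = fderiv ℝ θ (x s) (deriv x s) := by
    filter_upwards [dx, dx.self_of_nhds.continuousAt.preimage_mem_nhds (hL.isOpen.mem_nhds hx)]
      with s hs hsU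
    exact ((h.smooth.differentiableAt_infty hL.isOpen hsU).hasFDerivAt.comp_hasDerivAt s
      hs.hasDerivAt).deriv
  have hd1 := hd.self_of_nhds
  have hF : HasDerivAt (fun s => fderiv ℝ θ (x s)) (fderiv ℝ (fderiv ℝ θ) (x t) (deriv x t)) t :=
    (h.hasFDerivAt_fderiv hL hp).comp_hasDerivAt t dx.self_of_nhds.hasDerivAt
  have hd2 : deriv (deriv fun s => θ (x s)) t = fderiv ℝ θ (x t) (deriv (deriv x) t) +
      fderiv ℝ (fderiv ℝ θ) (x t) (deriv x t) (deriv x t) := by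
    rw [Filter.EventuallyEq.deriv_eq hd, (hF.clm_apply ddx.hasDerivAt).deriv]
    exact add_comm _ _
  have hdX : deriv (fun s => fderiv ℝ θ (x s) (X s)) t = fderiv ℝ θ (x t) (deriv X t) +
      fderiv ℝ (fderiv ℝ θ) (x t) (deriv x t) (X t) := by
    rw [(hF.clm_apply dX.hasDerivAt).deriv]
    exact add_comm _ _
  have hs := h.spray_eq hL hL' hp
  have hN := h.nonlin_eq hL hL' hp (X t)
  have hC := h.cartan_eq hL hL' hp (deriv (deriv x) t + spray L (x t, deriv x t)) (X t)
  rw [hL'.covDeriv_eq (h.mapsTo _ hx) (by rw [hd1]; exact hmem.2), hL.covDeriv_eq hx hy, hd1, hd2,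
    hdX]
  simp only [tang] at hs hN hC
  rw [map_add, map_add, hN, hC, map_add, hs]
  rw [show fderiv ℝ θ (x t) (deriv (deriv x) t) + (spray L' (θ (x t), fderiv ℝ θ (x t) (deriv x t))
    + fderiv ℝ (fderiv ℝ θ) (x t) (deriv x t) (deriv x t)) = fderiv ℝ θ (x t) (deriv (deriv x) t) +
    fderiv ℝ (fderiv ℝ θ) (x t) (deriv x t) (deriv x t) + spray L' (θ (x t), fderiv ℝ θ (x t)
    (deriv x t)) by abel]
  abel

end IsLocalIsometry

end Finsler

namespace Finsler

variable {n : ℕ}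

open Local Set

/-! ### Geodesic circles in local coordinates -/

/-- Integral curves of a smooth vector field are smooth. -/
theorem contDiffOn_of_hasDerivAt_ode {V : Type*} [NormedAddCommGroup V] [NormedSpace ℝ V]
    {v : V → V} {O : Set V} (hv : ContDiffOn ℝ ∞ v O) {z : ℝ → V} {I : Set ℝ} (hI : IsOpen I)
    (hz : ∀ t ∈ I, z t ∈ O ∧ HasDerivAt z (v (z t)) t) : ContDiffOn ℝ ∞ z I := by
  rw [contDiffOn_infty]
  intro m
  induction m with
  | zero => exact contDiffOn_zero.2 fun t ht => (hz t ht).2.continuousAt.continuousWithinAt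
  | succ m ih =>
    push_cast
    rw [contDiffOn_succ_iff_deriv_of_isOpen hI]
    refine ⟨fun t ht => (hz t ht).2.differentiableAt.differentiableWithinAt, by simp, ?_⟩
    exact ((hv.of_le (by exact_mod_cast le_top)).comp ih fun t ht => (hz t ht).1).congr
      fun t ht => (hz t ht).2.deriv

/-- Smooth vector fields have smooth integral curves. -/
theorem exists_smooth_integral_curve {V : Type*} [NormedAddCommGroup V] [NormedSpace ℝ V]
    [CompleteSpace V] {v : V → V} {O : Set V} (hO : IsOpen O) (hv : ContDiffOn ℝ ∞ v O) {z₀ : V}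
    (hz₀ : z₀ ∈ O) : ∃ ε > 0, ∃ z : ℝ → V, z 0 = z₀ ∧ ContDiffOn ℝ ∞ z (Ioo (-ε) ε) ∧
      ∀ t ∈ Ioo (-ε) ε, z t ∈ O ∧ HasDerivAt z (v (z t)) t := by
  obtain ⟨z, hz, ε, hε, h⟩ :=
    ((hv.contDiffAt (hO.mem_nhds hz₀)).of_le (by exact_mod_cast le_top)
      : ContDiffAt ℝ 1 v z₀).exists_forall_mem_closedBall_exists_eq_forall_mem_Ioo_hasDerivAt₀ 0
  simp only [zero_sub, zero_add] at h
  have hc : ContinuousAt z 0 := (h 0 ⟨by linarith, hε⟩).continuousAt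
  obtain ⟨δ, hδ, hδO⟩ := Metric.mem_nhds_iff.1 (hc.preimage_mem_nhds (by
    rw [hz]; exact hO.mem_nhds hz₀))
  rw [Real.ball_eq_Ioo, zero_sub, zero_add] at hδO
  have key : ∀ t ∈ Ioo (-min ε δ) (min ε δ), z t ∈ O ∧ HasDerivAt z (v (z t)) t := fun t ht =>
    ⟨hδO ⟨by linarith [ht.1, min_le_right ε δ], by linarith [ht.2, min_le_right ε δ]⟩,
      h t ⟨by linarith [ht.1, min_le_left ε δ], by linarith [ht.2, min_le_left ε δ]⟩⟩
  exact ⟨min ε δ, lt_min hε hδ, z, hz, contDiffOn_of_hasDerivAt_ode hv isOpen_Ioo key, key⟩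

theorem gf_add_right (L : E n → E n → ℝ) (p : E n × E n) (u v v' : E n) :
    gf L p u (v + v') = gf L p u v + gf L p u v' := by
  have : ((0 : E n), v + v') = (0, v) + (0, v') := by simp
  rw [gf, this, map_add]; rfl

theorem gf_smul_left (L : E n → E n → ℝ) (p : E n × E n) (r : ℝ) (u v : E n) :
    gf L p (r • u) v = r * gf L p u v := by
  have : ((0 : E n), r • u) = r • (0, u) := by simp
  rw [gf, this, map_smul]; rfl

theorem gf_smul_right (L : E n → E n → ℝ) (p : E n × E n) (r : ℝ) (u v : E n) :
    gf L p u (r • v) = r * gf L p u v := by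
  have : ((0 : E n), r • v) = r • (0, v) := by simp
  rw [gf, this, map_smul]; rfl

/-- The only solution with zero initial data of the linear system satisfied by
`u = g(c', c') - 1`, `b = g(c', w)` and `q = g(w, w) - k²` is the zero solution, because
`q + k² u` is constant along it, hence zero, and then `b² + k² u²` is constant as well. -/
theorem conservation {u b q : ℝ → ℝ} {k ε : ℝ} (hk : k ≠ 0) (hε : 0 < ε)
    (hu : ∀ t ∈ Ioo (-ε) ε, HasDerivAt u (2 * b t) t)
    (hb : ∀ t ∈ Ioo (-ε) ε, HasDerivAt b (q t - k ^ 2 * u t) t)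
    (hq : ∀ t ∈ Ioo (-ε) ε, HasDerivAt q (-2 * k ^ 2 * b t) t)
    (u0 : u 0 = 0) (b0 : b 0 = 0) (q0 : q 0 = 0) :
    ∀ t ∈ Ioo (-ε) ε, u t = 0 ∧ q t = 0 := by
  have const : ∀ f : ℝ → ℝ, (∀ t ∈ Ioo (-ε) ε, HasDerivAt f 0 t) → f 0 = 0 →
      ∀ t ∈ Ioo (-ε) ε, f t = 0 := by
    intro f hf f0 t ht
    rw [← f0]
    exact isOpen_Ioo.is_const_of_deriv_eq_zero isPreconnected_Ioo
      (fun s hs => (hf s hs).differentiableAt.differentiableWithinAt)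
      (fun s hs => (hf s hs).deriv) ht ⟨by linarith, hε⟩
  have h1 := const (fun t => q t + k ^ 2 * u t)
    (fun t ht => ((hq t ht).add ((hu t ht).const_mul (k ^ 2))).congr_deriv (by ring))
    (by simp [u0, q0])
  have h2 := const (fun t => b t ^ 2 + k ^ 2 * u t ^ 2)
    (fun t ht => (((hb t ht).pow 2).add (((hu t ht).pow 2).const_mul (k ^ 2))).congr_deriv (by
      have := h1 t ht
      push_cast
      linear_combination 2 * b t * this)) (by simp [u0, b0])
  intro t ht
  have h3 := h2 t ht
  have h4 : u t = 0 := by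
    have : k ^ 2 * u t ^ 2 = 0 := by nlinarith [sq_nonneg (b t), sq_nonneg (k * u t)]
    simpa [hk] using this
  have h5 := h1 t ht
  simp only [h4, mul_zero, add_zero] at h5
  exact ⟨h4, h5⟩

namespace LocalFinsler

variable {U : Set (E n)} {L : E n → E n → ℝ} (hL : LocalFinsler U L)
include hL

/-- The acceleration: the Cartan covariant derivative of the velocity. -/
theorem covDeriv_velocity {x : ℝ → E n} {t : ℝ} (hx : x t ∈ U) (hy : deriv x t ≠ 0) :
    Local.covDeriv L x (deriv x) t = deriv (deriv x) t + spray L (x t, deriv x t) := by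
  have hp : (x t, deriv x t) ∈ U ×ˢ ({0}ᶜ : Set (E n)) := ⟨hx, hy⟩
  have h1 := hL.nonlin_self hp
  have h2 := hL.cartan_self_right hp
  dsimp only at h1 h2
  rw [hL.covDeriv_eq hx hy, h1, h2, add_zero]

/-- The vector field on triples `((x, y), w)` whose integral curves are the geodesic circles. -/
theorem smooth_circle_field (k : ℝ) : ContDiffOn ℝ ∞ (fun z : (E n × E n) × E n =>
    ((z.1.2, z.2 - spray L z.1),
      - nonlin L z.1 z.2 - cartan L z.1 z.2 z.2 - k ^ 2 • z.1.2)) ((U ×ˢ {0}ᶜ) ×ˢ univ) := by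
  have hm : MapsTo (Prod.fst : (E n × E n) × E n → E n × E n)
    ((U ×ˢ ({0}ᶜ : Set (E n))) ×ˢ univ) (U ×ˢ {0}ᶜ) := fun z hz => hz.1
  have hfst : ContDiffOn ℝ ∞ (Prod.fst : (E n × E n) × E n → E n × E n)
    ((U ×ˢ ({0}ᶜ : Set (E n))) ×ˢ univ) := contDiffOn_fst
  have hcoord : ∀ j : Fin n, ContDiffOn ℝ ∞ (fun z : (E n × E n) × E n => z.2 j)
    ((U ×ˢ ({0}ᶜ : Set (E n))) ×ˢ univ) := fun j => by fun_prop
  refine ((contDiffOn_snd.comp hfst fun z _ => mem_univ z.1).prodMk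
    (contDiffOn_snd.sub (hL.smooth_spray.comp hfst hm))).prodMk (.sub (.sub (.neg ?_) ?_) ?_)
  · rw [contDiffOn_euclidean]
    simp only [nonlin]
    exact fun i => ContDiffOn.sum fun j _ => ((hL.smooth_N i j).comp hfst hm).mul (hcoord j)
  · rw [contDiffOn_euclidean]
    simp only [cartan]
    exact fun i => ContDiffOn.sum fun j _ => ContDiffOn.sum fun k _ =>
      (((hL.smooth_C i j k).comp hfst hm).mul (hcoord k)).mul (hcoord j)
  · exact (contDiffOn_snd.comp hfst fun z _ => mem_univ z.1).const_smul _

/-- A geodesic circle with prescribed initial point, unit velocity `y₀` and curvature vector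
`w₀ ⟂ y₀`, `w₀ ≠ 0`, in local coordinates. Here `w` is its curvature vector `∇_{x'} x'`. -/
theorem exists_circle {x₀ y₀ w₀ : E n} (hx₀ : x₀ ∈ U) (hy₀ : L x₀ y₀ = 1) (hy₀' : y₀ ≠ 0)
    (hw₀ : w₀ ≠ 0) (hperp : gf L (x₀, y₀) y₀ w₀ = 0) :
    ∃ ε > 0, ∃ k > 0, ∃ x w : ℝ → E n, x 0 = x₀ ∧ deriv x 0 = y₀ ∧ w 0 = w₀ ∧
      ContDiffOn ℝ ∞ x (Ioo (-ε) ε) ∧ ContDiffOn ℝ ∞ w (Ioo (-ε) ε) ∧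
      ∀ t ∈ Ioo (-ε) ε, x t ∈ U ∧ deriv x t ≠ 0 ∧ L (x t) (deriv x t) = 1 ∧
        Local.covDeriv L x (deriv x) t = w t ∧ Local.covDeriv L x w t = -(k ^ 2 • deriv x t) ∧
        gf L (x t, deriv x t) (w t) (w t) = k ^ 2 := by
  have hp₀ : (x₀, y₀) ∈ U ×ˢ ({0}ᶜ : Set (E n)) := ⟨hx₀, hy₀'⟩
  have hpos := hL.posDef x₀ hx₀ y₀ hy₀' w₀ hw₀
  set k := √(gf L (x₀, y₀) w₀ w₀) with hk
  have hk2 : k ^ 2 = gf L (x₀, y₀) w₀ w₀ := Real.sq_sqrt hpos.le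
  have hkpos : 0 < k := Real.sqrt_pos.2 hpos
  obtain ⟨ε, hε, z, hz0, hzs, hz⟩ := exists_smooth_integral_curve
    (hL.isOpen_slit.prod isOpen_univ) (hL.smooth_circle_field k)
    (z₀ := ((x₀, y₀), w₀)) ⟨hp₀, mem_univ _⟩
  have h0 : (0 : ℝ) ∈ Ioo (-ε) ε := ⟨by linarith, hε⟩
  set x : ℝ → E n := fun t => (z t).1.1 with hxdef
  set w : ℝ → E n := fun t => (z t).2 with hwdef
  have hp : ∀ t ∈ Ioo (-ε) ε, (x t, (z t).1.2) ∈ U ×ˢ ({0}ᶜ : Set (E n)) := fun t ht =>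
    (hz t ht).1.1
  have hxd : ∀ t ∈ Ioo (-ε) ε, HasDerivAt x (z t).1.2 t := fun t ht =>
    ((ContinuousLinearMap.fst ℝ (E n) (E n)).comp
      (ContinuousLinearMap.fst ℝ (E n × E n) (E n))).hasFDerivAt.comp_hasDerivAt t (hz t ht).2
  have hyd : ∀ t ∈ Ioo (-ε) ε,
      HasDerivAt (fun t => (z t).1.2) (w t - spray L (x t, (z t).1.2)) t := fun t ht =>
    ((ContinuousLinearMap.snd ℝ (E n) (E n)).comp
      (ContinuousLinearMap.fst ℝ (E n × E n) (E n))).hasFDerivAt.comp_hasDerivAt t (hz t ht).2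
  have hwd : ∀ t ∈ Ioo (-ε) ε, HasDerivAt w (- nonlin L (x t, (z t).1.2) (w t) -
      cartan L (x t, (z t).1.2) (w t) (w t) - k ^ 2 • (z t).1.2) t := fun t ht =>
    (ContinuousLinearMap.snd ℝ (E n × E n) (E n)).hasFDerivAt.comp_hasDerivAt t (hz t ht).2
  have hxy : ∀ t ∈ Ioo (-ε) ε, deriv x t = (z t).1.2 := fun t ht => (hxd t ht).deriv
  have hyd' : ∀ t ∈ Ioo (-ε) ε, HasDerivAt (deriv x) (w t - spray L (x t, deriv x t)) t := by
    intro t ht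
    rw [hxy t ht]
    refine (hyd t ht).congr_of_eventuallyEq ?_
    filter_upwards [isOpen_Ioo.mem_nhds ht] with s hs using hxy s hs
  have hy0 : ∀ t ∈ Ioo (-ε) ε, deriv x t ≠ 0 := fun t ht => by
    rw [hxy t ht]; exact (hp t ht).2
  have hcov1 : ∀ t ∈ Ioo (-ε) ε, Local.covDeriv L x (deriv x) t = w t := fun t ht => by
    rw [hL.covDeriv_velocity (hp t ht).1 (hy0 t ht), (hyd' t ht).deriv]
    abel
  have hcov2 : ∀ t ∈ Ioo (-ε) ε, Local.covDeriv L x w t = -(k ^ 2 • deriv x t) := fun t ht => by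
    rw [hL.covDeriv_eq (hp t ht).1 (hy0 t ht), (hyd' t ht).deriv, (hwd t ht).deriv, hxy t ht,
      sub_add_cancel]
    abel
  have hcons := conservation (u := fun t => gf L (x t, deriv x t) (deriv x t) (deriv x t) - 1)
    (b := fun t => gf L (x t, deriv x t) (deriv x t) (w t))
    (q := fun t => gf L (x t, deriv x t) (w t) (w t) - k ^ 2) hkpos.ne' hε
    (fun t ht => ((hL.hasDerivAt_gf (hp t ht).1 (hy0 t ht) (hxd t ht).differentiableAt
      (hyd' t ht).differentiableAt (hyd' t ht).differentiableAt
      (hyd' t ht).differentiableAt).sub_const 1).congr_deriv (by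
        rw [hcov1 t ht, hL.gf_comm (p := (x t, deriv x t)) ⟨(hp t ht).1, hy0 t ht⟩ (w t)]; ring))
    (fun t ht => (hL.hasDerivAt_gf (hp t ht).1 (hy0 t ht) (hxd t ht).differentiableAt
      (hyd' t ht).differentiableAt (hyd' t ht).differentiableAt
      (hwd t ht).differentiableAt).congr_deriv (by
        rw [hcov1 t ht, hcov2 t ht, ← neg_smul, gf_smul_right]; ring))
    (fun t ht => ((hL.hasDerivAt_gf (hp t ht).1 (hy0 t ht) (hxd t ht).differentiableAt
      (hyd' t ht).differentiableAt (hwd t ht).differentiableAt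
      (hwd t ht).differentiableAt).sub_const _).congr_deriv (by
        rw [hcov2 t ht, ← neg_smul, gf_smul_right, gf_smul_left,
          hL.gf_comm (p := (x t, deriv x t)) ⟨(hp t ht).1, hy0 t ht⟩ (w t)]; ring))
    (by
      rw [hxy 0 h0]
      have := hL.gf_self hp₀
      dsimp only at this
      simp [hxdef, hz0, this, hy₀])
    (by rw [hxy 0 h0]; simp [hxdef, hwdef, hz0, hperp])
    (by rw [hxy 0 h0, hk2]; simp [hxdef, hwdef, hz0])
  refine ⟨ε, hε, k, hkpos, x, w, by simp [hxdef, hz0], by rw [hxy 0 h0, hz0], by simp [hwdef, hz0],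
    (contDiff_fst.comp contDiff_fst).comp_contDiffOn hzs, contDiff_snd.comp_contDiffOn hzs,
    fun t ht => ⟨(hp t ht).1, hy0 t ht, ?_, hcov1 t ht, hcov2 t ht, ?_⟩⟩
  · have h1 := (hcons t ht).1
    have h2 := hL.gf_self (p := (x t, deriv x t)) ⟨(hp t ht).1, hy0 t ht⟩
    dsimp only at h1 h2
    have h3 := hL.nonneg (x t) (hp t ht).1 (deriv x t)
    nlinarith
  · linarith [(hcons t ht).2]

end LocalFinsler

end Finsler

namespace Finsler

open Local Set

variable {n : ℕ} {M : Type*} [TopologicalSpace M] [ChartedSpace (E n) M]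
  [IsManifold 𝓘(ℝ, E n) ∞ M]

/-! ### Local parametrizations of a Finsler manifold -/

/-- A smooth map `κ` from an open subset `U` of `ℝⁿ` to `M` with injective (hence invertible)
differentials. Besides inverses of charts, these include compositions of inverses of charts with a
local diffeomorphism. -/
structure IsLocalParam (U : Set (E n)) (κ : E n → M) : Prop where
  isOpen : IsOpen U
  smooth : ContMDiffOn 𝓘(ℝ, E n) 𝓘(ℝ, E n) ∞ κ U
  injective : ∀ x ∈ U, Function.Injective (mfderiv 𝓘(ℝ, E n) 𝓘(ℝ, E n) κ x)

/-- The expression of `F` in the coordinates given by `κ`. -/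
def pullF (F : TangentBundle 𝓘(ℝ, E n) M → ℝ) (κ : E n → M) (x y : E n) : ℝ :=
  F ⟨κ x, mfderiv 𝓘(ℝ, E n) 𝓘(ℝ, E n) κ x y⟩

theorem gf_eq_fderiv {L : E n → E n → ℝ} {W : Set (E n × E n)} (hW : IsOpen W)
    (he : ContDiffOn ℝ ∞ (energy L) W) {p : E n × E n} (hp : p ∈ W) (u v : E n) :
    gf L p u v = (1 / 2) * fderiv ℝ (fun z => fderiv ℝ (fun w => L p.1 w ^ 2) z u) p.2 v := by
  have hinr : ∀ z, HasFDerivAt (fun z : E n => (p.1, z)) (ContinuousLinearMap.inr ℝ (E n) (E n)) z :=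
    fun z => (hasFDerivAt_const p.1 z).prodMk (hasFDerivAt_id z)
  have h1 : ∀ z, (p.1, z) ∈ W →
      fderiv ℝ (fun w => L p.1 w ^ 2) z u = 2 * D1 L (p.1, z) (0, u) := by
    intro z hz
    have h := hasFDerivAt_comp_of ((he.differentiableAt_infty hW hz).hasFDerivAt.const_mul 2)
      (hinr z) rfl
    have e : (fun w => L p.1 w ^ 2) = fun w => 2 * energy L (p.1, w) := by
      ext w; simp only [energy]; ring
    rw [e, h.fderiv]
    simp
  have h2 : (fun z => fderiv ℝ (fun w => L p.1 w ^ 2) z u) =ᶠ[nhds p.2]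
      fun z => 2 * D1 L (p.1, z) (0, u) := by
    have hc : ContinuousAt (fun z : E n => (p.1, z)) p.2 := by fun_prop
    filter_upwards [hc.preimage_mem_nhds (hW.mem_nhds hp)] with z hz using h1 z hz
  have h3 : HasFDerivAt (fun z => D1 L (p.1, z) (0, u)) _ p.2 :=
    (hasFDerivAt_comp_of ((he.fderiv_infty hW).differentiableAt_infty hW hp).hasFDerivAt
      (hinr p.2) rfl).clm_apply (hasFDerivAt_const _ _)
  rw [h2.fderiv_eq, (h3.const_mul 2).fderiv, gf, fderiv_fderiv_comm he hW hp]
  simp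

omit [IsManifold 𝓘(ℝ, E n) ∞ M] in
/-- The fundamental tensor in the coordinates given by a linear isomorphism of a tangent space. -/
theorem fundamentalTensor_linear (F : TangentBundle 𝓘(ℝ, E n) M → ℝ) (q : M)
    (A : E n ≃L[ℝ] E n) (y u v : E n) :
    (1 / 2) * fderiv ℝ (fun z => fderiv ℝ (fun w => F ⟨q, A w⟩ ^ 2) z u) y v =
      fundamentalTensor F q (A y) (A u) (A v) := by
  have h1 : ∀ (f : E n → ℝ) (z a : E n), fderiv ℝ (fun w => f (A w)) z a =
      fderiv ℝ f (A z) (A a) := by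
    intro f z a
    have := A.comp_right_fderiv (f := f) (x := z)
    exact congrArg (fun φ => φ a) this
  change _ = (1 / 2) * fderiv ℝ (fun z : E n => fderiv ℝ (fun w : E n => F ⟨q, w⟩ ^ 2) z (A u))
    (A y) (A v)
  simp only [h1 (fun w : E n => F ⟨q, w⟩ ^ 2)]
  rw [h1 (fun z => fderiv ℝ (fun w : E n => F ⟨q, w⟩ ^ 2) z (A u))]

theorem contMDiff_pair : ContMDiff 𝓘(ℝ, E n × E n) 𝓘(ℝ, E n).tangent ∞
    (fun p : E n × E n => (⟨p.1, p.2⟩ : TangentBundle 𝓘(ℝ, E n) (E n))) := by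
  have := contMDiff_tangentBundleModelSpaceHomeomorph_symm (I := 𝓘(ℝ, E n)) (n := ∞)
  rw [modelWithCornersSelf_prod]
  exact this

theorem contDiffOn_pullF (Φ : FinslerStructure n M) {U : Set (E n)} {κ : E n → M}
    (hκ : IsLocalParam U κ) :
    ContDiffOn ℝ ∞ (fun p : E n × E n => pullF Φ.F κ p.1 p.2) (U ×ˢ {0}ᶜ) := by
  rw [← contMDiffOn_iff_contDiffOn]
  have h1 := hκ.smooth.contMDiffOn_tangentMapWithin (m := ∞) (by simp) hκ.isOpen.uniqueMDiffOn
  have h3 := h1.comp (contMDiff_pair.contMDiffOn (s := U ×ˢ ({0}ᶜ : Set (E n)))) (fun p hp => hp.1)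
  have h4 := Φ.smooth.comp h3 (fun p hp => by
    intro h0
    have h : mfderivWithin 𝓘(ℝ, E n) 𝓘(ℝ, E n) κ U p.1 p.2 = 0 := h0
    rw [mfderivWithin_of_isOpen hκ.isOpen hp.1] at h
    exact hp.2 (hκ.injective p.1 hp.1 (h.trans (map_zero _).symm)))
  refine h4.congr fun p hp => ?_
  have : mfderivWithin 𝓘(ℝ, E n) 𝓘(ℝ, E n) κ U p.1 = mfderiv 𝓘(ℝ, E n) 𝓘(ℝ, E n) κ p.1 :=
    mfderivWithin_of_isOpen hκ.isOpen hp.1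
  change _ = Φ.F ⟨κ p.1, mfderivWithin 𝓘(ℝ, E n) 𝓘(ℝ, E n) κ U p.1 p.2⟩
  rw [this]
  rfl

namespace IsLocalParam

variable {U : Set (E n)} {κ : E n → M} (hκ : IsLocalParam U κ) (Φ : FinslerStructure n M)
include hκ

omit [IsManifold 𝓘(ℝ, E n) ∞ M] in
/-- The differential of a local parametrization, as a linear isomorphism. -/
theorem exists_equiv {x : E n} (hx : x ∈ U) :
    ∃ A : E n ≃L[ℝ] E n, ∀ u, A u = mfderiv 𝓘(ℝ, E n) 𝓘(ℝ, E n) κ x u := by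
  have hinj := hκ.injective x hx
  let B : E n →L[ℝ] E n := mfderiv 𝓘(ℝ, E n) 𝓘(ℝ, E n) κ x
  exact ⟨(LinearEquiv.ofInjectiveEndo B.toLinearMap hinj).toContinuousLinearEquiv, fun u => rfl⟩

theorem smooth_energy_pullF : ContDiffOn ℝ ∞ (energy (pullF Φ.F κ)) (U ×ˢ {0}ᶜ) :=
  ((contDiffOn_pullF Φ hκ).pow 2).div_const 2

theorem gf_pullF {x y : E n} (hx : x ∈ U) (hy : y ≠ 0) (u v : E n) :
    gf (pullF Φ.F κ) (x, y) u v = fundamentalTensor Φ.F (κ x)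
      (mfderiv 𝓘(ℝ, E n) 𝓘(ℝ, E n) κ x y) (mfderiv 𝓘(ℝ, E n) 𝓘(ℝ, E n) κ x u)
      (mfderiv 𝓘(ℝ, E n) 𝓘(ℝ, E n) κ x v) := by
  obtain ⟨A, hA⟩ := hκ.exists_equiv hx
  rw [gf_eq_fderiv (hκ.isOpen.prod isOpen_compl_singleton) (hκ.smooth_energy_pullF Φ)
    (p := (x, y)) ⟨hx, hy⟩]
  have h := fundamentalTensor_linear Φ.F (κ x) A y u v
  rw [hA y, hA u, hA v] at h
  rw [← h]
  simp only [hA]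
  rfl

theorem localFinsler : LocalFinsler U (pullF Φ.F κ) where
  isOpen := hκ.isOpen
  smooth := contDiffOn_pullF Φ hκ
  nonneg _ _ _ := Φ.nonneg _
  homog x _ y r hr := by
    have h := Φ.homog (κ x) (mfderiv 𝓘(ℝ, E n) 𝓘(ℝ, E n) κ x y) r hr
    exact (congrArg (fun v => Φ.F ⟨κ x, v⟩) (map_smul _ r y)).trans h
  posDef x hx y hy v hv := by
    rw [hκ.gf_pullF Φ hx hy]
    have h0 : ∀ a : E n, a ≠ 0 → mfderiv 𝓘(ℝ, E n) 𝓘(ℝ, E n) κ x a ≠ 0 := fun a ha h =>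
      ha (hκ.injective x hx (h.trans (map_zero _).symm))
    exact Φ.posDef _ _ _ (h0 y hy) (h0 v hv)

omit [IsManifold 𝓘(ℝ, E n) ∞ M] in
theorem mdifferentiableAt {x : E n} (hx : x ∈ U) :
    MDifferentiableAt 𝓘(ℝ, E n) 𝓘(ℝ, E n) κ x :=
  (hκ.smooth.contMDiffAt (hκ.isOpen.mem_nhds hx)).mdifferentiableAt (by simp)

end IsLocalParam

theorem isLocalParam_extChartAt_symm (q : M) :
    IsLocalParam (extChartAt 𝓘(ℝ, E n) q).target (extChartAt 𝓘(ℝ, E n) q).symm where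
  isOpen := isOpen_extChartAt_target q
  smooth := contMDiffOn_extChartAt_symm q
  injective x hx := by
    have h := isInvertible_mfderivWithin_extChartAt_symm (I := 𝓘(ℝ, E n)) hx
    rw [ModelWithCorners.range_eq_univ, mfderivWithin_univ] at h
    exact h.injective

theorem localFinsler_localExpr (Φ : FinslerStructure n M) (q : M) :
    LocalFinsler (extChartAt 𝓘(ℝ, E n) q).target (localExpr Φ.F q) :=
  (isLocalParam_extChartAt_symm q).localFinsler Φ

namespace IsLocalParam

variable {U : Set (E n)} {κ : E n → M} (hκ : IsLocalParam U κ) (Φ : FinslerStructure n M)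
include hκ

omit [IsManifold 𝓘(ℝ, E n) ∞ M] in
theorem isOpen_inter_preimage (q : M) :
    IsOpen (U ∩ κ ⁻¹' (extChartAt 𝓘(ℝ, E n) q).source) :=
  hκ.smooth.continuousOn.isOpen_inter_preimage hκ.isOpen (isOpen_extChartAt_source q)

theorem fderiv_chart_comp (q : M) {x : E n} (hx : x ∈ U)
    (hxq : κ x ∈ (extChartAt 𝓘(ℝ, E n) q).source) (u : E n) :
    fderiv ℝ (fun z => extChartAt 𝓘(ℝ, E n) q (κ z)) x u =
      mfderiv 𝓘(ℝ, E n) 𝓘(ℝ, E n) (extChartAt 𝓘(ℝ, E n) q) (κ x)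
        (mfderiv 𝓘(ℝ, E n) 𝓘(ℝ, E n) κ x u) := by
  rw [extChartAt_source] at hxq
  have h := mfderiv_comp x (mdifferentiableAt_extChartAt (I := 𝓘(ℝ, E n)) hxq)
    (hκ.mdifferentiableAt hx)
  rw [mfderiv_eq_fderiv] at h
  exact congrArg (fun φ => φ u) h

/-- Transition from a local parametrization to a chart preserves the Finsler functions. -/
theorem isLocalIsometry (q : M) :
    IsLocalIsometry (U ∩ κ ⁻¹' (extChartAt 𝓘(ℝ, E n) q).source)
      (extChartAt 𝓘(ℝ, E n) q).target (pullF Φ.F κ) (localExpr Φ.F q)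
      (fun z => extChartAt 𝓘(ℝ, E n) q (κ z)) where
  smooth := by
    rw [← contMDiffOn_iff_contDiffOn]
    refine (contMDiffOn_extChartAt (I := 𝓘(ℝ, E n)) (x := q)).comp
      (hκ.smooth.mono inter_subset_left) fun x hx => ?_
    simpa using hx.2
  mapsTo x hx := (extChartAt 𝓘(ℝ, E n) q).map_source hx.2
  injective x hx := by
    intro a b hab
    rw [hκ.fderiv_chart_comp q hx.1 hx.2, hκ.fderiv_chart_comp q hx.1 hx.2] at hab
    exact hκ.injective x hx.1
      ((isInvertible_mfderiv_extChartAt (I := 𝓘(ℝ, E n)) hx.2).injective hab)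
  pullback x hx y := by
    have hs : MDifferentiableAt 𝓘(ℝ, E n) 𝓘(ℝ, E n) (extChartAt 𝓘(ℝ, E n) q).symm
        (extChartAt 𝓘(ℝ, E n) q (κ x)) :=
      (isLocalParam_extChartAt_symm q).mdifferentiableAt ((extChartAt _ q).map_source hx.2)
    have hθ : MDifferentiableAt 𝓘(ℝ, E n) 𝓘(ℝ, E n) (fun z => extChartAt 𝓘(ℝ, E n) q (κ z)) x :=
      (mdifferentiableAt_extChartAt (I := 𝓘(ℝ, E n)) (by simpa using hx.2)).comp x
        (hκ.mdifferentiableAt hx.1)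
    have he : ((extChartAt 𝓘(ℝ, E n) q).symm ∘ fun z => extChartAt 𝓘(ℝ, E n) q (κ z))
        =ᶠ[nhds x] κ := by
      filter_upwards [(hκ.isOpen_inter_preimage q).mem_nhds hx] with z hz
      exact (extChartAt 𝓘(ℝ, E n) q).left_inv hz.2
    have h := mfderiv_comp x hs hθ
    rw [mfderiv_eq_fderiv] at h
    have h' := he.mfderiv_eq (I := 𝓘(ℝ, E n)) (I' := 𝓘(ℝ, E n))
    have hv : (mfderiv 𝓘(ℝ, E n) 𝓘(ℝ, E n) κ x y : E n) =
        mfderiv 𝓘(ℝ, E n) 𝓘(ℝ, E n) (extChartAt 𝓘(ℝ, E n) q).symm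
          (extChartAt 𝓘(ℝ, E n) q (κ x)) (fderiv ℝ (fun z => extChartAt 𝓘(ℝ, E n) q (κ z)) x y) := by
      have := congrArg (fun φ : E n →L[ℝ] E n => φ y) (h'.symm.trans h)
      exact this
    have hb : κ x = (extChartAt 𝓘(ℝ, E n) q).symm (extChartAt 𝓘(ℝ, E n) q (κ x)) :=
      ((extChartAt 𝓘(ℝ, E n) q).left_inv hx.2).symm
    have key : ∀ (a b : M) (v w : E n), a = b → v = w →
        Φ.F (⟨a, v⟩ : TangentBundle 𝓘(ℝ, E n) M) = Φ.F ⟨b, w⟩ := by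
      rintro a _ v _ rfl rfl; rfl
    exact key _ _ _ _ hb hv

end IsLocalParam

end Finsler

namespace Finsler

open Local Set

variable {n : ℕ} {M : Type*} [TopologicalSpace M] [ChartedSpace (E n) M]
  [IsManifold 𝓘(ℝ, E n) ∞ M]

/-! ### Curves in local parametrizations -/

theorem Local.covDeriv_congr {L : E n → E n → ℝ} {x X Y : ℝ → E n} {t : ℝ}
    (h : X =ᶠ[nhds t] Y) : Local.covDeriv L x X t = Local.covDeriv L x Y t := by
  simp only [Local.covDeriv, h.deriv_eq, h.eq_of_nhds]

theorem Local.covDeriv_const_smul {L : E n → E n → ℝ} {x X : ℝ → E n} {t : ℝ} (r : ℝ)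
    (hX : DifferentiableAt ℝ X t) :
    Local.covDeriv L x (fun s => r • X s) t = r • Local.covDeriv L x X t := by
  ext i
  simp only [Local.covDeriv, deriv_fun_const_smul r hX, PiLp.smul_apply, smul_eq_mul, mul_add,
    Finset.mul_sum]
  congr 1
  exact Finset.sum_congr rfl fun j _ => by ring

namespace IsLocalParam

variable {U : Set (E n)} {κ : E n → M} (hκ : IsLocalParam U κ) (Φ : FinslerStructure n M)
include hκ

omit [IsManifold 𝓘(ℝ, E n) ∞ M] in
theorem velocity_eq {x : ℝ → E n} {t : ℝ} (hx : x t ∈ U) (dx : DifferentiableAt ℝ x t) :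
    velocity (n := n) (κ ∘ x) t = mfderiv 𝓘(ℝ, E n) 𝓘(ℝ, E n) κ (x t) (deriv x t) := by
  have h := mfderiv_comp t (hκ.mdifferentiableAt hx) dx.mdifferentiableAt
  rw [mfderiv_eq_fderiv] at h
  exact congrArg (fun φ => φ (1 : ℝ)) h

/-- The Cartan covariant derivative along a curve, computed in a local parametrization. -/
theorem covDeriv_eq {x : ℝ → E n} {t : ℝ} (hx : x t ∈ U) (hy : deriv x t ≠ 0)
    (dx : ∀ᶠ s in nhds t, DifferentiableAt ℝ x s) (ddx : DifferentiableAt ℝ (deriv x) t)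
    {X : ℝ → E n} (dX : DifferentiableAt ℝ X t)
    {Y : ∀ s, TangentSpace 𝓘(ℝ, E n) ((κ ∘ x) s)}
    (hXY : ∀ᶠ s in nhds t, Y s = mfderiv 𝓘(ℝ, E n) 𝓘(ℝ, E n) κ (x s) (X s)) :
    covDeriv Φ (κ ∘ x) Y t = mfderiv 𝓘(ℝ, E n) 𝓘(ℝ, E n) κ (x t)
      (Local.covDeriv (pullF Φ.F κ) x X t) := by
  have hL := hκ.localFinsler Φ
  have hiso := hκ.isLocalIsometry Φ (κ (x t))
  have hmem : x t ∈ U ∩ κ ⁻¹' (extChartAt 𝓘(ℝ, E n) (κ (x t))).source :=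
    ⟨hx, mem_extChartAt_source (κ (x t))⟩
  have hopen := hκ.isOpen_inter_preimage (κ (x t))
  have hL0 : LocalFinsler (U ∩ κ ⁻¹' (extChartAt 𝓘(ℝ, E n) (κ (x t))).source) (pullF Φ.F κ) :=
    ⟨hopen, hL.smooth.mono (prod_mono_left inter_subset_left), fun z hz => hL.nonneg z hz.1,
      fun z hz => hL.homog z hz.1, fun z hz => hL.posDef z hz.1⟩
  have h1 := hiso.covDeriv_eq hL0 (localFinsler_localExpr Φ _) hmem hy dx ddx dX
  have h2 : (fun τ => mfderiv 𝓘(ℝ, E n) 𝓘(ℝ, E n) (extChartAt 𝓘(ℝ, E n) (κ (x t)))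
      ((κ ∘ x) τ) (Y τ)) =ᶠ[nhds t]
      fun s => fderiv ℝ (fun z => extChartAt 𝓘(ℝ, E n) (κ (x t)) (κ z)) (x s) (X s) := by
    filter_upwards [hXY, dx.self_of_nhds.continuousAt.preimage_mem_nhds (hopen.mem_nhds hmem)]
      with s hs hsU
    rw [hκ.fderiv_chart_comp _ hsU.1 hsU.2]
    exact congrArg _ hs
  have h3 := Local.covDeriv_congr (L := localExpr Φ.F (κ (x t)))
    (x := fun s => extChartAt 𝓘(ℝ, E n) (κ (x t)) (κ (x s))) h2
  have h4 := h3.trans (h1.trans (hκ.fderiv_chart_comp _ hx hmem.2 _))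
  have hinv := isInvertible_mfderiv_extChartAt (I := 𝓘(ℝ, E n)) hmem.2
  refine (congrArg _ h4).trans ?_
  exact DFunLike.congr_fun hinv.inverse_comp_self _

theorem normAlong_eq {x : ℝ → E n} {t : ℝ} (hx : x t ∈ U) (dx : DifferentiableAt ℝ x t)
    (hy : deriv x t ≠ 0) (v : E n) :
    normAlong Φ (κ ∘ x) t (mfderiv 𝓘(ℝ, E n) 𝓘(ℝ, E n) κ (x t) v) =
      √(gf (pullF Φ.F κ) (x t, deriv x t) v v) := by
  rw [normAlong, hκ.velocity_eq hx dx, hκ.gf_pullF Φ hx hy]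
  rfl

theorem F_velocity {x : ℝ → E n} {t : ℝ} (hx : x t ∈ U) (dx : DifferentiableAt ℝ x t) :
    Φ.F ⟨(κ ∘ x) t, velocity (κ ∘ x) t⟩ = pullF Φ.F κ (x t) (deriv x t) := by
  rw [hκ.velocity_eq hx dx]; rfl

/-- The curvature vector and the first Frenet curvature in a local parametrization. -/
theorem firstCurvature_eq {x : ℝ → E n} {I : Set ℝ} (hI : IsOpen I) (hxs : ContDiffOn ℝ ∞ x I)
    (hxU : ∀ t ∈ I, x t ∈ U) {t : ℝ} (ht : t ∈ I) (hy : deriv x t ≠ 0) :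
    covDeriv Φ (κ ∘ x) (velocity (κ ∘ x)) t = mfderiv 𝓘(ℝ, E n) 𝓘(ℝ, E n) κ (x t)
      (Local.covDeriv (pullF Φ.F κ) x (deriv x) t) ∧
    firstCurvature Φ (κ ∘ x) t = √(gf (pullF Φ.F κ) (x t, deriv x t)
      (Local.covDeriv (pullF Φ.F κ) x (deriv x) t)
      (Local.covDeriv (pullF Φ.F κ) x (deriv x) t)) := by
  have dx : ∀ s ∈ I, DifferentiableAt ℝ x s := fun s hs => hxs.differentiableAt_infty hI hs
  have ddx : DifferentiableAt ℝ (deriv x) t :=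
    ((contDiffOn_infty_iff_deriv_of_isOpen hI).1 hxs).2.differentiableAt_infty hI ht
  have h1 := hκ.covDeriv_eq Φ (hxU t ht) hy
    (by filter_upwards [hI.mem_nhds ht] with s hs using dx s hs) ddx ddx
    (Y := velocity (κ ∘ x)) (by
      filter_upwards [hI.mem_nhds ht] with s hs using hκ.velocity_eq (hxU s hs) (dx s hs))
  refine ⟨h1, ?_⟩
  rw [firstCurvature, h1]
  exact hκ.normAlong_eq Φ (hxU t ht) (dx t ht) hy _

/-- The second Frenet curvature in a local parametrization, where `w` represents the curvature
vector `∇_{c'} c'`. The case `k = 0` is included: then `k⁻¹ = 0`, and both sides vanish. -/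
theorem secondCurvature_eq {x : ℝ → E n} {I : Set ℝ} (hI : IsOpen I) (hxs : ContDiffOn ℝ ∞ x I)
    (hxU : ∀ t ∈ I, x t ∈ U) (hy : ∀ t ∈ I, deriv x t ≠ 0) {k : ℝ} {w : ℝ → E n}
    (hk : ∀ t ∈ I, firstCurvature Φ (κ ∘ x) t = k)
    (hw : ∀ t ∈ I, Local.covDeriv (pullF Φ.F κ) x (deriv x) t = w t) (hws : ContDiffOn ℝ ∞ w I)
    {t : ℝ} (ht : t ∈ I) :
    secondCurvature Φ (κ ∘ x) t = √(gf (pullF Φ.F κ) (x t, deriv x t)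
      (k⁻¹ • Local.covDeriv (pullF Φ.F κ) x w t + k • deriv x t)
      (k⁻¹ • Local.covDeriv (pullF Φ.F κ) x w t + k • deriv x t)) := by
  have dx : ∀ s ∈ I, DifferentiableAt ℝ x s := fun s hs => hxs.differentiableAt_infty hI hs
  have ddx : DifferentiableAt ℝ (deriv x) t :=
    ((contDiffOn_infty_iff_deriv_of_isOpen hI).1 hxs).2.differentiableAt_infty hI ht
  have dw : DifferentiableAt ℝ w t := hws.differentiableAt_infty hI ht
  have h1 := hκ.covDeriv_eq Φ (hxU t ht) (hy t ht)
    (by filter_upwards [hI.mem_nhds ht] with s hs using dx s hs) ddx (X := fun s => k⁻¹ • w s)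
    (dw.const_smul k⁻¹)
    (Y := secondFrenetVector Φ (κ ∘ x)) (by
      filter_upwards [hI.mem_nhds ht] with s hs
      rw [secondFrenetVector, hk s hs, (hκ.firstCurvature_eq Φ hI hxs hxU hs (hy s hs)).1, hw s hs]
      exact (map_smul _ _ _).symm)
  rw [Local.covDeriv_const_smul k⁻¹ dw] at h1
  rw [secondCurvature, h1, hk t ht, hκ.velocity_eq (hxU t ht) (dx t ht),
    ← hκ.normAlong_eq Φ (hxU t ht) (dx t ht) (hy t ht)]
  congr 1
  refine Eq.trans ?_ (map_add (mfderiv 𝓘(ℝ, E n) 𝓘(ℝ, E n) κ (x t)) _ _).symm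
  exact congrArg _ (map_smul (mfderiv 𝓘(ℝ, E n) 𝓘(ℝ, E n) κ (x t)) _ _).symm

/-- A sufficient condition for being a geodesic circle, in a local parametrization. -/
theorem isGeodesicCircle {x w : ℝ → E n} {ε k : ℝ} (hk : 0 < k)
    (hxs : ContDiffOn ℝ ∞ x (Ioo (-ε) ε)) (hws : ContDiffOn ℝ ∞ w (Ioo (-ε) ε))
    (h : ∀ t ∈ Ioo (-ε) ε, x t ∈ U ∧ deriv x t ≠ 0 ∧ pullF Φ.F κ (x t) (deriv x t) = 1 ∧
        Local.covDeriv (pullF Φ.F κ) x (deriv x) t = w t ∧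
        Local.covDeriv (pullF Φ.F κ) x w t = -(k ^ 2 • deriv x t) ∧
        gf (pullF Φ.F κ) (x t, deriv x t) (w t) (w t) = k ^ 2) :
    IsGeodesicCircle Φ (κ ∘ x) (Ioo (-ε) ε) := by
  have dx : ∀ t ∈ Ioo (-ε) ε, DifferentiableAt ℝ x t := fun t ht =>
    hxs.differentiableAt_infty isOpen_Ioo ht
  have hk1 : ∀ t ∈ Ioo (-ε) ε, firstCurvature Φ (κ ∘ x) t = k := fun t ht => by
    obtain ⟨_, hy, _, hw, _, hg⟩ := h t ht
    rw [(hκ.firstCurvature_eq Φ isOpen_Ioo hxs (fun s hs => (h s hs).1) ht hy).2, hw, hg,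
      Real.sqrt_sq hk.le]
  refine ⟨isOpen_Ioo, ordConnected_Ioo, ?_, ?_, ⟨k, hk1⟩, ?_⟩
  · exact hκ.smooth.comp (contMDiffOn_iff_contDiffOn.2 hxs) fun t ht => (h t ht).1
  · intro t ht
    rw [hκ.F_velocity Φ (h t ht).1 (dx t ht), (h t ht).2.2.1]
  · intro t ht
    rw [hκ.secondCurvature_eq Φ isOpen_Ioo hxs (fun s hs => (h s hs).1)
      (fun s hs => (h s hs).2.1) hk1 (fun s hs => (h s hs).2.2.2.1) hws ht,
      (h t ht).2.2.2.2.1]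
    have : k⁻¹ • -(k ^ 2 • deriv x t) + k • deriv x t = (0 : ℝ) • deriv x t := by
      rw [smul_neg, smul_smul, show k⁻¹ * k ^ 2 = k by field_simp]; simp
    rw [this, gf_smul_left]
    simp

/-- In a local parametrization, a geodesic circle satisfies a third order differential equation:
the covariant derivative of its curvature vector `w` is tangent to it. -/
theorem exists_covDeriv_eq_smul {x w : ℝ → E n} {I : Set ℝ} (hxs : ContDiffOn ℝ ∞ x I)
    (hxU : ∀ t ∈ I, x t ∈ U) (hy : ∀ t ∈ I, deriv x t ≠ 0)
    (hw : ∀ t ∈ I, Local.covDeriv (pullF Φ.F κ) x (deriv x) t = w t) (hws : ContDiffOn ℝ ∞ w I)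
    (h : IsGeodesicCircle Φ (κ ∘ x) I) {t : ℝ} (ht : t ∈ I) :
    ∃ r : ℝ, Local.covDeriv (pullF Φ.F κ) x w t = r • deriv x t := by
  have hL := hκ.localFinsler Φ
  have hI := h.isOpen
  obtain ⟨k, hk⟩ := h.firstCurvature_const
  have hsqrt : ∀ s ∈ I, ∀ v : E n, √(gf (pullF Φ.F κ) (x s, deriv x s) v v) = 0 → v = 0 := by
    intro s hs v hv
    by_contra hv0
    exact (Real.sqrt_pos.2 (hL.posDef _ (hxU s hs) _ (hy s hs) v hv0)).ne' hv
  -- if `k = 0`, the curve is a geodesic, and the second Frenet curvature gives no information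
  by_cases hk0 : k = 0
  · have hw0 : ∀ s ∈ I, w s = 0 := fun s hs => by
      have h1 := (hκ.firstCurvature_eq Φ hI hxs hxU hs (hy s hs)).2
      rw [hk s hs, hk0, hw s hs] at h1
      exact hsqrt s hs _ h1.symm
    have he : w =ᶠ[nhds t] fun s => (0 : ℝ) • w s := by
      filter_upwards [hI.mem_nhds ht] with s hs using by simp [hw0 s hs]
    refine ⟨0, ?_⟩
    rw [Local.covDeriv_congr he, Local.covDeriv_const_smul 0 (hws.differentiableAt_infty hI ht)]
    simp
  · have h1 := h.secondCurvature_zero t ht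
    rw [hκ.secondCurvature_eq Φ hI hxs hxU hy hk hw hws ht] at h1
    have h2 := hsqrt t ht _ h1
    refine ⟨-k ^ 2, ?_⟩
    have h3 : Local.covDeriv (pullF Φ.F κ) x w t =
        k • (k⁻¹ • Local.covDeriv (pullF Φ.F κ) x w t + k • deriv x t) - k ^ 2 • deriv x t := by
      rw [smul_add, smul_smul, mul_inv_cancel₀ hk0]; module
    rw [h3, h2]
    simp

end IsLocalParam

end Finsler

namespace Finsler

open Local Set

variable {n : ℕ}

/-! ### Reparametrization and comparison of two Finsler functions -/

theorem nonlin_add (L : E n → E n → ℝ) (p : E n × E n) (X Y : E n) :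
    nonlin L p (X + Y) = nonlin L p X + nonlin L p Y := by
  ext i; simp [nonlin, mul_add, Finset.sum_add_distrib]

theorem nonlin_smul (L : E n → E n → ℝ) (p : E n × E n) (r : ℝ) (X : E n) :
    nonlin L p (r • X) = r • nonlin L p X := by
  ext i; simp [nonlin, Finset.mul_sum, mul_left_comm]

theorem cartan_add_left (L : E n → E n → ℝ) (p : E n × E n) (b c X : E n) :
    cartan L p (b + c) X = cartan L p b X + cartan L p c X := by
  ext i; simp [cartan, mul_add, add_mul, Finset.sum_add_distrib]

theorem cartan_add_right (L : E n → E n → ℝ) (p : E n × E n) (b X Y : E n) :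
    cartan L p b (X + Y) = cartan L p b X + cartan L p b Y := by
  ext i; simp [cartan, mul_add, Finset.sum_add_distrib]

theorem cartan_smul_left (L : E n → E n → ℝ) (p : E n × E n) (r : ℝ) (b X : E n) :
    cartan L p (r • b) X = r • cartan L p b X := by
  ext i; simp only [cartan, PiLp.smul_apply, smul_eq_mul, Finset.mul_sum]
  exact Finset.sum_congr rfl fun j _ => Finset.sum_congr rfl fun k _ => by ring

theorem cartan_smul_right (L : E n → E n → ℝ) (p : E n × E n) (r : ℝ) (b X : E n) :
    cartan L p b (r • X) = r • cartan L p b X := by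
  ext i; simp only [cartan, PiLp.smul_apply, smul_eq_mul, Finset.mul_sum]
  exact Finset.sum_congr rfl fun j _ => Finset.sum_congr rfl fun k _ => by ring

namespace LocalFinsler

variable {U : Set (E n)} {L : E n → E n → ℝ} (hL : LocalFinsler U L) {p : E n × E n}
  (hp : p ∈ U ×ˢ ({0}ᶜ : Set (E n))) {r : ℝ} (hr : 0 < r)
include hL hp hr

theorem gf_scale (u v : E n) : gf L (p.1, r • p.2) u v = gf L p u v := by
  have h := hL.D2_scale hp hr (0, r⁻¹ • u) (0, r⁻¹ • v)
  simp only [smul_smul, mul_inv_cancel₀ hr.ne', one_smul] at h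
  change gf L _ u v = r ^ 2 * gf L p _ _ at h
  rw [h, gf_smul_left, gf_smul_right]
  field_simp

theorem spray_scale : spray L (p.1, r • p.2) = r ^ 2 • spray L p := by
  refine hL.gf_ext (scale_mem hp hr) fun u => ?_
  rw [hL.gf_spray (scale_mem hp hr), gf_smul_left, hL.gf_scale hp hr, hL.gf_spray hp]
  have h1 := hL.D1_scale hp hr (u, 0)
  have h2 := hL.D2_scale hp hr (p.2, 0) (0, r⁻¹ • u)
  simp only [smul_smul, mul_inv_cancel₀ hr.ne', one_smul, smul_zero] at h1 h2
  have e1 : (r • p.2, (0 : E n)) = r • (p.2, 0) := by simp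
  have e2 : ((0 : E n), r⁻¹ • u) = r⁻¹ • (0, u) := by simp
  rw [e2, map_smul] at h2
  rw [e1, map_smul, _root_.smul_apply, h2, h1]
  simp only [smul_eq_mul]
  field_simp

theorem nonlin_scale (X : E n) : nonlin L (p.1, r • p.2) X = r • nonlin L p X := by
  have h1 := hasFDerivAt_comp_of (hL.hasFDerivAt_spray (scale_mem hp hr))
    (hasFDerivAt_scale r p) rfl
  have h2 := Filter.EventuallyEq.fderiv_eq (𝕜 := ℝ) (x := p)
    (f₁ := fun q : E n × E n => spray L (q.1, r • q.2)) (f := fun q => r ^ 2 • spray L q) (by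
      filter_upwards [hL.isOpen_slit.mem_nhds hp] with q hq using hL.spray_scale hq hr)
  rw [h1.fderiv, fderiv_fun_const_smul (hL.hasFDerivAt_spray hp).differentiableAt] at h2
  have h3 := congrArg (fun φ => φ (0, r⁻¹ • X)) h2
  simp only [ContinuousLinearMap.comp_apply, ContinuousLinearMap.prod_apply, _root_.smul_apply,
    ContinuousLinearMap.coe_fst', ContinuousLinearMap.coe_snd', smul_smul,
    mul_inv_cancel₀ hr.ne', one_smul] at h3
  have e2 : ((0 : E n), r⁻¹ • X) = r⁻¹ • (0, X) := by simp
  rw [hL.nonlin_eq hp, hL.nonlin_eq (scale_mem hp hr), h3, e2, map_smul]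
  simp only [smul_smul]
  congr 1
  field_simp

theorem cartan_scale (b X : E n) : cartan L (p.1, r • p.2) b X = r⁻¹ • cartan L p b X := by
  refine hL.gf_ext (scale_mem hp hr) fun u => ?_
  have h := hL.D3_scale hp hr (0, r⁻¹ • b) (0, r⁻¹ • X) (0, r⁻¹ • u)
  simp only [smul_smul, mul_inv_cancel₀ hr.ne', one_smul] at h
  have e : ∀ v : E n, ((0 : E n), r⁻¹ • v) = r⁻¹ • (0, v) := by simp
  rw [hL.gf_cartan (scale_mem hp hr), gf_smul_left, hL.gf_scale hp hr, hL.gf_cartan hp, h,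
    e, e, e]
  simp only [map_smul, _root_.smul_apply, smul_eq_mul]
  field_simp

end LocalFinsler

section Comparison

variable {U : Set (E n)} {L L' : E n → E n → ℝ}

/-- The terms, up to multiples of `y`, in the third order equation for a reparametrized curve `x`
to be a geodesic circle of `L'`, when `x` is a geodesic circle of `L` with velocity `y` and curvature
vector `w`. Terms from `L'` are evaluated on the curvature vector `w + S' - S` of `x` with respect
to the spray of `L'`. -/
def circleDefect (L L' : E n → E n → ℝ) (p : E n × E n) (w : E n) : E n :=
  cartan L' p (w + (spray L' p - spray L p)) (w + (spray L' p - spray L p))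
    - cartan L p w w - nonlin L p w + nonlin L' p (w + (spray L' p - spray L p))
    + fderiv ℝ (fun q => spray L' q - spray L q) p (p.2, w - spray L p)
    - (3 * fderiv ℝ (fun q : E n × E n => L' q.1 q.2) p (p.2, w - spray L p) / L' p.1 p.2) •
      (w + (spray L' p - spray L p))

/-- The curvature vector, with respect to `L'`, of the reparametrized curve `x ∘ s`. -/
theorem covDeriv_velocity_comp (hL : LocalFinsler U L) (hL' : LocalFinsler U L')
    {x w : ℝ → E n} {s : ℝ → ℝ} {I J : Set ℝ} (hI : IsOpen I) (hJ : IsOpen J)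
    (hxs : ContDiffOn ℝ ∞ x I) (hs : ContDiffOn ℝ ∞ s J)
    (hx : ∀ t ∈ I, x t ∈ U ∧ deriv x t ≠ 0 ∧ Local.covDeriv L x (deriv x) t = w t)
    (hs' : ∀ t ∈ J, 0 < deriv s t) (hsI : ∀ t ∈ J, s t ∈ I) {t : ℝ} (ht : t ∈ J) :
    HasDerivAt (deriv x) (w (s t) - spray L (x (s t), deriv x (s t))) (s t) ∧
    deriv (fun τ => x (s τ)) t = deriv s t • deriv x (s t) ∧
    Local.covDeriv L' (fun τ => x (s τ)) (deriv fun τ => x (s τ)) t =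
      deriv (deriv s) t • deriv x (s t) + deriv s t ^ 2 • (w (s t) +
        (spray L' (x (s t), deriv x (s t)) - spray L (x (s t), deriv x (s t)))) := by
  obtain ⟨hU, hy, hw⟩ := hx (s t) (hsI t ht)
  have hp : (x (s t), deriv x (s t)) ∈ U ×ˢ ({0}ᶜ : Set (E n)) := ⟨hU, hy⟩
  have ddx : HasDerivAt (deriv x) (w (s t) - spray L (x (s t), deriv x (s t))) (s t) := by
    have h := (((contDiffOn_infty_iff_deriv_of_isOpen hI).1 hxs).2.differentiableAt_infty hI
      (hsI t ht)).hasDerivAt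
    rwa [← hw, hL.covDeriv_velocity hU hy, add_sub_cancel_right]
  have hz : ∀ τ ∈ J, HasDerivAt (fun τ => x (s τ)) (deriv s τ • deriv x (s τ)) τ := fun τ hτ =>
    (hxs.differentiableAt_infty hI (hsI τ hτ)).hasDerivAt.scomp τ
      (hs.differentiableAt_infty hJ hτ).hasDerivAt
  have hs1 := (hs.differentiableAt_infty hJ ht).hasDerivAt
  have hs2 := (((contDiffOn_infty_iff_deriv_of_isOpen hJ).1 hs).2.differentiableAt_infty hJ
    ht).hasDerivAt
  have hz2 : HasDerivAt (deriv fun τ => x (s τ))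
      (deriv s t • (deriv s t • (w (s t) - spray L (x (s t), deriv x (s t)))) +
        deriv (deriv s) t • deriv x (s t)) t := by
    refine (hs2.smul (ddx.scomp t hs1)).congr_of_eventuallyEq ?_
    filter_upwards [hJ.mem_nhds ht] with τ hτ using (hz τ hτ).deriv
  have hz1 := (hz t ht).deriv
  refine ⟨ddx, hz1, ?_⟩
  have hsc := hL'.spray_scale hp (hs' t ht)
  dsimp only at hsc
  rw [hL'.covDeriv_velocity (x := fun τ => x (s τ)) hU (by
    rw [hz1]; exact smul_ne_zero (hs' t ht).ne' hy), hz2.deriv, hz1, hsc]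
  module

/-- The third order equation for geodesic circles of `L'`, expressed along a geodesic circle `x`
of `L`. -/
theorem circleDefect_eq_smul (hL : LocalFinsler U L) (hL' : LocalFinsler U L')
    {x w : ℝ → E n} {s : ℝ → ℝ} {k : ℝ} {I J : Set ℝ} (hI : IsOpen I) (hJ : IsOpen J)
    (hxs : ContDiffOn ℝ ∞ x I) (hws : ContDiffOn ℝ ∞ w I) (hs : ContDiffOn ℝ ∞ s J)
    (hx : ∀ t ∈ I, x t ∈ U ∧ deriv x t ≠ 0 ∧ Local.covDeriv L x (deriv x) t = w t)
    (hxw : ∀ t ∈ I, Local.covDeriv L x w t = -(k ^ 2 • deriv x t))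
    (hs' : ∀ t ∈ J, 0 < deriv s t) (hsI : ∀ t ∈ J, s t ∈ I)
    (hunit : ∀ t ∈ J, L' (x (s t)) (deriv (fun τ => x (s τ)) t) = 1) {t : ℝ} (ht : t ∈ J)
    {r : ℝ} (hr : Local.covDeriv L' (fun τ => x (s τ))
      (Local.covDeriv L' (fun τ => x (s τ)) (deriv fun τ => x (s τ))) t =
        r • deriv (fun τ => x (s τ)) t) :
    ∃ c : ℝ, circleDefect L L' (x (s t), deriv x (s t)) (w (s t)) = c • deriv x (s t) := by
  have key := fun {τ} (hτ : τ ∈ J) => covDeriv_velocity_comp hL hL' hI hJ hxs hs hx hs' hsI hτ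
  obtain ⟨hU, hy, hw⟩ := hx (s t) (hsI t ht)
  obtain ⟨ddx, hz1, hacc⟩ := key ht
  set p : E n × E n := (x (s t), deriv x (s t)) with hpdef
  have hp : p ∈ U ×ˢ ({0}ᶜ : Set (E n)) := ⟨hU, hy⟩
  set T : E n × E n → E n := fun q => spray L' q - spray L q with hT
  have ha := hs' t ht
  set a := deriv s t with hadef
  have hs1 : HasDerivAt s a t := (hs.differentiableAt_infty hJ ht).hasDerivAt
  have hds := ((contDiffOn_infty_iff_deriv_of_isOpen hJ).1 hs).2
  have hs2 := (hds.differentiableAt_infty hJ ht).hasDerivAt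
  have hs3 := (((contDiffOn_infty_iff_deriv_of_isOpen hJ).1 hds).2.differentiableAt_infty hJ
    ht).hasDerivAt
  have dx : HasDerivAt x (deriv x (s t)) (s t) :=
    (hxs.differentiableAt_infty hI (hsI t ht)).hasDerivAt
  -- The lifted curve `(x, x')` and its derivative.
  have hlift : HasDerivAt (fun τ => (x (s τ), deriv x (s τ)))
      (a • (deriv x (s t), w (s t) - spray L p)) t := (dx.prodMk ddx).scomp t hs1
  have hTd : HasDerivAt (fun τ => T (x (s τ), deriv x (s τ)))
      (a • fderiv ℝ T p (deriv x (s t), w (s t) - spray L p)) t := by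
    have h := hasDerivAt_comp_of (γ := fun τ => (x (s τ), deriv x (s τ)))
      (((hL'.hasFDerivAt_spray hp).sub (hL.hasFDerivAt_spray hp)).differentiableAt.hasFDerivAt :
        HasFDerivAt T (fderiv ℝ T p) p) hlift
    rwa [map_smul] at h
  have hwd : HasDerivAt w (-(k ^ 2 • deriv x (s t)) - nonlin L p (w (s t)) -
      cartan L p (w (s t)) (w (s t))) (s t) := by
    have h := (hws.differentiableAt_infty hI (hsI t ht)).hasDerivAt
    have h1 := hL.covDeriv_eq (X := w) hU hy
    rw [hxw _ (hsI t ht), ← hL.covDeriv_velocity hU hy, hw] at h1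
    refine h.congr_deriv ?_
    rw [h1]
    abel
  -- Differentiating `s' L'(x, x') = 1` expresses `s''`.
  have hl : deriv (deriv s) t * L' p.1 p.2 = - a ^ 2 *
      fderiv ℝ (fun q : E n × E n => L' q.1 q.2) p (deriv x (s t), w (s t) - spray L p) := by
    have h1 := hasDerivAt_comp_of (γ := fun τ => (x (s τ), deriv x (s τ)))
      (hL'.smooth.differentiableAt_infty hL'.isOpen_slit hp).hasFDerivAt hlift
    have h2 := hs2.mul h1
    have h3 : (deriv s * fun τ => L' (x (s τ)) (deriv x (s τ))) =ᶠ[nhds t] fun _ => 1 := by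
      filter_upwards [hJ.mem_nhds ht] with τ hτ
      rw [← hunit τ hτ, (key hτ).2.1, hL'.homog _ (hx _ (hsI τ hτ)).1 _ _ (hs' τ hτ)]
      rfl
    have h4 := h2.unique ((hasDerivAt_const t (1 : ℝ)).congr_of_eventuallyEq h3)
    rw [map_smul, smul_eq_mul] at h4
    simp only [hpdef] at h4 ⊢
    linarith
  -- The derivative of the curvature vector with respect to `L'`.
  set v := w (s t) + T p with hv
  have hW : deriv (Local.covDeriv L' (fun τ => x (s τ)) (deriv fun τ => x (s τ))) t =
      deriv (deriv (deriv s)) t • deriv x (s t) +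
      (deriv (deriv s) t * a) • (w (s t) - spray L p) + (2 * a * deriv (deriv s) t) • v +
      a ^ 3 • (-(k ^ 2 • deriv x (s t)) - nonlin L p (w (s t)) - cartan L p (w (s t)) (w (s t)) +
        fderiv ℝ T p (deriv x (s t), w (s t) - spray L p)) := by
    have h1 := (hs3.smul (ddx.scomp t hs1)).add ((hs2.pow 2).smul ((hwd.scomp t hs1).add hTd))
    have h2 : Local.covDeriv L' (fun τ => x (s τ)) (deriv fun τ => x (s τ)) =ᶠ[nhds t]
        deriv (deriv s) • deriv x ∘ s +
          deriv s ^ 2 • (w ∘ s + fun τ => T (x (s τ), deriv x (s τ))) := by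
      filter_upwards [hJ.mem_nhds ht] with τ hτ using (key hτ).2.2
    rw [h2.deriv_eq]
    refine HasDerivAt.deriv (h1.congr_deriv ?_)
    simp only [Pi.add_apply, Function.comp_apply, Pi.pow_apply, ← hadef, ← hpdef]
    rw [hv]
    module
  have hcov := hL'.covDeriv_eq (x := fun τ => x (s τ))
    (X := Local.covDeriv L' (fun τ => x (s τ)) (deriv fun τ => x (s τ))) (t := t) hU
    (by rw [hz1]; exact smul_ne_zero ha.ne' hy)
  rw [← hL'.covDeriv_velocity (x := fun τ => x (s τ)) hU
    (by rw [hz1]; exact smul_ne_zero ha.ne' hy), hr, hW, hacc, hz1] at hcov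
  have hNs := hL'.nonlin_scale hp ha
  have hCs := hL'.cartan_scale hp ha
  have hN0 := hL'.nonlin_self hp
  have hC0 := hL'.cartan_self_right hp
  have hC1 := fun b => (hL'.cartan_comm hp p.2 b).trans (hC0 b)
  simp only [hpdef] at hNs hCs hN0 hC0 hC1
  rw [hNs, hCs] at hcov
  change _ = _ + a • nonlin L' p (deriv (deriv s) t • deriv x (s t) + a ^ 2 • v) +
    a⁻¹ • cartan L' p (deriv (deriv s) t • deriv x (s t) + a ^ 2 • v)
      (deriv (deriv s) t • deriv x (s t) + a ^ 2 • v) at hcov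
  simp only [nonlin_add, nonlin_smul, cartan_add_left, cartan_add_right, cartan_smul_left,
    cartan_smul_right, ← hpdef] at hcov hN0 hC0 hC1
  simp only [hN0, hC0, hC1, smul_zero, zero_add] at hcov
  have hS : spray L' p = spray L p + T p := by simp [hT]
  have hLpos := hL'.pos hp
  have hl' : deriv (deriv s) t = - a ^ 2 * (fderiv ℝ (fun q : E n × E n => L' q.1 q.2) p
      (deriv x (s t), w (s t) - spray L p) / L' p.1 p.2) := by
    field_simp
    linarith
  refine ⟨(a ^ 3)⁻¹ * (r * a - deriv (deriv (deriv s)) t) + k ^ 2, ?_⟩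
  set ℓ := fderiv ℝ (fun q : E n × E n => L' q.1 q.2) p
      (deriv x (s t), w (s t) - spray L p) / L' p.1 p.2 with hℓ
  have h3 : (3 * fderiv ℝ (fun q : E n × E n => L' q.1 q.2) p
      (deriv x (s t), w (s t) - spray L p) / L' p.1 p.2) = 3 * ℓ := by rw [hℓ]; ring
  have hgoal : a ^ 3 • circleDefect L L' p (w (s t)) =
      (r * a - deriv (deriv (deriv s)) t + a ^ 3 * k ^ 2) • deriv x (s t) := by
    simp only [circleDefect]
    change a ^ 3 • (cartan L' p v v - cartan L p (w (s t)) (w (s t)) - nonlin L p (w (s t)) +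
      nonlin L' p v + fderiv ℝ T p (deriv x (s t), w (s t) - spray L p) - (3 *
        fderiv ℝ (fun q : E n × E n => L' q.1 q.2) p
      (deriv x (s t), w (s t) - spray L p) / L' p.1 p.2) • v) = _
    rw [h3]
    have e1 : a⁻¹ • a ^ 2 • a ^ 2 • cartan L' p v v = a ^ 3 • cartan L' p v v := by
      simp only [smul_smul]; congr 1; field_simp
    rw [e1, hS, hl'] at hcov
    have hw' : w (s t) = v - T p := by rw [hv]; abel
    have e2 : (r * a) • deriv x (s t) = r • a • deriv x (s t) := by rw [smul_smul]
    rw [add_smul, sub_smul, e2, hcov]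
    rw [← sub_eq_zero]
    generalize nonlin L' p v = q1 at *
    generalize cartan L' p v v = q2 at *
    generalize fderiv ℝ T p (deriv x (s t), w (s t) - spray L p) = q3 at *
    generalize cartan L p (w (s t)) (w (s t)) = q4 at *
    generalize nonlin L p (w (s t)) = q5 at *
    rw [hw']
    module
  have hne : a ^ 3 ≠ 0 := pow_ne_zero 3 ha.ne'
  have := congrArg (fun u => (a ^ 3)⁻¹ • u) hgoal
  simp only [smul_smul, inv_mul_cancel₀ hne, one_smul] at this
  rw [this]
  congr 1
  field_simp

/-- The part of the comparison which is quadratic in the curvature vector `w`: it is obtained by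
comparing the defects for `w`, `-w`, `2w` and `-2w`. -/
theorem cartan_sub_cartan {p : E n × E n}
    (h : ∀ w, w ≠ 0 → gf L p p.2 w = 0 → ∃ c : ℝ, circleDefect L L' p w = c • p.2)
    {w : E n} (hw : gf L p p.2 w = 0) :
    ∃ c : ℝ, cartan L' p w w - cartan L p w w -
      (3 * fderiv ℝ (fun q : E n × E n => L' q.1 q.2) p (0, w) / L' p.1 p.2) • w = c • p.2 := by
  by_cases hw0 : w = 0
  · have h1 := cartan_smul_right L p 0 0 0
    have h2 := cartan_smul_right L' p 0 0 0
    rw [zero_smul, zero_smul] at h1 h2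
    exact ⟨0, by simp [hw0, h1, h2]⟩
  have H : ∀ r : ℝ, r ≠ 0 → ∃ c : ℝ, circleDefect L L' p (r • w) = c • p.2 := fun r hr =>
    h _ (smul_ne_zero hr hw0) (by rw [gf_smul_right, hw, mul_zero])
  have hexp : ∃ A B : E n, ∀ r : ℝ, circleDefect L L' p (r • w) = A + r • B + r ^ 2 •
      (cartan L' p w w - cartan L p w w -
      (3 * fderiv ℝ (fun q : E n × E n => L' q.1 q.2) p (0, w) / L' p.1 p.2) • w) := by
    set T := spray L' p - spray L p
    set S := spray L p
    set dT := fderiv ℝ (fun q => spray L' q - spray L q) p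
    set dL := fderiv ℝ (fun q : E n × E n => L' q.1 q.2) p
    have e : ∀ r : ℝ, (p.2, r • w - S) = (p.2, -S) + r • (0, w) := by
      intro r; ext <;> simp [sub_eq_add_neg, add_comm]
    refine ⟨cartan L' p T T + nonlin L' p T + dT (p.2, -S) -
      (3 * dL (p.2, -S) / L' p.1 p.2) • T,
      cartan L' p w T + cartan L' p T w - nonlin L p w + nonlin L' p w + dT (0, w) -
      (3 * dL (p.2, -S) / L' p.1 p.2) • w - (3 * dL (0, w) / L' p.1 p.2) • T, fun r => ?_⟩
    change cartan L' p (r • w + T) (r • w + T) - cartan L p (r • w) (r • w) - nonlin L p (r • w) +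
      nonlin L' p (r • w + T) + dT (p.2, r • w - S) - (3 * dL (p.2, r • w - S) / L' p.1 p.2) •
        (r • w + T) = _
    rw [e]
    simp only [map_add, map_smul, nonlin_add, nonlin_smul, cartan_add_left, cartan_add_right,
      cartan_smul_left, cartan_smul_right, smul_eq_mul]
    have : 3 * (dL (p.2, -S) + r * dL (0, w)) / L' p.1 p.2 =
      3 * dL (p.2, -S) / L' p.1 p.2 + r * (3 * dL (0, w) / L' p.1 p.2) := by ring
    rw [this]
    module
  obtain ⟨A, B, hAB⟩ := hexp
  obtain ⟨c1, h1⟩ := H 1 one_ne_zero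
  obtain ⟨c2, h2⟩ := H (-1) (by norm_num)
  obtain ⟨c3, h3⟩ := H 2 (by norm_num)
  obtain ⟨c4, h4⟩ := H (-2) (by norm_num)
  rw [hAB] at h1 h2 h3 h4
  refine ⟨(c3 + c4 - c1 - c2) / 6, ?_⟩
  have : ((c3 + c4 - c1 - c2) / 6) • p.2 =
      (1 / 6 : ℝ) • (c3 • p.2 + c4 • p.2 - c1 • p.2 - c2 • p.2) := by module
  rw [this, ← h1, ← h2, ← h3, ← h4]
  module

end Comparison

end Finsler

namespace Finsler

open Local Set

variable {n : ℕ}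

/-! ### Determinants -/

section Det

open scoped MatrixOrder Matrix.Norms.L2Operator

/-- The determinant is monotone on positive definite matrices: if `B⁻¹ = Sᵀ S`, then `S A Sᵀ ≤ 1`,
so the eigenvalues of `S A Sᵀ` are at most one. -/
theorem det_le_det_of_posDef {A B : Matrix (Fin n) (Fin n) ℝ} (hA : A.PosDef) (hB : B.PosDef)
    (h : ∀ v, v ⬝ᵥ A.mulVec v ≤ v ⬝ᵥ B.mulVec v) : A.det ≤ B.det := by
  obtain ⟨S, hS⟩ := CStarAlgebra.nonneg_iff_eq_star_mul_self.mp hB.inv.posSemidef.nonneg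
  have hBdet := hB.det_pos
  have hSt : star S = S.transpose := by
    rw [Matrix.star_eq_conjTranspose, Matrix.conjTranspose_eq_transpose_of_trivial]
  rw [hSt] at hS
  have hdet : S.det ^ 2 * B.det = 1 := by
    have := congrArg Matrix.det hS
    rw [Matrix.det_mul, Matrix.det_transpose, Matrix.det_nonsing_inv, Ring.inverse_eq_inv'] at this
    rw [pow_two, ← this, inv_mul_cancel₀ hBdet.ne']
  have hSdet : S.det ≠ 0 := fun h0 => by simp [h0] at hdet
  have hone : S * B * S.transpose = 1 := by
    have h1 : B * (S.transpose * S) = 1 := by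
      rw [← hS, Matrix.mul_nonsing_inv _ hBdet.ne'.isUnit]
    have h2 : S * (B * S.transpose) = 1 := by
      rw [mul_eq_one_comm, Matrix.mul_assoc]; exact h1
    rw [Matrix.mul_assoc, h2]
  have hX : (S * A * S.conjTranspose).PosSemidef := hA.posSemidef.mul_mul_conjTranspose_same S
  rw [Matrix.conjTranspose_eq_transpose_of_trivial] at hX
  have hquad : ∀ (D : Matrix (Fin n) (Fin n) ℝ) (v : Fin n → ℝ),
      v ⬝ᵥ (S * D * S.transpose).mulVec v =
        (S.transpose.mulVec v) ⬝ᵥ D.mulVec (S.transpose.mulVec v) := by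
    intro D v
    rw [← Matrix.mulVec_mulVec, ← Matrix.mulVec_mulVec, Matrix.dotProduct_mulVec,
      Matrix.mulVec_transpose]
  have hle : (S * A * S.transpose).det ≤ 1 := by
    rw [hX.isHermitian.det_eq_prod_eigenvalues]
    refine Finset.prod_le_one (fun i _ => hX.eigenvalues_nonneg i) fun i _ => ?_
    -- the eigenvalue is the value of the quadratic form at a unit eigenvector
    set v := (hX.isHermitian.eigenvectorBasis i).ofLp with hv
    have h1 := hX.isHermitian.eigenvalues_eq i
    rw [← hv] at h1
    have h2 : v ⬝ᵥ v = 1 := by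
      have h3 := hX.isHermitian.eigenvectorBasis.orthonormal.1 i
      have h4 := EuclideanSpace.real_norm_sq_eq (hX.isHermitian.eigenvectorBasis i)
      rw [h3] at h4
      rw [dotProduct, show (1 : ℝ) = 1 ^ 2 by norm_num, h4]
      exact Finset.sum_congr rfl fun j _ => by rw [pow_two]
    simp only [star_trivial, RCLike.re_to_real] at h1
    simp only [RCLike.ofReal_real_eq_id, id]
    have hv1 : v ⬝ᵥ v = v ⬝ᵥ (S * B * S.transpose).mulVec v := by rw [hone, Matrix.one_mulVec]
    rw [h1, hquad, ← h2, hv1, hquad]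
    exact h _
  rw [Matrix.det_mul, Matrix.det_mul, Matrix.det_transpose] at hle
  have h5 : 0 < S.det ^ 2 := by positivity
  nlinarith

end Det

/-- Jacobi's formula along an affine line. -/
theorem hasDerivAt_det_add_smul {B : Matrix (Fin n) (Fin n) ℝ} (hB : B.det ≠ 0)
    (H : Matrix (Fin n) (Fin n) ℝ) :
    HasDerivAt (fun r : ℝ => (B + r • H).det) (B.det * (B⁻¹ * H).trace) 0 := by
  have h1 : ∀ r : ℝ, (B + r • H).det = B.det * (1 + r • (B⁻¹ * H)).det := by
    intro r
    rw [← Matrix.det_mul, mul_add, mul_one, Matrix.mul_smul,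
      Matrix.mul_nonsing_inv_cancel_left _ _ hB.isUnit]
  have h1' : ∀ r : ℝ, (B + r • H).det = _ := fun r => by
    rw [h1, Matrix.det_one_add_smul]
  rw [funext h1']
  generalize (Matrix.det (1 + (Polynomial.X : Polynomial ℝ) •
    (B⁻¹ * H).map Polynomial.C)).divX.divX = P
  have h2 := (((hasDerivAt_id (0 : ℝ)).const_mul (B⁻¹ * H).trace).const_add 1).add
    ((P.hasDerivAt 0).mul ((hasDerivAt_id (0 : ℝ)).pow 2))
  refine (h2.const_mul B.det).congr_deriv ?_
  simp

/-- Jacobi's formula for the derivative of a determinant. -/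
theorem fderiv_det {V : Type*} [NormedAddCommGroup V] [NormedSpace ℝ V]
    {A : V → Matrix (Fin n) (Fin n) ℝ} {q : V}
    (h : ∀ i j, DifferentiableAt ℝ (fun q => A q i j) q) (h0 : (A q).det ≠ 0) (a : V) :
    fderiv ℝ (fun q => (A q).det) q a = (A q).det *
      ((A q)⁻¹ * Matrix.of fun i j => fderiv ℝ (fun q => A q i j) q a).trace := by
  set D : (Fin n → Fin n → ℝ) → ℝ := fun B => (Matrix.of B).det with hD
  have hDs : ContDiff ℝ ∞ D := by
    rw [← contDiffOn_univ]
    exact contDiffOn_det fun i j => by simp only [Matrix.of_apply]; fun_prop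
  have hDd : HasFDerivAt D (fderiv ℝ D (A q)) (A q) := (hDs.differentiable (by simp) _).hasFDerivAt
  have hA : HasFDerivAt (fun q => (A q : Fin n → Fin n → ℝ))
      (ContinuousLinearMap.pi fun i => ContinuousLinearMap.pi fun j =>
        fderiv ℝ (fun q => A q i j) q) q :=
    hasFDerivAt_pi.2 fun i => hasFDerivAt_pi.2 fun j => (h i j).hasFDerivAt
  have h1 := hasFDerivAt_comp_of hDd hA rfl
  set H : Fin n → Fin n → ℝ := fun i j => fderiv ℝ (fun q => A q i j) q a
  let B : Fin n → Fin n → ℝ := fun i j => A q i j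
  have h2 : HasDerivAt (fun r : ℝ => B + r • H) H 0 := by
    simpa using ((hasDerivAt_id (0 : ℝ)).smul_const H).const_add B
  have hDd' : HasFDerivAt D (fderiv ℝ D (A q)) (B + (0 : ℝ) • H) := by
    rw [zero_smul, add_zero]; exact hDd
  have h3 := hasDerivAt_comp_of hDd' h2
  have h4 := h3.unique (hasDerivAt_det_add_smul h0 (Matrix.of H))
  have h5 : fderiv ℝ (fun q => (A q).det) q a = fderiv ℝ D (A q) H := by
    have h6 : HasFDerivAt (fun q => (A q).det) _ q := h1
    rw [h6.fderiv]
    rfl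
  rw [h5, h4]

namespace LocalFinsler

variable {U : Set (E n)} {L : E n → E n → ℝ} (hL : LocalFinsler U L) {p : E n × E n}
  (hp : p ∈ U ×ˢ ({0}ᶜ : Set (E n)))
include hL

theorem smooth_det : ContDiffOn ℝ ∞ (fun q => (gMat L q).det) (U ×ˢ {0}ᶜ) :=
  contDiffOn_det hL.smooth_g

include hp

/-- The trace of the Cartan tensor is the logarithmic derivative of `√(det g)`. -/
theorem fderiv_det_gMat (w : E n) : fderiv ℝ (fun q => (gMat L q).det) p (0, w) =
    (gMat L p).det * (2 * ∑ i, cartan L p w (ei i) i) := by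
  have hc : ∀ i, cartan L p w (ei i) i =
      ∑ h, gInv L i h p.1 p.2 * ((1 / 2) * D3 L p (0, w) (0, ei i) (0, ei h)) := by
    intro i
    have h1 : cartan L p w (ei i) = WithLp.toLp 2 fun k => ∑ h, gInv L k h p.1 p.2 *
        ((1 / 2) * D3 L p (0, w) (0, ei i) (0, ei h)) := by
      refine hL.gf_ext hp fun u => ?_
      have h2 := linear_expand ((D3 L p (0, w) (0, ei i)) ∘L
        ContinuousLinearMap.inr ℝ _ _).toLinearMap u
      simp only [ContinuousLinearMap.coe_coe, ContinuousLinearMap.comp_apply,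
        ContinuousLinearMap.inr_apply, smul_eq_mul] at h2
      rw [hL.gf_raise hp, hL.gf_cartan hp, h2, Finset.mul_sum]
      exact Finset.sum_congr rfl fun m _ => by ring
    rw [h1]
  rw [fderiv_det (A := gMat L) (fun i j =>
    (hL.smooth_g i j).differentiableAt_infty hL.isOpen_slit hp) (hL.det_pos hp).ne']
  congr 1
  simp only [hc, Matrix.trace, Matrix.diag_apply, Matrix.mul_apply, Finset.mul_sum, Matrix.of_apply]
  refine Finset.sum_congr rfl fun i _ => Finset.sum_congr rfl fun h _ => ?_
  have h3 : fderiv ℝ (fun q => gMat L q h i) p (0, w) = D3 L p (0, w) (0, ei i) (0, ei h) := by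
    have := (hL.hasFDerivAt_g hp h i).fderiv
    have h4 := congrArg (fun φ => φ (0, w)) this
    rw [hL.D3_comm_right hp]
    exact h4
  rw [h3]
  change gInv L i h p.1 p.2 * _ = _
  ring

end LocalFinsler

/-! ### The trace of the quadratic relation -/

section Trace

variable {U : Set (E n)} {L L' : E n → E n → ℝ}

/-- The trace of the quadratic relation between two Finsler functions, at a unit vector `y`. -/
theorem trace_cartan_sub_cartan (hL : LocalFinsler U L) (hL' : LocalFinsler U L') {p : E n × E n}
    (hp : p ∈ U ×ˢ ({0}ᶜ : Set (E n))) (hunit : L p.1 p.2 = 1) {μ : E n →L[ℝ] ℝ}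
    (h : ∀ w, gf L p p.2 w = 0 → ∃ c : ℝ, cartan L' p w w - cartan L p w w - μ w • w = c • p.2)
    {w : E n} (hw : gf L p p.2 w = 0) :
    ∑ i, cartan L' p w (ei i) i - ∑ i, cartan L p w (ei i) i = n / 2 * μ w := by
  set R : E n → E n → E n := fun a b => cartan L' p a b - cartan L p a b with hR
  have R_add_left : ∀ a b c, R (a + b) c = R a c + R b c := fun a b c => by
    simp only [hR, cartan_add_left]; abel
  have R_add_right : ∀ a b c, R a (b + c) = R a b + R a c := fun a b c => by
    simp only [hR, cartan_add_right]; abel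
  have R_comm : ∀ a b, R a b = R b a := fun a b => by
    simp only [hR, hL.cartan_comm hp a b, hL'.cartan_comm hp a b]
  have R_self : ∀ a, R a p.2 = 0 := fun a => by
    simp only [hR, hL.cartan_self_right hp, hL'.cartan_self_right hp, sub_self]
  have R_smul : ∀ a (r : ℝ) b, R a (r • b) = r • R a b := fun a r b => by
    simp only [hR, cartan_smul_right, smul_sub]
  set η : E n → ℝ := gf L p p.2 with hη
  have η_self : η p.2 = 1 := by rw [hη, hL.gf_self hp, hunit]; norm_num
  -- polarization of the quadratic relation
  have hpol : ∀ v, η v = 0 →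
      ∃ c : ℝ, R w v = (1 / 2 : ℝ) • (μ w • v + μ v • w) + c • p.2 := by
    intro v hv
    obtain ⟨c1, h1⟩ := h (w + v) (by
      rw [hη, gf_add_right, ← hη, hw, hv, add_zero])
    obtain ⟨c2, h2⟩ := h w hw
    obtain ⟨c3, h3⟩ := h v hv
    refine ⟨(c1 - c2 - c3) / 2, ?_⟩
    change R (w + v) (w + v) - _ = _ at h1
    change R w w - _ = _ at h2
    change R v v - _ = _ at h3
    rw [R_add_left, R_add_right, R_add_right, R_comm v w, map_add] at h1
    have e : ((c1 - c2 - c3) / 2) • p.2 = (1 / 2 : ℝ) • (c1 • p.2 - c2 • p.2 - c3 • p.2) := by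
      module
    rw [e, ← h1, ← h2, ← h3]
    module
  -- the same for arbitrary vectors, by projecting along `y`
  have hall : ∀ v, R w v = (1 / 2 : ℝ) • (μ w • (v - η v • p.2) + μ (v - η v • p.2) • w) +
      η (R w v) • p.2 := by
    intro v
    have hv : η (v - η v • p.2) = 0 := by
      rw [sub_eq_add_neg, ← neg_smul, hη, gf_add_right, gf_smul_right]
      change η v + -η v * η p.2 = 0
      rw [η_self]; ring
    obtain ⟨c, hc⟩ := hpol _ hv
    have h1 : R w (v - η v • p.2) = R w v := by
      rw [sub_eq_add_neg, ← neg_smul, R_add_right, R_smul, R_self, smul_zero, add_zero]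
    rw [h1] at hc
    have h2 : η (R w v) = c := by
      rw [hc]
      simp only [hη, gf_add_right, gf_smul_right]
      change (1 / 2) * (μ w * η (v - η v • p.2) + _ * η w) + c * η p.2 = c
      rw [hv, η_self, show η w = 0 from hw]; ring
    rw [h2]
    exact hc
  have hsum : ∑ i, R w (ei i) i = n / 2 * μ w := by
    have hcoord : ∀ i, R w (ei i) i = (1 / 2) * (μ w * (1 - p.2 i * η (ei i)) +
        (w i * μ (ei i) - μ p.2 * (w i * η (ei i)))) + p.2 i * η (R w (ei i)) := by
      intro i
      conv_lhs => rw [hall (ei i)]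
      simp only [PiLp.add_apply, PiLp.smul_apply, PiLp.sub_apply, smul_eq_mul, map_sub, map_smul,
        PiLp.single_apply, if_true]
      ring
    have e1 : ∑ i, p.2 i * η (ei i) = 1 := by
      have h1 := linear_expand ((D2 L p (0, p.2)) ∘L ContinuousLinearMap.inr ℝ _ _).toLinearMap p.2
      rw [← η_self]
      exact h1.symm
    have e2 : ∑ i, w i * η (ei i) = 0 := by
      have h1 := linear_expand ((D2 L p (0, p.2)) ∘L ContinuousLinearMap.inr ℝ _ _).toLinearMap w
      rw [← hw]
      exact h1.symm
    have e3 : ∑ i, w i * μ (ei i) = μ w := (linear_expand μ.toLinearMap w).symm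
    have e4 : ∑ i, p.2 i * η (R w (ei i)) = 0 := by
      let φ : E n →ₗ[ℝ] ℝ :=
        { toFun := fun v => η (R w v)
          map_add' := fun a b => by rw [R_add_right, hη, gf_add_right]
          map_smul' := fun r a => by rw [R_smul, hη, gf_smul_right]; rfl }
      have h1 := linear_expand φ p.2
      have h2 : φ p.2 = 0 := by
        change η (R w p.2) = 0
        rw [R_self, ← zero_smul ℝ p.2, hη, gf_smul_right, zero_mul]
      rw [← h2]
      exact h1.symm
    rw [Finset.sum_congr rfl fun i _ => hcoord i, Finset.sum_add_distrib, e4, ← Finset.mul_sum,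
      Finset.sum_add_distrib, ← Finset.mul_sum, Finset.sum_sub_distrib, Finset.sum_sub_distrib, e1,
      e3, ← Finset.mul_sum, e2]
    simp
    ring
  rw [← hsum, ← Finset.sum_sub_distrib]
  exact Finset.sum_congr rfl fun i _ => by simp [hR]

end Trace

end Finsler

namespace Finsler

open Local Set

variable {n : ℕ}

/-! ### Pointwise proportionality of two Finsler functions -/

/-- The logarithm of the ratio of `(det g') (L')⁻³ⁿ` and `(det g) L⁻³ⁿ`, where `g` and `g'` are the
matrices of the fundamental tensors of `L` and `L'`. -/
def logRatio (L L' : E n → E n → ℝ) (p : E n × E n) : ℝ :=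
  (Real.log (gMat L' p).det - Real.log (gMat L p).det) -
    3 * n * (Real.log (L' p.1 p.2) - Real.log (L p.1 p.2))

theorem logRatio_swap (L L' : E n → E n → ℝ) (p : E n × E n) :
    logRatio L' L p = -logRatio L L' p := by
  simp only [logRatio]; ring

namespace LocalFinsler

variable {U : Set (E n)} {L L' : E n → E n → ℝ} (hL : LocalFinsler U L) {p : E n × E n}
  (hp : p ∈ U ×ˢ ({0}ᶜ : Set (E n)))
include hL hp

theorem fderiv_vertical (w : E n) :
    fderiv ℝ (fun q : E n × E n => L q.1 q.2) p (0, w) = gf L p p.2 w / L p.1 p.2 := by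
  have h := (hL.smooth.differentiableAt_infty hL.isOpen_slit hp).hasFDerivAt
  have h1 : HasFDerivAt (energy L) _ p := (h.pow 2).mul_const (1 / 2 : ℝ) |>.congr_of_eventuallyEq
    (Filter.Eventually.of_forall fun q => by simp only [energy]; ring)
  have h2 : D1 L p (0, w) = L p.1 p.2 * fderiv ℝ (fun q : E n × E n => L q.1 q.2) p (0, w) := by
    change fderiv ℝ (energy L) p (0, w) = _
    rw [h1.fderiv]
    simp
    ring
  rw [hL.gf_self_left hp, h2, mul_div_cancel_left₀ _ (hL.pos hp).ne']

theorem gMat_scale {r : ℝ} (hr : 0 < r) : gMat L (p.1, r • p.2) = gMat L p := by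
  ext i j
  exact (hL.g_eq (scale_mem hp hr) i j).trans
    ((hL.gf_scale hp hr _ _).trans (hL.g_eq hp i j).symm)

theorem logRatio_scale (hL' : LocalFinsler U L') {r : ℝ} (hr : 0 < r) :
    logRatio L L' (p.1, r • p.2) = logRatio L L' p := by
  simp only [logRatio, hL.gMat_scale hp hr, hL'.gMat_scale hp hr, hL.homog _ hp.1 _ r hr,
    hL'.homog _ hp.1 _ r hr, Real.log_mul hr.ne' (hL.pos hp).ne',
    Real.log_mul hr.ne' (hL'.pos hp).ne']
  ring

theorem cartan_self_left (w : E n) : cartan L p p.2 w = 0 := by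
  rw [hL.cartan_comm hp, hL.cartan_self_right hp]

theorem differentiableAt_logRatio (hL' : LocalFinsler U L') :
    DifferentiableAt ℝ (logRatio L L') p := by
  have d {K : E n → E n → ℝ} (hK : LocalFinsler U K) :=
    (hK.smooth_det.differentiableAt_infty hK.isOpen_slit hp).log (hK.det_pos hp).ne'
  have l {K : E n → E n → ℝ} (hK : LocalFinsler U K) :=
    (hK.smooth.differentiableAt_infty hK.isOpen_slit hp).log (hK.pos hp).ne'
  exact ((d hL').sub (d hL)).sub (((l hL').sub (l hL)).const_mul _)

theorem fderiv_logRatio (hL' : LocalFinsler U L') (w : E n) :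
    fderiv ℝ (logRatio L L') p (0, w) =
      2 * (∑ i, cartan L' p w (ei i) i - ∑ i, cartan L p w (ei i) i) -
        3 * n * (gf L' p p.2 w / L' p.1 p.2 ^ 2 - gf L p p.2 w / L p.1 p.2 ^ 2) := by
  have d {K : E n → E n → ℝ} (hK : LocalFinsler U K) :=
    (hK.smooth_det.differentiableAt_infty hK.isOpen_slit hp).hasFDerivAt.log (hK.det_pos hp).ne'
  have l {K : E n → E n → ℝ} (hK : LocalFinsler U K) :=
    (hK.smooth.differentiableAt_infty hK.isOpen_slit hp).hasFDerivAt.log (hK.pos hp).ne'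
  have h : HasFDerivAt (logRatio L L') _ p :=
    ((d hL').sub (d hL)).sub (((l hL').sub (l hL)).const_mul _)
  rw [h.fderiv]
  simp only [_root_.sub_apply, _root_.smul_apply, smul_eq_mul,
    hL.fderiv_det_gMat hp, hL'.fderiv_det_gMat hp, hL.fderiv_vertical hp, hL'.fderiv_vertical hp]
  have h1 := (hL.det_pos hp).ne'
  have h2 := (hL'.det_pos hp).ne'
  have h3 := (hL.pos hp).ne'
  have h4 := (hL'.pos hp).ne'
  field_simp

end LocalFinsler

section Fiber

variable {U : Set (E n)} {L L' : E n → E n → ℝ} (hL : LocalFinsler U L) (hL' : LocalFinsler U L')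
include hL hL'

/-- At unit vectors, the quadratic relation makes `logRatio` stationary along the fibre. -/
theorem fderiv_logRatio_eq_zero {p : E n × E n} (hp : p ∈ U ×ˢ ({0}ᶜ : Set (E n)))
    (hunit : L p.1 p.2 = 1)
    (h : ∀ w, gf L p p.2 w = 0 → ∃ c : ℝ, cartan L' p w w - cartan L p w w -
      (3 * fderiv ℝ (fun q : E n × E n => L' q.1 q.2) p (0, w) / L' p.1 p.2) • w = c • p.2)
    (u : E n) : fderiv ℝ (logRatio L L') p (0, u) = 0 := by
  have hL'0 := (hL'.pos hp).ne'
  -- vectors orthogonal to `y`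
  have horth : ∀ w, gf L p p.2 w = 0 → fderiv ℝ (logRatio L L') p (0, w) = 0 := by
    intro w hw
    have h1 := trace_cartan_sub_cartan hL hL' hp hunit
      (μ := (3 / L' p.1 p.2) • (fderiv ℝ (fun q : E n × E n => L' q.1 q.2) p ∘L
        ContinuousLinearMap.inr ℝ _ _)) (fun v hv => by
          obtain ⟨c, hc⟩ := h v hv
          refine ⟨c, ?_⟩
          rw [← hc]
          congr 2
          change 3 / L' p.1 p.2 * fderiv ℝ (fun q : E n × E n => L' q.1 q.2) p (0, v) = _
          ring) hw
    rw [hL.fderiv_logRatio hp hL', h1, hw]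
    change 2 * (n / 2 * (3 / L' p.1 p.2 * fderiv ℝ (fun q : E n × E n => L' q.1 q.2) p (0, w))) -
      _ = 0
    rw [hL'.fderiv_vertical hp]
    field_simp
    ring
  -- the direction of `y`
  have hself : fderiv ℝ (logRatio L L') p (0, p.2) = 0 := by
    rw [hL.fderiv_logRatio hp hL', hL.gf_self hp, hL'.gf_self hp]
    simp only [hL.cartan_self_left hp, hL'.cartan_self_left hp]
    rw [div_self (pow_ne_zero 2 hL'0), div_self (pow_ne_zero 2 (hL.pos hp).ne')]
    simp
  have hdec : ((0 : E n), u) = (0, u - gf L p p.2 u • p.2) + gf L p p.2 u • (0, p.2) := by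
    ext <;> simp
  rw [hdec, map_add, map_smul, hself, smul_zero, add_zero]
  refine horth _ ?_
  rw [sub_eq_add_neg, ← neg_smul, gf_add_right, gf_smul_right, hL.gf_self hp, hunit]
  ring

/-- The function `logRatio` is constant on the fibre over `x`. -/
theorem exists_logRatio_eq (hn : 2 ≤ n) {x : E n} (hx : x ∈ U)
    (h : ∀ y ≠ 0, L x y = 1 → ∀ w, gf L (x, y) y w = 0 →
      ∃ c : ℝ, cartan L' (x, y) w w - cartan L (x, y) w w -
      (3 * fderiv ℝ (fun q : E n × E n => L' q.1 q.2) (x, y) (0, w) / L' x y) • w = c • y) :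
    ∃ K : ℝ, ∀ y ≠ 0, logRatio L L' (x, y) = K := by
  have hd : ∀ y : E n, y ≠ 0 →
      HasFDerivAt (fun z => logRatio L L' (x, z)) (fderiv ℝ (logRatio L L') (x, y) ∘L
        ContinuousLinearMap.inr ℝ _ _) y := fun y hy =>
    hasFDerivAt_comp_of (hL.differentiableAt_logRatio (p := (x, y)) ⟨hx, hy⟩ hL').hasFDerivAt
      ((hasFDerivAt_const x y).prodMk (hasFDerivAt_id y)) rfl
  have hzero : ∀ y : E n, y ≠ 0 → fderiv ℝ (fun z => logRatio L L' (x, z)) y = 0 := by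
    intro y hy
    set r := L x y with hr
    have hrpos : 0 < r := hL.pos (p := (x, y)) ⟨hx, hy⟩
    -- the function is invariant under the homothety carrying the unit vector `r⁻¹ y` to `y`
    have hy1 : r⁻¹ • y ≠ 0 := smul_ne_zero (inv_pos.2 hrpos).ne' hy
    have e : r • r⁻¹ • y = y := by rw [smul_smul, mul_inv_cancel₀ hrpos.ne', one_smul]
    have hu : L x (r⁻¹ • y) = 1 := by
      rw [hL.homog _ hx _ _ (inv_pos.2 hrpos), ← hr, inv_mul_cancel₀ hrpos.ne']
    have h1 : HasFDerivAt (fun z : E n => logRatio L L' (x, r • z))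
        ((fderiv ℝ (fun z => logRatio L L' (x, z)) y) ∘L
          (r • ContinuousLinearMap.id ℝ (E n))) (r⁻¹ • y) :=
      hasFDerivAt_comp_of (c := fun z => logRatio L L' (x, z)) (φ := fun z : E n => r • z)
        (by rw [e]; exact (hd y hy).differentiableAt.hasFDerivAt)
        ((hasFDerivAt_id (r⁻¹ • y)).const_smul r) rfl
    have h2 := (hd _ hy1).congr_of_eventuallyEq (f₁ := fun z : E n => logRatio L L' (x, r • z)) (by
      filter_upwards [isOpen_compl_singleton.mem_nhds hy1] with z hz
      exact hL.logRatio_scale (p := (x, z)) ⟨hx, hz⟩ hL' hrpos)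
    ext u
    have h3 := congrArg (fun φ => φ (r⁻¹ • u)) (h1.unique h2)
    have h4 := fderiv_logRatio_eq_zero hL hL' (p := (x, r⁻¹ • y)) ⟨hx, hy1⟩ hu
      (h _ hy1 hu) (r⁻¹ • u)
    simp only [ContinuousLinearMap.comp_apply, ContinuousLinearMap.inr_apply, h4] at h3
    have h5 : (r • ContinuousLinearMap.id ℝ (E n)) (r⁻¹ • u) = u := by
      change r • r⁻¹ • u = u
      rw [smul_smul, mul_inv_cancel₀ hrpos.ne', one_smul]
    rw [h5] at h3
    exact h3
  have hrank : 1 < Module.rank ℝ (E n) := by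
    rw [← Module.finrank_eq_rank, finrank_euclideanSpace_fin]
    exact_mod_cast hn
  have hconn := isConnected_compl_singleton_of_one_lt_rank hrank (0 : E n)
  obtain ⟨y0, hy0⟩ := hconn.nonempty
  refine ⟨logRatio L L' (x, y0), fun y hy => ?_⟩
  exact isOpen_compl_singleton.is_const_of_fderiv_eq_zero (𝕜 := ℝ) hconn.isPreconnected
    (fun z hz => (hd z hz).differentiableAt.differentiableWithinAt) (fun z hz => hzero z hz) hy hy0

/-- If `c L² - (L')²` is nonnegative on a fibre and vanishes at `y`, then its Hessian at `y` is
positive semidefinite. -/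
theorem gf_le_of_energy_le {x y : E n} (hx : x ∈ U) (hy : y ≠ 0) {c : ℝ}
    (hle : ∀ z ≠ 0, energy L' (x, z) ≤ c * energy L (x, z))
    (heq : energy L' (x, y) = c * energy L (x, y)) (v : E n) :
    gf L' (x, y) v v ≤ c * gf L (x, y) v v := by
  by_contra! hlt
  set f : ℝ → ℝ := fun t => c * energy L (x, y + t • v) - energy L' (x, y + t • v) with hf
  have hγ : ∀ t : ℝ, HasDerivAt (fun t : ℝ => (x, y + t • v)) ((0 : E n), v) t := fun t => by
    simpa using (hasDerivAt_const t x).prodMk (((hasDerivAt_id t).smul_const v).const_add y)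
  have hne : ∀ᶠ t : ℝ in nhds 0, y + t • v ≠ 0 := by
    have : ContinuousAt (fun t : ℝ => y + t • v) 0 := by fun_prop
    exact this.eventually_ne (by simpa using hy)
  have hd1 : ∀ t : ℝ, y + t • v ≠ 0 → HasDerivAt f
      (c * D1 L (x, y + t • v) (0, v) - D1 L' (x, y + t • v) (0, v)) t := by
    intro t ht
    have d {K : E n → E n → ℝ} (hK : LocalFinsler U K) :=
      hasDerivAt_comp_of (γ := fun t : ℝ => (x, y + t • v))
        (hK.smooth_energy.differentiableAt_infty hK.isOpen_slit
          (p := (x, y + t • v)) ⟨hx, ht⟩).hasFDerivAt (hγ t)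
    exact ((d hL).const_mul c).sub (d hL')
  have hd2 : HasDerivAt (deriv f) (c * gf L (x, y) v v - gf L' (x, y) v v) 0 := by
    have d {K : E n → E n → ℝ} (hK : LocalFinsler U K) :
        HasDerivAt (fun t : ℝ => D1 K (x, y + t • v) (0, v)) (gf K (x, y) v v) 0 := by
      have h1 := hasDerivAt_comp_of (γ := fun t : ℝ => (x, y + t • v)) (t := 0)
        (hK.hasFDerivAt_D1 (p := (x, y + (0 : ℝ) • v)) ⟨hx, by simpa using hy⟩) (hγ 0)
      have h2 := h1.clm_apply (hasDerivAt_const (0 : ℝ) ((0 : E n), v))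
      simpa [gf] using h2
    refine (((d hL).const_mul c).sub (d hL')).congr_of_eventuallyEq ?_
    filter_upwards [hne] with t ht using (hd1 t ht).deriv
  have hf0 : f 0 = 0 := by simp [hf, heq]
  have hmin : IsLocalMin f 0 := by
    filter_upwards [hne] with t ht
    rw [hf0]
    exact sub_nonneg.2 (hle _ ht)
  have hmax : IsLocalMax f 0 := isLocalMax_of_deriv_deriv_neg (by rw [hd2.deriv]; linarith)
    hmin.deriv_eq_zero (hd1 0 (by simpa using hy)).continuousAt
  -- `f` is locally constant, contradicting `f'' 0 < 0`
  have hconst : f =ᶠ[nhds 0] fun _ => f 0 := by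
    filter_upwards [hmin, hmax] with t h1 h2 using le_antisymm h2 h1
  have h0 : deriv (deriv f) 0 = 0 := by
    rw [hconst.deriv.deriv_eq]
    simp
  rw [hd2.deriv] at h0
  linarith

/-- At a maximum of `L' / L` over the fibre, the Hessians of the energies compare, hence so do the
determinants; this bounds `logRatio`. -/
theorem logRatio_le {x : E n} (hx : x ∈ U) {K : ℝ}
    (hK : ∀ y ≠ 0, logRatio L L' (x, y) = K) {y : E n} (hy : y ≠ 0) :
    K ≤ -(n * (Real.log (L' x y) - Real.log (L x y))) := by
  set f : E n → ℝ := fun z => Real.log (L' x z) - Real.log (L x z) with hf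
  have hcont : ContinuousOn f (Metric.sphere 0 1) := by
    have hz0 : ∀ z ∈ Metric.sphere (0 : E n) 1, (x, z) ∈ U ×ˢ ({0}ᶜ : Set (E n)) :=
      fun z hz => ⟨hx, Metric.ne_of_mem_sphere hz one_ne_zero⟩
    have d {K : E n → E n → ℝ} (hK : LocalFinsler U K) :
        ContinuousOn (fun z => Real.log (K x z)) (Metric.sphere 0 1) :=
      ContinuousOn.log ((hK.smooth.continuousOn).comp (f := fun z => (x, z)) (by fun_prop) hz0)
        fun z hz => (hK.pos (hz0 z hz)).ne'
    exact (d hL').sub (d hL)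
  have hnorm : ∀ z : E n, z ≠ 0 → ‖z‖⁻¹ • z ∈ Metric.sphere (0 : E n) 1 := fun z hz => by
    rw [mem_sphere_zero_iff_norm, norm_smul, norm_inv, norm_norm,
      inv_mul_cancel₀ (norm_ne_zero_iff.2 hz)]
  have hscale : ∀ z : E n, z ≠ 0 → f (‖z‖⁻¹ • z) = f z := fun z hz => by
    have h0 : 0 < ‖z‖⁻¹ := inv_pos.2 (norm_pos_iff.2 hz)
    have h1 := (hL.pos (p := (x, z)) ⟨hx, hz⟩).ne'
    have h2 := (hL'.pos (p := (x, z)) ⟨hx, hz⟩).ne'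
    simp only [hf, hL.homog _ hx _ _ h0, hL'.homog _ hx _ _ h0]
    rw [Real.log_mul h0.ne' h2, Real.log_mul h0.ne' h1]
    ring
  -- a maximum on the Euclidean unit sphere is a maximum on the fibre, by homogeneity
  obtain ⟨y1, hy1, hmax⟩ := (isCompact_sphere (0 : E n) 1).exists_isMaxOn ⟨_, hnorm y hy⟩ hcont
  have hy10 : y1 ≠ 0 := Metric.ne_of_mem_sphere hy1 one_ne_zero
  have hle : ∀ z ≠ 0, f z ≤ f y1 := fun z hz => by
    rw [← hscale z hz]; exact hmax (hnorm z hz)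
  have hL'f : ∀ z ≠ 0, L' x z = Real.exp (f z) * L x z := fun z hz => by
    have h1 := hL.pos (p := (x, z)) ⟨hx, hz⟩
    have h2 := hL'.pos (p := (x, z)) ⟨hx, hz⟩
    rw [hf, Real.exp_sub, Real.exp_log h1, Real.exp_log h2, div_mul_cancel₀ _ h1.ne']
  set ρ := Real.exp (f y1) with hρ
  have hp : (x, y1) ∈ U ×ˢ ({0}ᶜ : Set (E n)) := ⟨hx, hy10⟩
  have hgf : ∀ v, gf L' (x, y1) v v ≤ ρ ^ 2 * gf L (x, y1) v v := by
    refine gf_le_of_energy_le hL hL' hx hy10 (fun z hz => ?_) ?_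
    · simp only [energy, hL'f z hz]
      have h1 := (hL.pos (p := (x, z)) ⟨hx, hz⟩).le
      have h2 : Real.exp (f z) ≤ ρ := Real.exp_le_exp.2 (hle z hz)
      have h3 : (Real.exp (f z) * L x z) ^ 2 ≤ (ρ * L x z) ^ 2 := by gcongr
      linarith [mul_pow ρ (L x z) 2]
    · simp only [energy, hL'f y1 hy10]; ring
  have hρ0 : 0 < ρ := Real.exp_pos _
  have hdet : (gMat L' (x, y1)).det ≤ (ρ ^ 2) ^ n * (gMat L (x, y1)).det := by
    have h1 : (ρ ^ 2 • gMat L (x, y1)).PosDef := (hL.posDef_gMat hp).smul (by positivity)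
    have h2 := det_le_det_of_posDef (hL'.posDef_gMat hp) h1 fun v => by
      have h3 := hgf (WithLp.toLp 2 v)
      rw [hL.gf_eq_dotProduct hp, hL'.gf_eq_dotProduct hp] at h3
      rw [Matrix.smul_mulVec, dotProduct_smul]
      exact h3
    rwa [Matrix.det_smul, Fintype.card_fin] at h2
  have hlog := Real.log_le_log (hL'.det_pos hp) hdet
  rw [Real.log_mul (by positivity) (hL.det_pos hp).ne', Real.log_pow, Real.log_pow, hρ,
    Real.log_exp] at hlog
  have h1 := hK y1 hy10
  simp only [logRatio] at h1
  change _ - 3 * n * f y1 = K at h1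
  have h2 : (n : ℝ) * f y ≤ n * f y1 := mul_le_mul_of_nonneg_left (hle y hy) (Nat.cast_nonneg n)
  change K ≤ -(n * f y)
  push_cast at hlog
  nlinarith

/-- Two Finsler functions satisfying the quadratic relation over `x` are proportional there. -/
theorem exists_log_sub_log_eq (hn : 2 ≤ n) {x : E n} (hx : x ∈ U)
    (h : ∀ y ≠ 0, L x y = 1 → ∀ w, gf L (x, y) y w = 0 →
      ∃ c : ℝ, cartan L' (x, y) w w - cartan L (x, y) w w -
      (3 * fderiv ℝ (fun q : E n × E n => L' q.1 q.2) (x, y) (0, w) / L' x y) • w = c • y) :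
    ∃ σ : ℝ, ∀ y ≠ 0, Real.log (L' x y) - Real.log (L x y) = σ := by
  obtain ⟨K, hK⟩ := exists_logRatio_eq hL hL' hn hx h
  refine ⟨-K / n, fun y hy => ?_⟩
  have h1 := logRatio_le hL hL' hx hK hy
  have h2 := logRatio_le hL' hL hx (K := -K) (fun z hz => by rw [logRatio_swap, hK z hz]) hy
  have hn0 : (n : ℝ) ≠ 0 := by positivity
  rw [eq_div_iff hn0]
  linarith

end Fiber

end Finsler

namespace Finsler

open Set

variable {n : ℕ} {M M' : Type*}
  [TopologicalSpace M] [ChartedSpace (E n) M] [IsManifold 𝓘(ℝ, E n) ∞ M]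
  [TopologicalSpace M'] [ChartedSpace (E n) M'] [IsManifold 𝓘(ℝ, E n) ∞ M']

/-! ### Maps preserving geodesic circles -/

section

variable {φ : M → M'} (hφ : IsLocalDiffeomorph 𝓘(ℝ, E n) 𝓘(ℝ, E n) ∞ φ)
include hφ

omit [IsManifold 𝓘(ℝ, E n) ∞ M] [IsManifold 𝓘(ℝ, E n) ∞ M'] in
/-- The differential of a local diffeomorphism, as an automorphism of the model space. -/
theorem exists_equiv_mfderiv (p : M) :
    ∃ A : E n ≃L[ℝ] E n, ∀ u : E n, A u = mfderiv 𝓘(ℝ, E n) 𝓘(ℝ, E n) φ p u :=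
  ⟨hφ.mfderivToContinuousLinearEquiv (by simp) p, fun u => by
    have := hφ.mfderivToContinuousLinearEquiv_coe (by simp) (x := p)
    exact congrArg (fun ψ : E n →L[ℝ] E n => ψ u) this⟩

omit [IsManifold 𝓘(ℝ, E n) ∞ M] [IsManifold 𝓘(ℝ, E n) ∞ M'] in
theorem mfderiv_comp_localParam {U : Set (E n)} {κ : E n → M} (hκ : IsLocalParam U κ) {x : E n}
    (hx : x ∈ U) (u : E n) : mfderiv 𝓘(ℝ, E n) 𝓘(ℝ, E n) (φ ∘ κ) x u =
      mfderiv 𝓘(ℝ, E n) 𝓘(ℝ, E n) φ (κ x) (mfderiv 𝓘(ℝ, E n) 𝓘(ℝ, E n) κ x u) := by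
  have h := mfderiv_comp x (hφ.mdifferentiable (by simp) (κ x)) (hκ.mdifferentiableAt hx)
  exact congrArg (fun ψ : E n →L[ℝ] E n => ψ u) h

omit [IsManifold 𝓘(ℝ, E n) ∞ M] [IsManifold 𝓘(ℝ, E n) ∞ M'] in
/-- Composition of a local parametrization with a local diffeomorphism. In these coordinates the
local diffeomorphism is the identity. -/
theorem IsLocalParam.comp {U : Set (E n)} {κ : E n → M} (hκ : IsLocalParam U κ) :
    IsLocalParam U (φ ∘ κ) where
  isOpen := hκ.isOpen
  smooth := hφ.contMDiff.comp_contMDiffOn hκ.smooth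
  injective x hx := by
    intro a b hab
    obtain ⟨A, hA⟩ := exists_equiv_mfderiv hφ (κ x)
    have h : ∀ u : E n, mfderiv 𝓘(ℝ, E n) 𝓘(ℝ, E n) (φ ∘ κ) x u =
        A (mfderiv 𝓘(ℝ, E n) 𝓘(ℝ, E n) κ x u) := fun u =>
      (mfderiv_comp_localParam hφ hκ hx u).trans (hA _).symm
    exact hκ.injective x hx (A.injective ((h a).symm.trans (hab.trans (h b))))

end

variable {Φ : FinslerStructure n M} {Φ' : FinslerStructure n M'} {φ : M → M'}
  (hφ : IsLocalDiffeomorph 𝓘(ℝ, E n) 𝓘(ℝ, E n) ∞ φ)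
include hφ

/-- A map preserving geodesic circles, tested on the circle with given initial velocity `y` and
initial curvature vector `w`. -/
theorem exists_circleDefect_eq (hpres : PreservesGeodesicCircles Φ Φ' φ) {U : Set (E n)}
    {κ : E n → M} (hκ : IsLocalParam U κ) {x₀ y₀ w₀ : E n} (hx₀ : x₀ ∈ U) (hy₀ : y₀ ≠ 0)
    (hunit : pullF Φ.F κ x₀ y₀ = 1) (hw₀ : w₀ ≠ 0)
    (hperp : gf (pullF Φ.F κ) (x₀, y₀) y₀ w₀ = 0) :
    ∃ c : ℝ, circleDefect (pullF Φ.F κ) (pullF Φ'.F (φ ∘ κ)) (x₀, y₀) w₀ = c • y₀ := by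
  have hL := hκ.localFinsler Φ
  have hκ' := hκ.comp hφ
  have hL' := hκ'.localFinsler Φ'
  obtain ⟨ε, hε, k, hk, x, w, hx0, hxd0, hw0, hxs, hws, h⟩ :=
    hL.exists_circle hx₀ hunit hy₀ hw₀ hperp
  obtain ⟨J, s, hs, hs', hsJ, hcirc⟩ := hpres _ _ (hκ.isGeodesicCircle Φ hk hxs hws h)
  have hsI : ∀ t ∈ J, s t ∈ Ioo (-ε) ε := fun t ht => hsJ ▸ mem_image_of_mem s ht
  obtain ⟨t, ht, hst⟩ : (0 : ℝ) ∈ s '' J := by rw [hsJ]; constructor <;> linarith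
  have hJ := hcirc.isOpen
  set z : ℝ → E n := fun τ => x (s τ) with hz
  have hcirc' : IsGeodesicCircle Φ' ((φ ∘ κ) ∘ z) J := hcirc
  have hzs : ContDiffOn ℝ ∞ z J := hxs.comp hs hsI
  have hzU : ∀ τ ∈ J, z τ ∈ U := fun τ hτ => (h _ (hsI τ hτ)).1
  have hzd : ∀ τ ∈ J, deriv z τ ≠ 0 := fun τ hτ => by
    rw [(covDeriv_velocity_comp hL hL' isOpen_Ioo hJ hxs hs
      (fun σ hσ => ⟨(h σ hσ).1, (h σ hσ).2.1, (h σ hσ).2.2.2.1⟩) hs' hsI hτ).2.1]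
    exact smul_ne_zero (hs' τ hτ).ne' (h _ (hsI τ hτ)).2.1
  have hzd1 := ((contDiffOn_infty_iff_deriv_of_isOpen hJ).1 hzs).2
  have hzd2 := ((contDiffOn_infty_iff_deriv_of_isOpen hJ).1 hzd1).2
  have hWs : ContDiffOn ℝ ∞
      (Local.covDeriv (pullF Φ'.F (φ ∘ κ)) z (deriv z)) J := by
    have h1 := hL'.smooth_spray.comp (f := fun τ => (z τ, deriv z τ)) (hzs.prodMk hzd1)
      fun τ hτ => ⟨hzU τ hτ, hzd τ hτ⟩
    exact (hzd2.add h1).congr fun τ hτ => hL'.covDeriv_velocity (hzU τ hτ) (hzd τ hτ)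
  obtain ⟨r, hr⟩ := hκ'.exists_covDeriv_eq_smul Φ' hzs hzU hzd (fun _ _ => rfl) hWs hcirc' ht
  have hu : ∀ τ ∈ J, pullF Φ'.F (φ ∘ κ) (x (s τ)) (deriv z τ) = 1 := fun τ hτ => by
    rw [← hcirc'.unitSpeed τ hτ,
      hκ'.F_velocity Φ' (hzU τ hτ) (hzs.differentiableAt_infty hJ hτ)]
  have := circleDefect_eq_smul hL hL' isOpen_Ioo hJ hxs hws hs
    (fun σ hσ => ⟨(h σ hσ).1, (h σ hσ).2.1, (h σ hσ).2.2.2.1⟩)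
    (fun σ hσ => (h σ hσ).2.2.2.2.1) hs' hsI hu ht hr
  rwa [hst, hx0, hxd0, hw0] at this

/-- A local diffeomorphism preserving geodesic circles multiplies the Finsler function on each
tangent space by a constant. -/
theorem exists_F_eq_exp_mul (hn : 2 ≤ n) (hpres : PreservesGeodesicCircles Φ Φ' φ) (p : M) :
    ∃ σ : ℝ, ∀ y : E n, y ≠ 0 → Φ'.F ⟨φ p, mfderiv 𝓘(ℝ, E n) 𝓘(ℝ, E n) φ p y⟩ =
      Real.exp σ * Φ.F ⟨p, y⟩ := by
  have hκ := isLocalParam_extChartAt_symm (n := n) p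
  set κ := (extChartAt 𝓘(ℝ, E n) p).symm with hκd
  set x := extChartAt 𝓘(ℝ, E n) p p with hxd
  have hx : x ∈ (extChartAt 𝓘(ℝ, E n) p).target := mem_extChartAt_target p
  have hκx : κ x = p := extChartAt_to_inv p
  have hL := hκ.localFinsler Φ
  have hL' := (hκ.comp hφ).localFinsler Φ'
  obtain ⟨σ, hσ⟩ := exists_log_sub_log_eq hL hL' hn hx fun y hy hunit w hw =>
    cartan_sub_cartan (p := (x, y)) (fun w hw0 hw =>
      exists_circleDefect_eq hφ hpres hκ hx hy hunit hw0 hw) hw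
  refine ⟨σ, fun y hy => ?_⟩
  obtain ⟨A, hA⟩ := hκ.exists_equiv hx
  have hz : A.symm y ≠ 0 := fun h => hy (by simpa using congrArg A h)
  have h1 := hL.pos (p := (x, A.symm y)) ⟨hx, hz⟩
  have h2 := hL'.pos (p := (x, A.symm y)) ⟨hx, hz⟩
  have h3 : pullF Φ'.F (φ ∘ κ) x (A.symm y) = Real.exp σ * pullF Φ.F κ x (A.symm y) := by
    rw [← hσ _ hz, Real.exp_sub, Real.exp_log h1, Real.exp_log h2, div_mul_cancel₀ _ h1.ne']
  have hAy : mfderiv 𝓘(ℝ, E n) 𝓘(ℝ, E n) κ x (A.symm y) = y :=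
    (hA _).symm.trans (A.apply_symm_apply y)
  have hAy' : mfderiv 𝓘(ℝ, E n) 𝓘(ℝ, E n) (φ ∘ κ) x (A.symm y) =
      mfderiv 𝓘(ℝ, E n) 𝓘(ℝ, E n) φ (κ x) y := by
    rw [mfderiv_comp_localParam hφ hκ hx]
    exact congrArg _ hAy
  have h4 : pullF Φ.F κ x (A.symm y) = Φ.F ⟨κ x, y⟩ :=
    congrArg (fun v : E n => Φ.F ⟨κ x, v⟩) hAy
  have h5 : pullF Φ'.F (φ ∘ κ) x (A.symm y) =
      Φ'.F ⟨φ (κ x), mfderiv 𝓘(ℝ, E n) 𝓘(ℝ, E n) φ (κ x) y⟩ :=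
    congrArg (fun v : E n => Φ'.F ⟨φ (κ x), v⟩) hAy'
  rw [h4, h5, hκx] at h3
  exact h3

/-- If `φ^* F' = e^σ F`, then `σ` is smooth. -/
theorem contMDiff_of_F_eq_exp_mul (hn : 2 ≤ n) {σ : M → ℝ} (h : ∀ (p : M) (y : E n), y ≠ 0 →
    Φ'.F ⟨φ p, mfderiv 𝓘(ℝ, E n) 𝓘(ℝ, E n) φ p y⟩ = Real.exp (σ p) * Φ.F ⟨p, y⟩) :
    ContMDiff 𝓘(ℝ, E n) 𝓘(ℝ, ℝ) ∞ σ := by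
  intro p
  have hκ := isLocalParam_extChartAt_symm (n := n) p
  set κ := (extChartAt 𝓘(ℝ, E n) p).symm with hκd
  set U := (extChartAt 𝓘(ℝ, E n) p).target with hU
  have hL := hκ.localFinsler Φ
  have hL' := (hκ.comp hφ).localFinsler Φ'
  -- `σ` is computed with a vector field which is constant in the chart
  let e : E n := ei ⟨0, by omega⟩
  have he : e ≠ 0 := by
    intro h0
    have := congrArg (fun v : E n => v ⟨0, by omega⟩) h0
    simp [e] at this
  have hsm : ContDiffOn ℝ ∞ (fun x => Real.log (pullF Φ'.F (φ ∘ κ) x e) -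
      Real.log (pullF Φ.F κ x e)) U := by
    have d {K : E n → E n → ℝ} (hK : LocalFinsler U K) :
        ContDiffOn ℝ ∞ (fun x => Real.log (K x e)) U :=
      ContDiffOn.log (hK.smooth.comp (f := fun x => (x, e)) (by fun_prop) fun x hx => ⟨hx, he⟩)
        fun x hx => (hK.pos (p := (x, e)) ⟨hx, he⟩).ne'
    exact (d hL').sub (d hL)
  have hσ : ∀ x ∈ U, σ (κ x) = Real.log (pullF Φ'.F (φ ∘ κ) x e) -
      Real.log (pullF Φ.F κ x e) := by
    intro x hx
    have h1 := hL.pos (p := (x, e)) ⟨hx, he⟩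
    have h2 : mfderiv 𝓘(ℝ, E n) 𝓘(ℝ, E n) κ x e ≠ 0 := fun h0 =>
      he (hκ.injective x hx (h0.trans (map_zero _).symm))
    have h3 : pullF Φ'.F (φ ∘ κ) x e = Real.exp (σ (κ x)) * pullF Φ.F κ x e :=
      (congrArg (fun v : E n => Φ'.F ⟨φ (κ x), v⟩) (mfderiv_comp_localParam hφ hκ hx e)).trans
        (h (κ x) _ h2)
    rw [h3, Real.log_mul (Real.exp_pos _).ne' h1.ne', Real.log_exp]
    ring
  have hcomp := (contMDiffOn_iff_contDiffOn.2 hsm).comp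
    (contMDiffOn_extChartAt (I := 𝓘(ℝ, E n)) (n := ∞) (x := p)) fun q hq =>
      (extChartAt 𝓘(ℝ, E n) p).map_source (by simpa using hq)
  refine (hcomp.contMDiffAt ((chartAt (E n) p).open_source.mem_nhds
    (mem_chart_source (E n) p))).congr_of_eventuallyEq ?_
  filter_upwards [extChartAt_source_mem_nhds (I := 𝓘(ℝ, E n)) p] with q hq
  rw [Function.comp_apply, ← hσ _ ((extChartAt 𝓘(ℝ, E n) p).map_source hq)]
  congr 1
  exact ((extChartAt 𝓘(ℝ, E n) p).left_inv hq).symm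

omit hφ in
theorem FinslerStructure.F_zero (Φ : FinslerStructure n M) (p : M) :
    Φ.F ⟨p, (0 : E n)⟩ = 0 := by
  have h := Φ.homog p (0 : E n) 2 two_pos
  have h0 : (2 : ℝ) • (0 : E n) = 0 := smul_zero _
  have h1 : Φ.F ⟨p, (0 : E n)⟩ = 2 * Φ.F ⟨p, (0 : E n)⟩ :=
    (congrArg (fun v : E n => Φ.F ⟨p, v⟩) h0).symm.trans h
  linarith

/-- If `φ^* F' = e^σ F` on `T_pM`, then `φ^* g' = e^{2σ} g` there. -/
theorem fundamentalTensor_eq_exp_mul {p : M} {σ : ℝ} (h : ∀ y : E n, y ≠ 0 →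
    Φ'.F ⟨φ p, mfderiv 𝓘(ℝ, E n) 𝓘(ℝ, E n) φ p y⟩ = Real.exp σ * Φ.F ⟨p, y⟩)
    (y u v : TangentSpace 𝓘(ℝ, E n) p) :
    fundamentalTensor Φ'.F (φ p) (mfderiv 𝓘(ℝ, E n) 𝓘(ℝ, E n) φ p y)
      (mfderiv 𝓘(ℝ, E n) 𝓘(ℝ, E n) φ p u) (mfderiv 𝓘(ℝ, E n) 𝓘(ℝ, E n) φ p v) =
    Real.exp (2 * σ) * fundamentalTensor Φ.F p y u v := by
  obtain ⟨A, hA⟩ := exists_equiv_mfderiv hφ p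
  have h1 := fundamentalTensor_linear Φ'.F (φ p) A y u v
  rw [hA y, hA u, hA v] at h1
  rw [← h1]
  have h2 : (fun w : E n => Φ'.F ⟨φ p, A w⟩ ^ 2) =
      Real.exp (2 * σ) • fun w : E n => Φ.F ⟨p, w⟩ ^ 2 := by
    ext w
    change Φ'.F ⟨φ p, A w⟩ ^ 2 = Real.exp (2 * σ) * Φ.F ⟨p, w⟩ ^ 2
    by_cases hw : w = 0
    · rw [hw, map_zero]
      have e1 : Φ.F ⟨p, (0 : E n)⟩ = 0 := Φ.F_zero p
      have e2 : Φ'.F ⟨φ p, (0 : E n)⟩ = 0 := Φ'.F_zero (φ p)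
      refine (congrArg (· ^ 2) e2).trans (Eq.trans ?_ (congrArg (Real.exp (2 * σ) * · ^ 2) e1).symm)
      simp
    · have h3 : Φ'.F ⟨φ p, A w⟩ = Real.exp σ * Φ.F ⟨p, w⟩ := by
        rw [← h w hw, ← hA w]
      rw [h3, mul_pow, ← Real.exp_nat_mul]
      norm_num
  rw [h2]
  simp only [fderiv_const_smul_field]
  change (1 / 2) * fderiv ℝ (Real.exp (2 * σ) • fun z : E n =>
    fderiv ℝ (fun w : E n => Φ.F ⟨p, w⟩ ^ 2) z u) y v = _
  rw [fderiv_const_smul_field, fundamentalTensor]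
  exact mul_left_comm _ _ _

theorem isConformal_of_preservesGeodesicCircles (hn : 2 ≤ n)
    (hpres : PreservesGeodesicCircles Φ Φ' φ) : IsConformal Φ Φ' φ := by
  choose σ hσ using exists_F_eq_exp_mul hφ hn hpres
  exact ⟨σ, contMDiff_of_F_eq_exp_mul hφ hn hσ, fun p y u v _ =>
    fundamentalTensor_eq_exp_mul hφ (hσ p) y u v⟩

end Finsler

end

theorem theorem2 {n : ℕ} (hn : 2 ≤ n) {M M' : Type*}
    [TopologicalSpace M] [ChartedSpace (Finsler.E n) M] [IsManifold 𝓘(ℝ, Finsler.E n) ∞ M]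
    [TopologicalSpace M'] [ChartedSpace (Finsler.E n) M'] [IsManifold 𝓘(ℝ, Finsler.E n) ∞ M']
    (Φ : Finsler.FinslerStructure n M) (Φ' : Finsler.FinslerStructure n M')
    (φ : M → M') (hφ : IsLocalDiffeomorph 𝓘(ℝ, Finsler.E n) 𝓘(ℝ, Finsler.E n) ∞ φ) :
    (Finsler.PreservesGeodesicCircles Φ Φ' φ → Finsler.IsConformal Φ Φ' φ) ∧
      (Finsler.IsConcircular Φ Φ' φ ↔ Finsler.PreservesGeodesicCircles Φ Φ' φ) :=
  ⟨Finsler.isConformal_of_preservesGeodesicCircles hφ hn,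
    And.right, fun h => ⟨Finsler.isConformal_of_preservesGeodesicCircles hφ hn h, h⟩⟩
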